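/- **Lemma.** Let $W$ be a simply connected compact (Hausdorff) topological $5$-manifold with boundary such that $\partial W = V_0\cup V_1$, where $V_0\ne V_1$ are connected components of $\partial W$. Let $x\in V_1$. Regard $\pi_2(W,V_1,x)$ as a crossed $\pi_1(V_1,x)$-module, that is, with the usual left action of $\pi_1(V_1,x)$ and the boundary homomorphism $d:\pi_2(W,V_1,x)\to\pi_1(V_1,x)$; these satisfy $d(g\cdot c)=g\,d(c)\,g^{-1}$ and $d(c)\cdot c'=c\,c'c^{-1}$. Elements $\alpha_1,\dots,\alpha_k$ *generate* it as a crossed module if no proper subgroup of $\pi_2(W,V_1,x)$ that is invariant under $\pi_1(V_1,x)$ contains all of them. A generating system (of a crossed module, or of an abelian group) is called *minimal* if it is finite and no generating system has fewer members. Then there are integers $0\le s\le k$ and a minimal generating system $\alpha_1,\dots,\alpha_k$ of the crossed $\pi_1(V_1,x)$-module $\pi_2(W,V_1,x)$ such that, for the Hurewicz map $h:\pi_2(W,V_1,x)\to H_2(W,V_1;\mathbb Z)$, 1. $h(\alpha_1),\dots,h(\alpha_s)$ is a minimal generating system of the abelian group $H_2(W,V_1;\mathbb Z)$, and 2. $h(\alpha_i)=0$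 for $s<i\le k$. -/

import Mathlib

open scoped unitInterval Manifold

universe u

noncomputable section

/-- A crossed module `(C, G, d)`: a group `G` acting on a group `C` from the left and a
homomorphism `d : C → G` with `d (g • c) = g * d c * g⁻¹` and `d c • c' = c * c' * c⁻¹`. -/
structure CrossedModule (C G : Type*) [Group C] [Group G] [MulDistribMulAction G C] where
  d : C →* G
  equivariant : ∀ (g : G) (c : C), d (g • c) = g * d c * g⁻¹
  peiffer : ∀ c c' : C, d c • c' = c * c' * c⁻¹

namespace CrossedModule

variable {C G : Type*} [Group C] [Group G] [MulDistribMulAction G C]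

/-- The elements `α i` generate `C` as a crossed `G`-module: the only `G`-invariant subgroup of `C`
that contains all of them is `C` itself. -/
def Generates (_M : CrossedModule C G) {ι : Type*} (α : ι → C) : Prop :=
  ∀ K : Subgroup C, (∀ (g : G), ∀ c ∈ K, g • c ∈ K) → (∀ i, α i ∈ K) → K = ⊤

/-- A generating system of `C` as a crossed `G`-module with the least possible number of members. -/
def IsMinimalGenerating (M : CrossedModule C G) {k : ℕ} (α : Fin k → C) : Prop :=
  M.Generates α ∧ ∀ (m : ℕ) (β : Fin m → C), M.Generates β → k ≤ m

end CrossedModule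

/-- A generating system of an abelian group with the least possible number of members. -/
def IsMinimalGenerating {M : Type*} [AddCommGroup M] {k : ℕ} (α : Fin k → M) : Prop :=
  AddSubgroup.closure (Set.range α) = ⊤ ∧
    ∀ (m : ℕ) (β : Fin m → M), AddSubgroup.closure (Set.range β) = ⊤ → k ≤ m

namespace Singular

/-- Singular `n`-simplices. -/
abbrev Simplex (X : Type*) [TopologicalSpace X] (n : ℕ) := C(stdSimplex ℝ (Fin (n + 1)), X)

/-- Singular `n`-chains with integral coefficients. -/
abbrev Chain (X : Type*) [TopologicalSpace X] (n : ℕ) := Simplex X n →₀ ℤ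

section

variable {X : Type*} [TopologicalSpace X]

/-- The `i`-th face of a singular simplex (opposite to the `i`-th vertex). -/
def face {n : ℕ} (i : Fin (n + 2)) (τ : Simplex X (n + 1)) : Simplex X n :=
  τ.comp ⟨stdSimplex.map i.succAbove, stdSimplex.continuous_map _⟩

/-- The boundary operator `∂ τ = ∑ i, (-1) ^ i • face i τ`. -/
def bdry (X : Type*) [TopologicalSpace X] (n : ℕ) : Chain X (n + 1) →ₗ[ℤ] Chain X n :=
  Finsupp.linearCombination ℤ fun τ => ∑ i, Finsupp.single (face i τ) ((-1) ^ (i : ℕ))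

/-- The chains of the subspace `A`. -/
def chainsIn (A : Set X) (n : ℕ) : Submodule ℤ (Chain X n) :=
  Finsupp.supported ℤ ℤ {τ | Set.range τ ⊆ A}

/-- Relative cycles: chains of `X` whose boundary is a chain of `A`. -/
def relCycles (A : Set X) : (n : ℕ) → Submodule ℤ (Chain X n)
  | 0 => ⊤
  | n + 1 => (chainsIn A n).comap (bdry X n)

/-- Relative boundaries: sums of a boundary in `X` and a chain of `A`. -/
def relBoundaries (A : Set X) (n : ℕ) : Submodule ℤ (Chain X n) :=
  LinearMap.range (bdry X n) ⊔ chainsIn A n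

/-- The singular homology group `H_n(X, A)` with integral coefficients: relative cycles modulo
relative boundaries. -/
abbrev RelHomology (A : Set X) (n : ℕ) : Type _ :=
  relCycles A n ⧸ (relBoundaries A n).submoduleOf (relCycles A n)

/-- `t ↦ t_k + ⋯ + t_n` for a point `t = (t_0, …, t_n)` of the standard simplex. -/
def tail {n : ℕ} (k : ℕ) : C(stdSimplex ℝ (Fin (n + 1)), I) where
  toFun t := ⟨∑ j ∈ Finset.univ.filter (fun j : Fin (n + 1) => k ≤ (j : ℕ)), t j, Finset.sum_nonneg fun j _ => t.2.1 j, by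
    rw [← t.2.2]
    exact Finset.sum_le_univ_sum_of_nonneg fun j => t.2.1 j⟩
  continuous_toFun := Continuous.subtype_mk (continuous_finsetSum _ fun j _ =>
    (continuous_apply j).comp continuous_subtype_val) _

theorem tail_zero {n : ℕ} (t : stdSimplex ℝ (Fin (n + 1))) : tail 0 t = 1 := by
  refine Subtype.ext ?_
  simp [tail]

theorem tail_top {n : ℕ} (t : stdSimplex ℝ (Fin (n + 1))) : tail (n + 1) t = 0 := by
  refine Subtype.ext ?_
  change (∑ j ∈ Finset.univ.filter (fun j : Fin (n + 1) => n + 1 ≤ (j : ℕ)), t j) = 0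
  refine Finset.sum_eq_zero fun j hj => ?_
  have := j.2
  simp only [Finset.mem_filter, Finset.mem_univ, true_and] at hj
  omega

theorem tail_face {n : ℕ} (k : ℕ) (i : Fin (n + 2)) (t : stdSimplex ℝ (Fin (n + 1))) :
    tail k (stdSimplex.map i.succAbove t) = tail (if k ≤ i then k else k - 1) t := by
  refine Subtype.ext ?_
  simp only [tail, ContinuousMap.coe_mk, stdSimplex.map_coe, FunOnFinite.linearMap_apply_apply]
  rw [Finset.sum_comm' (t' := Finset.univ.filter fun m => k ≤ (i.succAbove m : ℕ))
    (s' := fun m => {i.succAbove m})]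
  · simp only [Finset.sum_singleton]
    refine Finset.sum_congr (Finset.filter_congr fun m _ => ?_) fun _ _ => rfl
    rw [Fin.succAbove]
    split_ifs with h1 h2 <;> simp [Fin.lt_def] at * <;> omega
  · intro j m
    simp only [Finset.mem_filter, Finset.mem_univ, true_and, Finset.mem_singleton]
    constructor
    · rintro ⟨h1, h2⟩
      exact ⟨h2.symm, h2 ▸ h1⟩
    · rintro ⟨h1, h2⟩
      exact ⟨h1 ▸ h2, h1.symm⟩

/-- The singular simplex `t ↦ f (u_a, u_b)` with `u_k = t_k + ⋯ + t_n`. -/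
def squareSimplex (f : C(I × I, X)) (n a b : ℕ) : Simplex X n :=
  f.comp ((tail a).prodMk (tail b))

/-- The square `[0, 1]²`, cut along the diagonal into two triangles, mapped by `f`. -/
def squareChain (f : C(I × I, X)) : Chain X 2 :=
  Finsupp.single (squareSimplex f 2 1 2) 1 - Finsupp.single (squareSimplex f 2 2 1) 1

/-- The singular simplex `t ↦ f (u_a, u_b, u_c)` with `u_k = t_k + ⋯ + t_n`. -/
def cubeSimplex (f : C(I × I × I, X)) (n a b c : ℕ) : Simplex X n :=
  f.comp ((tail a).prodMk ((tail b).prodMk (tail c)))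

/-- The cube `[0, 1]³`, cut into six tetrahedra, mapped by `f`. -/
def cubeChain (f : C(I × I × I, X)) : Chain X 3 :=
  Finsupp.single (cubeSimplex f 3 1 2 3) 1 + Finsupp.single (cubeSimplex f 3 2 3 1) 1 +
    Finsupp.single (cubeSimplex f 3 3 1 2) 1 - Finsupp.single (cubeSimplex f 3 2 1 3) 1 -
    Finsupp.single (cubeSimplex f 3 1 3 2) 1 - Finsupp.single (cubeSimplex f 3 3 2 1) 1

theorem face_squareSimplex (f : C(I × I, X)) (n a b : ℕ) (i : Fin (n + 2)) :
    face i (squareSimplex f (n + 1) a b) =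
      squareSimplex f n (if a ≤ i then a else a - 1) (if b ≤ i then b else b - 1) :=
  ContinuousMap.ext fun t => by simp [face, squareSimplex, tail_face]

theorem face_cubeSimplex (f : C(I × I × I, X)) (n a b c : ℕ) (i : Fin (n + 2)) :
    face i (cubeSimplex f (n + 1) a b c) =
      cubeSimplex f n (if a ≤ i then a else a - 1) (if b ≤ i then b else b - 1)
        (if c ≤ i then c else c - 1) :=
  ContinuousMap.ext fun t => by simp [face, cubeSimplex, tail_face]

theorem bdry_single {n : ℕ} (τ : Simplex X (n + 1)) :
    bdry X n (Finsupp.single τ 1) = ∑ i, Finsupp.single (face i τ) ((-1) ^ (i : ℕ)) := by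
  simp [bdry]

theorem bdry_squareChain (f : C(I × I, X)) : bdry X 1 (squareChain f) =
    Finsupp.single (squareSimplex f 1 0 1) 1 + Finsupp.single (squareSimplex f 1 1 2) 1 -
    (Finsupp.single (squareSimplex f 1 1 0) 1 + Finsupp.single (squareSimplex f 1 2 1) 1) := by
  simp [squareChain, bdry_single, face_squareSimplex, Fin.sum_univ_succ]
  abel

theorem bdry_cubeChain (f : C(I × I × I, X)) : bdry X 2 (cubeChain f) =
    (Finsupp.single (cubeSimplex f 2 0 1 2) 1 - Finsupp.single (cubeSimplex f 2 0 2 1) 1) -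
    (Finsupp.single (cubeSimplex f 2 3 1 2) 1 - Finsupp.single (cubeSimplex f 2 3 2 1) 1) +
    (Finsupp.single (cubeSimplex f 2 1 2 0) 1 + Finsupp.single (cubeSimplex f 2 2 0 1) 1 -
      Finsupp.single (cubeSimplex f 2 1 0 2) 1 - Finsupp.single (cubeSimplex f 2 2 1 0) 1 -
      Finsupp.single (cubeSimplex f 2 1 2 3) 1 - Finsupp.single (cubeSimplex f 2 2 3 1) 1 +
      Finsupp.single (cubeSimplex f 2 2 1 3) 1 + Finsupp.single (cubeSimplex f 2 1 3 2) 1) := by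
  simp [cubeChain, bdry_single, face_cubeSimplex, Fin.sum_univ_succ]
  abel

theorem single_mem {A : Set X} {n : ℕ} {τ : Simplex X n} (h : ∀ t, τ t ∈ A) :
    Finsupp.single τ 1 ∈ chainsIn A n :=
  Finsupp.single_mem_supported ℤ 1 (by rintro _ ⟨t, rfl⟩; exact h t)

/-- A square whose four sides lie in `A` is a relative cycle. -/
theorem squareChain_mem {A : Set X} (f : C(I × I, X)) (h0 : ∀ t, f (0, t) ∈ A)
    (h1 : ∀ t, f (1, t) ∈ A) (h2 : ∀ s, f (s, 0) ∈ A) (h3 : ∀ s, f (s, 1) ∈ A) :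
    squareChain f ∈ relCycles A 2 := by
  change bdry X 1 _ ∈ chainsIn A 1
  rw [bdry_squareChain]
  refine Submodule.sub_mem _ (Submodule.add_mem _ (single_mem fun t => ?_) (single_mem fun t => ?_))
    (Submodule.add_mem _ (single_mem fun t => ?_) (single_mem fun t => ?_)) <;>
  simp only [squareSimplex, ContinuousMap.comp_apply, ContinuousMap.prod_eval, tail_zero,
    tail_top, h0, h1, h2, h3]

/-- Homotopic squares are homologous, if the homotopy keeps the four sides in `A`. -/
theorem squareChain_homologous {A : Set X} (f g : C(I × I, X)) (H : C(I × I × I, X))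
    (hf : ∀ z, H (0, z) = f z) (hg : ∀ z, H (1, z) = g z)
    (h0 : ∀ r t, H (r, 0, t) ∈ A) (h1 : ∀ r t, H (r, 1, t) ∈ A)
    (h2 : ∀ r s, H (r, s, 0) ∈ A) (h3 : ∀ r s, H (r, s, 1) ∈ A) :
    squareChain g - squareChain f ∈ relBoundaries A 2 := by
  have e1 (a b : ℕ) : cubeSimplex H 2 0 a b = squareSimplex g 2 a b :=
    ContinuousMap.ext fun t => by simp [cubeSimplex, squareSimplex, tail_zero, hg]
  have e0 (a b : ℕ) : cubeSimplex H 2 3 a b = squareSimplex f 2 a b :=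
    ContinuousMap.ext fun t => by simp [cubeSimplex, squareSimplex, tail_top, hf]
  have h := bdry_cubeChain H
  rw [e1, e1, e0, e0] at h
  change _ = squareChain g - squareChain f + _ at h
  rw [eq_sub_of_add_eq h.symm]
  refine Submodule.sub_mem _ (Submodule.mem_sup_left ⟨_, rfl⟩) (Submodule.mem_sup_right ?_)
  refine Submodule.add_mem _ (Submodule.add_mem _ (Submodule.sub_mem _ (Submodule.sub_mem _
    (Submodule.sub_mem _ (Submodule.sub_mem _ (Submodule.add_mem _ ?_ ?_) ?_) ?_) ?_) ?_) ?_) ?_ <;>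
  refine single_mem fun t => ?_ <;>
  simp only [cubeSimplex, ContinuousMap.comp_apply, ContinuousMap.prod_eval, tail_zero,
    tail_top, h0, h1, h2, h3]

end

end Singular

namespace RelHomotopy

section Cat

variable {X Y : Type*}

/-- `s ↦ min (2s, 1)`. -/
def lo : C(I, I) := ⟨fun s : I => Set.projIcc 0 1 zero_le_one (2 * (s : ℝ) : ℝ), by fun_prop⟩

/-- `s ↦ max (0, 2s - 1)`. -/
def hi : C(I, I) := ⟨fun s : I => Set.projIcc 0 1 zero_le_one (2 * (s : ℝ) - 1 : ℝ), by fun_prop⟩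

theorem coe_lo (s : I) : (lo s : ℝ) = min 1 (2 * (s : ℝ)) := by
  have := s.2.1
  simp [lo, Set.coe_projIcc, this]

theorem coe_hi (s : I) : (hi s : ℝ) = max 0 (2 * (s : ℝ) - 1) := by
  have := s.2.2
  simp only [hi, ContinuousMap.coe_mk, Set.coe_projIcc]
  rw [min_eq_right]
  linarith

theorem lo_zero : lo 0 = 0 := Subtype.ext (by simp [coe_lo])

theorem hi_zero : hi 0 = 0 := Subtype.ext (by simp [coe_hi])

theorem hi_one : hi 1 = 1 := Subtype.ext (by rw [coe_hi]; norm_num)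

/-- Concatenation: `f` at double speed on `[0, 1/2]`, then `g` at double speed on `[1/2, 1]`. -/
def cat (f g : I → X) (s : I) : X := if (s : ℝ) ≤ 1 / 2 then f (lo s) else g (hi s)

theorem cat_zero (f g : I → X) : cat f g 0 = f 0 := by
  simp [cat, lo_zero]

theorem cat_one (f g : I → X) : cat f g 1 = g 1 := by
  have h : ¬ ((1 : ℝ) ≤ 1 / 2) := by norm_num
  simp only [cat, hi_one, Set.Icc.coe_one, h, if_false]

theorem cat_const (f : I → X) {x : X} (h : f 1 = x) (s : I) : cat f (fun _ => x) s = f (lo s) := by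
  unfold cat
  split_ifs with hs
  · rfl
  · have : lo s = 1 := Subtype.ext (by rw [coe_lo]; simp only [Set.Icc.coe_one]; rw [min_eq_left]; linarith)
    rw [this, h]

instance : ContractibleSpace I := (convex_Icc (0 : ℝ) 1).contractibleSpace ⟨0, by simp⟩

variable [TopologicalSpace X] [TopologicalSpace Y]

theorem trans_eq_cat {x y z : X} (p : Path x y) (q : Path y z) (s : I) :
    p.trans q s = cat p q s := rfl

theorem continuous_cat {f g : Y → I → X} (hf : Continuous fun z : Y × I => f z.1 z.2)
    (hg : Continuous fun z : Y × I => g z.1 z.2) (h : ∀ y, f y 1 = g y 0) :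
    Continuous fun z : Y × I => cat (f z.1) (g z.1) z.2 := by
  unfold cat
  refine Continuous.if_le (f' := fun z : Y × I => f z.1 (lo z.2))
    (g' := fun z : Y × I => g z.1 (hi z.2)) ?_ ?_ (by fun_prop) continuous_const ?_
  · exact hf.comp (f := fun z : Y × I => (z.1, lo z.2)) (by fun_prop)
  · exact hg.comp (f := fun z : Y × I => (z.1, hi z.2)) (by fun_prop)
  · rintro ⟨y, s⟩ hs
    have h1 : lo s = 1 := Subtype.ext (by simp only at hs; rw [coe_lo, hs]; norm_num)
    have h2 : hi s = 0 := Subtype.ext (by simp only at hs; rw [coe_hi, hs]; norm_num)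
    simp only [h1, h2, h]

theorem trans_left {x y z : X} (p : Path x y) (q : Path y z) {r v : I}
    (h : (r : ℝ) = 1 / 2 * v) : p.trans q r = p v := by
  have hv := v.2.2
  rw [trans_eq_cat, cat, if_pos (by linarith)]
  congr 1
  exact Subtype.ext (by rw [coe_lo, h, min_eq_right] <;> linarith)

theorem trans_right {x y z : X} (p : Path x y) (q : Path y z) {r v : I}
    (h : (r : ℝ) = 1 / 2 + 1 / 2 * v) : p.trans q r = q v := by
  have hv := v.2.1
  rcases eq_or_lt_of_le hv with hv | hv
  · have e : v = 0 := Subtype.ext hv.symm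
    subst e
    rw [trans_left (v := 1) p q (by rw [h]; simp), p.target, q.source]
  · rw [trans_eq_cat, cat, if_neg (by linarith)]
    congr 1
    exact Subtype.ext (by rw [coe_hi, h, max_eq_right] <;> linarith)

/-- Two paths with common end points that factor through a simply connected space, with common
end points there, are homotopic. -/
theorem homotopic_of_factor [SimplyConnectedSpace Y] (f : C(Y, X)) {a b : X} {z w : Y}
    {p q : Path a b} (p' q' : Path z w) (hp : ∀ t, p t = f (p' t)) (hq : ∀ t, q t = f (q' t)) :
    p.Homotopic q := by
  have ha : a = f z := by simpa using hp 0
  have hb : b = f w := by simpa using hp 1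
  subst ha hb
  have e1 : p = p'.map f.continuous := Path.ext (funext hp)
  have e2 : q = q'.map f.continuous := Path.ext (funext hq)
  rw [e1, e2]
  exact (SimplyConnectedSpace.paths_homotopic p' q').map f

end Cat

section

variable {X : Type u} [TopologicalSpace X]

/-- The space of paths in `X` that start at `x` and end in `A` (the homotopy fibre of `A → X`). -/
abbrev PathSpace (A : Set X) (x : A) : Type u := {p : C(I, X) // p 0 = x ∧ p 1 ∈ A}

/-- The constant path. -/
def base (A : Set X) (x : A) : PathSpace A x := ⟨ContinuousMap.const I x, rfl, x.2⟩

/-- The end point map `PathSpace A x → A`. -/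
def endpoint (A : Set X) (x : A) : C(PathSpace A x, A) :=
  ⟨fun p => ⟨p.1 1, p.2.2⟩, Continuous.subtype_mk
    ((ContinuousEvalConst.continuous_eval_const (1 : I)).comp continuous_subtype_val) _⟩

variable {A : Set X} {x : A}

theorem ext_apply {p q : PathSpace A x} (h : ∀ s, p.1 s = q.1 s) : p = q :=
  Subtype.ext (ContinuousMap.ext h)

/-- A continuous map into `PathSpace A x` from its adjoint. -/
def family {Y : Type*} [TopologicalSpace Y] (f : Y → I → X)
    (hf : Continuous fun z : Y × I => f z.1 z.2) (h0 : ∀ y, f y 0 = x) (h1 : ∀ y, f y 1 ∈ A) :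
    C(Y, PathSpace A x) :=
  ⟨fun y => ⟨(ContinuousMap.curry ⟨fun z : Y × I => f z.1 z.2, hf⟩) y, h0 y, h1 y⟩,
    Continuous.subtype_mk (ContinuousMap.continuous _) _⟩

theorem family_apply {Y : Type*} [TopologicalSpace Y] (f : Y → I → X)
    (hf : Continuous fun z : Y × I => f z.1 z.2) (h0 : ∀ y, f y 0 = x) (h1 : ∀ y, f y 1 ∈ A)
    (y : Y) (s : I) : (family f hf h0 h1 y).1 s = f y s := rfl

theorem base_apply (s : I) : (base A x).1 s = x := rfl

theorem continuous_eval : Continuous fun z : PathSpace A x × I => z.1.1 z.2 :=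
  (ContinuousEval.continuous_eval (F := C(I, X))).comp
    (continuous_subtype_val.prodMap continuous_id)

theorem continuous_eval_comp {Y : Type*} [TopologicalSpace Y] {f : Y → PathSpace A x} {g : Y → I}
    (hf : Continuous f) (hg : Continuous g) : Continuous fun y => (f y).1 (g y) :=
  continuous_eval.comp (hf.prodMk hg)

/-- Precomposition `p ↦ β · p` with a loop `β` of `X` at `x`. -/
def precat (β : Path (x : X) x) : C(PathSpace A x, PathSpace A x) :=
  family (fun p => cat β p.1) (continuous_cat (f := fun (_ : PathSpace A x) s => β s)
    (g := fun p => p.1) (by fun_prop) continuous_eval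
    (fun p => by rw [β.target, p.2.1]))
    (fun p => by rw [cat_zero, β.source]) (fun p => by rw [cat_one]; exact p.2.2)

theorem precat_apply (β : Path (x : X) x) (p : PathSpace A x) (s : I) :
    (precat β p).1 s = cat β p.1 s := rfl

/-- A loop of `A` viewed in `X`. -/
abbrev incl {y z : A} (γ : Path y z) : Path (y : X) z := γ.map continuous_subtype_val

/-- Time changes `τ : I → I` with `τ 0 = 0`. -/
abbrev Reparam : Type := {τ : C(I, I) // τ 0 = 0}

/-- A path in the space of time changes. -/
def reparamPath (f : I → I → I) (hf : Continuous fun z : I × I => f z.1 z.2) (h0 : ∀ y, f y 0 = 0)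
    (a b : Reparam) (ha : ∀ s, f 0 s = a.1 s) (hb : ∀ s, f 1 s = b.1 s) : Path a b where
  toFun t := ⟨(ContinuousMap.curry ⟨fun z : I × I => f z.1 z.2, hf⟩) t, h0 t⟩
  continuous_toFun := Continuous.subtype_mk (ContinuousMap.continuous _) _
  source' := Subtype.ext (ContinuousMap.ext ha)
  target' := Subtype.ext (ContinuousMap.ext hb)

instance : ContractibleSpace Reparam := by
  rw [contractible_iff_id_nullhomotopic]
  refine ⟨⟨ContinuousMap.const I 0, rfl⟩, ⟨ContinuousMap.Homotopy.symm ⟨⟨fun z =>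
    ⟨(ContinuousMap.curry ⟨fun z : (I × Reparam) × I => z.1.1 * z.1.2.1 z.2, ?_⟩) z, ?_⟩, ?_⟩,
    ?_, ?_⟩⟩⟩
  · have : Continuous fun z : (I × Reparam) × I => z.1.2.1 z.2 :=
      (ContinuousEval.continuous_eval (F := C(I, I))).comp
        (((continuous_subtype_val.comp (continuous_snd.comp continuous_fst))).prodMk continuous_snd)
    exact (continuous_fst.comp continuous_fst).mul this
  · simp only [ContinuousMap.curry_apply, ContinuousMap.coe_mk]
    rw [z.2.2, mul_zero]
  · exact Continuous.subtype_mk (ContinuousMap.continuous _) _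
  · intro τ
    exact Subtype.ext (ContinuousMap.ext fun s => by simp)
  · intro τ
    exact Subtype.ext (ContinuousMap.ext fun s => by simp)

/-- `τ ↦ γ ∘ τ` for a path `γ` of `A` starting at `x`. -/
def pull {y : A} (γ : Path x y) : C(Reparam, PathSpace A x) :=
  family (fun τ s => γ (τ.1 s))
    (continuous_subtype_val.comp (γ.continuous.comp
      ((ContinuousEval.continuous_eval (F := C(I, I))).comp
        (continuous_subtype_val.prodMap continuous_id))))
    (fun τ => by rw [τ.2, γ.source]) (fun τ => (γ (τ.1 1)).2)

/-- The path `t ↦ (γ restricted to [0, t])` from the constant path to `γ · const`. -/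
def grow (γ : Path x x) : Path (base A x) (precat (incl γ) (base A x)) where
  toFun := family (fun t s => (γ (t * lo s) : X)) (by fun_prop)
    (fun t => by simp [lo_zero]) (fun t => (γ _).2)
  continuous_toFun := ContinuousMap.continuous _
  source' := ext_apply fun s => by rw [family_apply]; simp [base]
  target' := ext_apply fun s => by
    have := cat_const (incl γ) (x := x) (by simp) s
    rw [family_apply, precat_apply, one_mul]
    exact this.symm

theorem grow_apply (γ : Path x x) (t s : I) : (grow γ t).1 s = γ (t * lo s) := rfl

open Path

/-- Transport of the class `φ` along the loop `γ` of `A`: first grow along `γ`, then run through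
`φ` with `γ` put in front of each path, then shrink back. -/
def transport (γ : Path x x) (φ : Homotopic.Quotient (base A x) (base A x)) :
    Homotopic.Quotient (base A x) (base A x) :=
  ((Homotopic.Quotient.mk (grow γ)).trans (φ.map (precat (incl γ)))).trans (Homotopic.Quotient.mk (grow γ)).symm

theorem natural {f g : C(PathSpace A x, PathSpace A x)} (H : f.Homotopy g)
    (φ : Homotopic.Quotient (base A x) (base A x)) :
    (φ.map f).trans (Homotopic.Quotient.mk (H.evalAt (base A x))) =
      (Homotopic.Quotient.mk (H.evalAt (base A x))).trans (φ.map g) := by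
  obtain ⟨p, rfl⟩ := Homotopic.Quotient.mk_surjective φ
  exact Homotopic.Quotient.eq.2 (Path.Homotopic.map_trans_evalAt H p)

theorem eq_trans_symm {Y : Type*} [TopologicalSpace Y] {a b c : Y} {p : Homotopic.Quotient a b}
    {q : Homotopic.Quotient b c} {r : Homotopic.Quotient a c} (h : p.trans q = r) : p = r.trans q.symm := by
  rw [← h, Homotopic.Quotient.trans_assoc, Homotopic.Quotient.trans_symm, Homotopic.Quotient.trans_refl]

theorem symm_trans_rev {Y : Type*} [TopologicalSpace Y] {a b c : Y} (p : Homotopic.Quotient a b)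
    (q : Homotopic.Quotient b c) : (p.trans q).symm = q.symm.trans p.symm := by
  have h : q.symm.trans p.symm = (Homotopic.Quotient.refl c).trans (p.trans q).symm := by
    apply eq_trans_symm
    rw [Homotopic.Quotient.trans_assoc, ← Homotopic.Quotient.trans_assoc p.symm, Homotopic.Quotient.symm_trans,
      Homotopic.Quotient.refl_trans, Homotopic.Quotient.symm_trans]
  rw [h, Homotopic.Quotient.refl_trans]

theorem map_trans {Y Z : Type*} [TopologicalSpace Y] [TopologicalSpace Z] {a b c : Y}
    (p : Homotopic.Quotient a b) (q : Homotopic.Quotient b c) (f : C(Y, Z)) :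
    (p.trans q).map f = (p.map f).trans (q.map f) := by
  obtain ⟨p, rfl⟩ := Homotopic.Quotient.mk_surjective p
  obtain ⟨q, rfl⟩ := Homotopic.Quotient.mk_surjective q
  exact congrArg Homotopic.Quotient.mk (Path.map_trans p q f.continuous)

theorem map_symm {Y Z : Type*} [TopologicalSpace Y] [TopologicalSpace Z] {a b : Y}
    (p : Homotopic.Quotient a b) (f : C(Y, Z)) : p.symm.map f = (p.map f).symm := by
  obtain ⟨p, rfl⟩ := Homotopic.Quotient.mk_surjective p
  rfl

theorem map_id {Y : Type*} [TopologicalSpace Y] {a b : Y}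
    (p : Homotopic.Quotient a b) : p.map (ContinuousMap.id Y) = p := by
  obtain ⟨p, rfl⟩ := Homotopic.Quotient.mk_surjective p
  rfl

theorem transport_of {γ : Path x x} {g : C(PathSpace A x, PathSpace A x)}
    (H : (precat (incl γ)).Homotopy g) {a : Homotopic.Quotient (base A x) (g (base A x))}
    (h : (Homotopic.Quotient.mk (grow γ)).trans (Homotopic.Quotient.mk (H.evalAt (base A x))) = a)
    (φ : Homotopic.Quotient (base A x) (base A x)) :
    transport γ φ = (a.trans (φ.map g)).trans a.symm := by
  subst h
  rw [transport, eq_trans_symm (natural H φ), symm_trans_rev]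
  simp only [Homotopic.Quotient.trans_assoc]

theorem transport_congr {γ γ' : Path x x} (h : γ.Homotopic γ')
    (φ : Homotopic.Quotient (base A x) (base A x)) : transport γ φ = transport γ' φ := by
  obtain ⟨H⟩ := h
  let K : (precat (incl γ)).Homotopy (precat (incl γ')) :=
    { toContinuousMap := family (fun z : I × PathSpace A x => cat (fun s => H (z.1, s)) z.2.1)
        (continuous_cat (f := fun (z : I × PathSpace A x) s => ((H (z.1, s) : A) : X))
          (g := fun z => z.2.1)
          (by fun_prop)
          (continuous_eval_comp (continuous_snd.comp continuous_fst) continuous_snd)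
          (fun z => by simp [z.2.2.1]))
        (fun z => by simp [cat_zero]) (fun z => by rw [cat_one]; exact z.2.2.2)
      map_zero_left := fun p => ext_apply fun s => by
        change cat (fun s => ((H (0, s) : A) : X)) p.1 s = cat (incl γ) p.1 s
        simp [cat]
      map_one_left := fun p => ext_apply fun s => by
        change cat (fun s => ((H (1, s) : A) : X)) p.1 s = cat (incl γ') p.1 s
        simp [cat] }
  have hK : (Homotopic.Quotient.mk (grow γ)).trans (Homotopic.Quotient.mk (K.evalAt (base A x))) =
      Homotopic.Quotient.mk (grow γ') := by
    have key : ((grow γ).trans (K.evalAt (base A x))).Homotopic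
        ((Path.refl _).trans (grow γ')) := by
      let Q : C(I × I, PathSpace A x) := family (fun z s => (H (z.1, z.2 * lo s) : X))
        (by fun_prop) (fun z => by simp [lo_zero]) (fun z => (H _).2)
      refine homotopic_of_factor Q (z := (0, 0)) (w := (1, 1))
        (Path.trans (y := (0, 1)) (Path.prod (Path.refl 0) Path.id)
          (Path.prod Path.id (Path.refl 1)))
        (Path.trans (y := (1, 0)) (Path.prod Path.id (Path.refl 0))
          (Path.prod (Path.refl 1) Path.id)) ?_ ?_
      · intro t
        rw [trans_eq_cat, trans_eq_cat]
        unfold cat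
        split_ifs
        · refine ext_apply fun s => ?_
          change ((γ (lo t * lo s) : A) : X) = ((H (0, lo t * lo s) : A) : X)
          simp
        · refine ext_apply fun s => ?_
          have := cat_const (fun s => ((H (hi t, s) : A) : X)) (x := x) (by simp) s
          change cat (fun s => ((H (hi t, s) : A) : X)) (fun _ => (x : X)) s =
            ((H (hi t, 1 * lo s) : A) : X)
          rw [this, one_mul]
      · intro t
        rw [trans_eq_cat, trans_eq_cat]
        unfold cat
        split_ifs
        · refine ext_apply fun s => ?_
          change (x : X) = ((H (lo t, 0 * lo s) : A) : X)
          simp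
        · refine ext_apply fun s => ?_
          change ((γ' (hi t * lo s) : A) : X) = ((H (1, hi t * lo s) : A) : X)
          simp
    have h := Homotopic.Quotient.eq.2 key
    rwa [Homotopic.Quotient.mk_trans, Homotopic.Quotient.mk_trans, Homotopic.Quotient.mk_refl, Homotopic.Quotient.refl_trans] at h
  exact transport_of K hK φ

theorem transport_refl (φ : Homotopic.Quotient (base A x) (base A x)) :
    transport (Path.refl x) φ = φ := by
  let K : (precat (incl (Path.refl x))).Homotopy (ContinuousMap.id (PathSpace A x)) :=
    { toContinuousMap := family (fun z : I × PathSpace A x => fun s =>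
          z.2.1 (Set.projIcc 0 1 zero_le_one ((1 - (z.1 : ℝ)) * hi s + z.1 * s)))
        (continuous_eval_comp (continuous_snd.comp continuous_fst) (by fun_prop))
        (fun z => by simp [hi_zero, z.2.2.1])
        (fun z => by simp [hi_one, z.2.2.2])
      map_zero_left := fun p => ext_apply fun s => by
        change p.1 (Set.projIcc 0 1 zero_le_one ((1 - (0 : ℝ)) * hi s + 0 * s)) =
          cat (fun _ => (x : X)) p.1 s
        unfold cat
        split_ifs with hs
        · have : hi s = 0 := Subtype.ext (by
            rw [coe_hi]; simp only [Set.Icc.coe_zero]; rw [max_eq_left]; linarith)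
          simp [this, p.2.1]
        · simp
      map_one_left := fun p => ext_apply fun s => by
        change p.1 (Set.projIcc 0 1 zero_le_one ((1 - (1 : ℝ)) * hi s + 1 * s)) = p.1 s
        simp }
  have hK : (Homotopic.Quotient.mk (grow (Path.refl x))).trans (Homotopic.Quotient.mk (K.evalAt (base A x))) =
      Homotopic.Quotient.refl (base A x) := by
    have key : ((grow (Path.refl x)).trans (K.evalAt (base A x))).Homotopic (Path.refl _) := by
      refine homotopic_of_factor (Y := Unit) ⟨fun _ => base A x, continuous_const⟩
        (Path.refl ()) (Path.refl ()) ?_ ?_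
      · intro t
        rw [trans_eq_cat]
        unfold cat
        split_ifs <;> rfl
      · intro t; rfl
    exact Homotopic.Quotient.eq.2 key
  rw [transport_of K hK φ]
  refine (congrArg (fun ψ : Homotopic.Quotient (base A x) (base A x) =>
    ((Homotopic.Quotient.refl _).trans ψ).trans (Homotopic.Quotient.refl _).symm)
    (map_id φ)).trans ?_
  simp only [Homotopic.Quotient.refl_trans]
  exact (eq_trans_symm (Homotopic.Quotient.trans_refl φ)).symm

theorem transport_trans (γ γ' : Path x x) (φ : Homotopic.Quotient (base A x) (base A x)) :
    transport (γ.trans γ') φ = transport γ (transport γ' φ) := by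
  let ρ (u s : I) : I := Set.projIcc 0 1 zero_le_one
    ((1 - (u : ℝ)) * Path.Homotopy.transAssocReparamAux s + u * s)
  have hρ : Continuous fun z : I × I => ρ z.1 z.2 := by
    have := Path.Homotopy.continuous_transAssocReparamAux
    fun_prop
  have hρ0 (s : I) : (ρ 0 s : ℝ) = Path.Homotopy.transAssocReparamAux s := by
    have := Path.Homotopy.transAssocReparamAux_mem_I s
    simp only [ρ, Set.Icc.coe_zero, sub_zero, one_mul, zero_mul, add_zero]
    rw [Set.projIcc_of_mem _ this]
  have hρ1 (s : I) : ρ 1 s = s := by simp [ρ]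
  have hρs (u : I) : ρ u 0 = 0 := by simp [ρ, Path.Homotopy.transAssocReparamAux_zero]
  have hρt (u : I) : ρ u 1 = 1 := by simp [ρ, Path.Homotopy.transAssocReparamAux_one]
  let g := (precat (incl γ)).comp (precat (incl γ'))
  let K : (precat (incl (γ.trans γ'))).Homotopy g :=
    { toContinuousMap := family (fun z : I × PathSpace A x => fun s => (g z.2).1 (ρ z.1 s))
        (continuous_eval_comp (by fun_prop)
          (hρ.comp (f := fun z : (I × PathSpace A x) × I => (z.1.1, z.2)) (by fun_prop)))
        (fun z => by simp only [hρs]; exact (g z.2).2.1)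
        (fun z => by simp only [hρt]; exact (g z.2).2.2)
      map_zero_left := fun p => ext_apply fun s => by
        let p' : Path (x : X) (p.1 1) := ⟨p.1, p.2.1, rfl⟩
        change cat (incl γ) (cat (incl γ') p') (ρ 0 s) = cat (incl (γ.trans γ')) p' s
        have e : ρ 0 s = ⟨Path.Homotopy.transAssocReparamAux s,
          Path.Homotopy.transAssocReparamAux_mem_I s⟩ := Subtype.ext (hρ0 s)
        have h := congrArg (fun q => q s)
          (Path.Homotopy.trans_assoc_reparam (incl γ) (incl γ') p')
        rw [Path.coe_reparam] at h
        have h2 : cat (incl (γ.trans γ')) p' s = (((incl γ).trans (incl γ')).trans p') s := by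
          exact congrArg (fun q => cat q p' s) (congrArg DFunLike.coe
            (Path.map_trans γ γ' continuous_subtype_val))
        rw [h2, h, e]
        rfl
      map_one_left := fun p => ext_apply fun s => by
        change (g p).1 (ρ 1 s) = (g p).1 s
        rw [hρ1] }
  have hK : (Homotopic.Quotient.mk (grow (γ.trans γ'))).trans (Homotopic.Quotient.mk (K.evalAt (base A x))) =
      (Homotopic.Quotient.mk (grow γ)).trans ((Homotopic.Quotient.mk (grow γ')).map (precat (incl γ))) := by
    have key : ((grow (γ.trans γ')).trans (K.evalAt (base A x))).Homotopic
        ((grow γ).trans ((grow γ').map (precat (incl γ)).continuous)) := by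
      let zero : Reparam := ⟨ContinuousMap.const I 0, rfl⟩
      let ω : C(I, I) := ⟨fun s => Set.projIcc 0 1 zero_le_one
        (max (s : ℝ) (min (2 * (s : ℝ) - 1 / 2) 1) : ℝ), by fun_prop⟩
      have hω (s : I) : (ω s : ℝ) = max (s : ℝ) (min (2 * (s : ℝ) - 1 / 2) 1) := by
        have h1 := s.2.1
        have h2 := s.2.2
        simp only [ω, ContinuousMap.coe_mk]
        rw [Set.projIcc_of_mem]
        exact ⟨le_max_of_le_left h1, max_le h2 (min_le_right _ _)⟩
      have hω0 : ω 0 = 0 := Subtype.ext (by rw [hω]; norm_num)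
      have hωcat (r : I) : cat (incl γ) (cat (incl γ') (fun _ => (x : X))) r =
          ((γ.trans γ') (ω r) : X) := by
        have h1 := r.2.1
        have h2 := r.2.2
        by_cases hr : (r : ℝ) ≤ 1 / 2
        · have e : (ω r : ℝ) = 1 / 2 * lo r := by
            rw [hω, coe_lo, max_eq_left, min_eq_right] <;> try linarith
            exact min_le_of_left_le (by linarith)
          rw [trans_left γ γ' e, cat, if_pos hr]
          rfl
        · have e : (ω r : ℝ) = 1 / 2 + 1 / 2 * lo (hi r) := by
            rw [hω, coe_lo, coe_hi, max_eq_right (a := (0 : ℝ)) (by linarith)]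
            rcases le_total (r : ℝ) (3 / 4) with h | h
            · rw [min_eq_left, max_eq_right, min_eq_right] <;> linarith
            · rw [min_eq_right, max_eq_right, min_eq_left] <;> linarith
          rw [trans_right γ γ' e, cat, if_neg hr, cat_const (incl γ') (x := x) (by simp)]
          rfl
      let ωr : Reparam := ⟨ω, hω0⟩
      let lor : Reparam := ⟨lo, lo_zero⟩
      let half : I := ⟨1 / 2, by norm_num, by norm_num⟩
      let mid : Reparam := ⟨⟨fun s => half * lo s, by fun_prop⟩, by simp [lo_zero]⟩
      let m (t s : I) : I := Set.projIcc 0 1 zero_le_one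
        (min (s : ℝ) (1 / 2) + 1 / 2 * (t * lo (hi s)) : ℝ)
      have hm (t s : I) : (m t s : ℝ) = min (s : ℝ) (1 / 2) + 1 / 2 * (t * lo (hi s)) := by
        simp only [m]
        rw [Set.projIcc_of_mem]
        have h3 := (t * lo (hi s)).2.1
        have h4 := (t * lo (hi s)).2.2
        rw [Set.Icc.coe_mul] at h3 h4
        have h5 : min (s : ℝ) (1 / 2) ≤ 1 / 2 := min_le_right _ _
        have h6 : 0 ≤ min (s : ℝ) (1 / 2) := le_min s.2.1 (by norm_num)
        exact ⟨by linarith, by linarith⟩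
      refine homotopic_of_factor (pull (γ.trans γ')) (z := zero) (w := ωr)
        (Path.trans (y := lor)
          (reparamPath (fun t s => t * lo s) (by fun_prop) (fun t => by simp [lo_zero]) _ _
            (fun s => by simp [zero]) (fun s => by simp [lor]))
          (reparamPath (fun t s => ω (ρ t s)) (by fun_prop) (fun t => by rw [hρs, hω0]) _ _
            (fun s => Subtype.ext ?_) (fun s => by rw [hρ1])))
        (Path.trans (y := mid)
          (reparamPath (fun t s => half * (t * lo s)) (by fun_prop)
            (fun t => by simp [lo_zero]) _ _
            (fun s => by simp [zero]) (fun s => by simp [mid]))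
          (reparamPath m (by fun_prop) (fun t => Subtype.ext (by
              rw [hm, hi_zero, lo_zero]; norm_num)) _ _
            (fun s => Subtype.ext ?_) (fun s => Subtype.ext ?_))) ?_ ?_
      · change (ω (ρ 0 s) : ℝ) = lo s
        have h1 := s.2.1
        have h2 := s.2.2
        rw [hω, hρ0, coe_lo, Path.Homotopy.transAssocReparamAux]
        split_ifs with h3 h4
        · rw [max_eq_left, min_eq_right] <;> try linarith
          exact min_le_of_left_le (by linarith)
        · rw [min_eq_left, max_eq_right, min_eq_right] <;> linarith
        · rw [min_eq_right, max_eq_right, min_eq_left] <;> linarith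
      · change (m 0 s : ℝ) = 1 / 2 * lo s
        rw [hm, coe_lo s]
        rcases le_total (s : ℝ) (1 / 2) with h | h
        · rw [min_eq_left h, min_eq_right (by linarith)]; simp
        · rw [min_eq_right h, min_eq_left (by linarith)]; simp
      · change (m 1 s : ℝ) = ω s
        have h1 := s.2.1
        have h2 := s.2.2
        rw [hm, hω, coe_lo, coe_hi, Set.Icc.coe_one, one_mul]
        rcases le_total (s : ℝ) (1 / 2) with h | h
        · rw [min_eq_left h, max_eq_left (a := (0 : ℝ)) (by linarith), max_eq_left]
          · simp
          · exact min_le_of_left_le (by linarith)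
        · rw [min_eq_right h, max_eq_right (a := (0 : ℝ)) (by linarith)]
          rcases le_total (s : ℝ) (3 / 4) with h | h
          · rw [min_eq_right, min_eq_left, max_eq_right] <;> linarith
          · rw [min_eq_left, min_eq_right, max_eq_right] <;> linarith
      · intro t
        rw [trans_eq_cat, trans_eq_cat]
        unfold cat
        split_ifs
        · rfl
        · exact ext_apply fun s => hωcat (ρ (hi t) s)
      · intro t
        rw [trans_eq_cat, trans_eq_cat]
        unfold cat
        split_ifs
        · refine ext_apply fun s => ?_
          change ((γ (lo t * lo s) : A) : X) = (γ.trans γ') (half * (lo t * lo s))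
          rw [trans_left γ γ' (v := lo t * lo s) rfl]
        · refine ext_apply fun s => ?_
          change cat (incl γ) (fun r => ((γ' (hi t * lo r) : A) : X)) s = (γ.trans γ') (m (hi t) s)
          unfold cat
          split_ifs with hs
          · have h0 : hi s = 0 := Subtype.ext (by
              rw [coe_hi]; simp only [Set.Icc.coe_zero]; rw [max_eq_left]; linarith)
            rw [trans_left γ γ' (v := lo s)]
            · rfl
            · rw [hm, h0, lo_zero, coe_lo, min_eq_left hs, min_eq_right (by linarith)]
              simp
          · rw [trans_right γ γ' (v := hi t * lo (hi s))]
            rw [hm, min_eq_right (by linarith), Set.Icc.coe_mul]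
    exact Homotopic.Quotient.eq.2 key
  rw [transport_of K hK φ]
  have e : φ.map g = (φ.map (precat (incl γ'))).map (precat (incl γ)) := by
    obtain ⟨p, rfl⟩ := Homotopic.Quotient.mk_surjective φ
    rfl
  rw [e, transport, transport, map_trans, map_trans, map_symm, symm_trans_rev]
  simp only [Homotopic.Quotient.trans_assoc]

theorem transport_endpoint (γ : Path x x) (φ : Homotopic.Quotient (base A x) (base A x)) :
    (transport γ φ).map (endpoint A x) = ((Homotopic.Quotient.mk γ).trans
      (φ.map (endpoint A x))).trans (Homotopic.Quotient.mk γ).symm := by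
  obtain ⟨p, rfl⟩ := Homotopic.Quotient.mk_surjective φ
  have key : (((grow γ).trans (p.map (precat (incl γ)).continuous)).trans (grow γ).symm).map
      (endpoint A x).continuous = (γ.trans (p.map (endpoint A x).continuous)).trans γ.symm := by
    have h1 : lo 1 = 1 := Subtype.ext (by rw [coe_lo]; norm_num)
    have hg (t : I) : endpoint A x (grow γ t) = γ t := by
      refine Subtype.ext ?_
      change ((γ (t * lo 1) : A) : X) = γ t
      rw [h1, mul_one]
    refine Path.ext (funext fun t => ?_)
    change endpoint A x (cat (cat (grow γ) fun s => precat (incl γ) (p s))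
      (fun s => grow γ (unitInterval.symm s)) t) =
      cat (cat γ fun s => endpoint A x (p s)) (fun s => γ (unitInterval.symm s)) t
    unfold cat
    split_ifs
    · exact hg _
    · exact Subtype.ext (cat_one _ _)
    · exact hg _
  exact congrArg Homotopic.Quotient.mk key

theorem transport_boundary (p : Path (base A x) (base A x))
    (ψ : Homotopic.Quotient (base A x) (base A x)) :
    transport (p.map (endpoint A x).continuous) ψ =
      ((Homotopic.Quotient.mk p).trans ψ).trans (Homotopic.Quotient.mk p).symm := by
  let γ : Path x x := p.map (endpoint A x).continuous
  let f (u v : I) : X := (p u).1 v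
  have hf : Continuous fun z : I × I => f z.1 z.2 :=
    continuous_eval_comp (by fun_prop) continuous_snd
  have hl1 : lo 1 = 1 := Subtype.ext (by rw [coe_lo]; norm_num)
  have f0 (v : I) : f 0 v = x := by simp only [f, p.source]; rfl
  have f1 (v : I) : f 1 v = x := by simp only [f, p.target]; rfl
  have fb (u : I) : f u 0 = x := (p u).2.1
  have ft (u : I) : f u 1 = γ u := rfl
  have hγ (r : I) : ((Path.refl x).trans γ) r = γ (hi r) := by
    rw [trans_eq_cat]
    unfold cat
    split_ifs with hr
    · have : hi r = 0 := Subtype.ext (by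
        rw [coe_hi]; simp only [Set.Icc.coe_zero]; rw [max_eq_left]; linarith)
      rw [this, γ.source]
      rfl
    · rfl
  have hγ' (r : I) : f (hi r) (lo r) = ((Path.refl x).trans γ) r := by
    rw [hγ]
    rcases le_total (r : ℝ) (1 / 2) with hr | hr
    · have : hi r = 0 := Subtype.ext (by
        rw [coe_hi]; simp only [Set.Icc.coe_zero]; rw [max_eq_left]; linarith)
      rw [this, γ.source, f0]
    · have : lo r = 1 := Subtype.ext (by
        rw [coe_lo]; simp only [Set.Icc.coe_one]; rw [min_eq_left]; linarith)
      rw [this, ft]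
  let K : (precat (incl ((Path.refl x).trans γ))).Homotopy (precat (incl (Path.refl x))) :=
    { toContinuousMap := family (fun z : I × PathSpace A x =>
          cat (fun s => f (max z.1 (hi s)) (lo s)) z.2.1)
        (continuous_cat (f := fun (z : I × PathSpace A x) s => f (max z.1 (hi s)) (lo s))
          (g := fun z => z.2.1)
          (hf.comp (f := fun z : (I × PathSpace A x) × I => (max z.1.1 (hi z.2), lo z.2))
            (by fun_prop))
          (continuous_eval_comp (continuous_snd.comp continuous_fst) continuous_snd)
          (fun z => by rw [hi_one, hl1, z.2.2.1, max_eq_right unitInterval.le_one', f1]))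
        (fun z => by rw [cat_zero, lo_zero, fb]) (fun z => by rw [cat_one]; exact z.2.2.2)
      map_zero_left := fun q => ext_apply fun s => by
        change cat (fun s => f (max 0 (hi s)) (lo s)) q.1 s =
          cat (fun r => (((Path.refl x).trans γ) r : X)) q.1 s
        have : (fun s => f (max 0 (hi s)) (lo s)) =
            fun r => (((Path.refl x).trans γ) r : X) := funext fun s => by
          rw [max_eq_right unitInterval.nonneg', hγ']
        rw [this]
      map_one_left := fun q => ext_apply fun s => by
        change cat (fun s => f (max 1 (hi s)) (lo s)) q.1 s = cat (fun _ => (x : X)) q.1 s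
        have : (fun s => f (max 1 (hi s)) (lo s)) = fun _ => (x : X) := funext fun s => by
          rw [max_eq_left unitInterval.le_one', f1]
        rw [this] }
  let a : Path (base A x) (precat (incl ((Path.refl x).trans γ)) (base A x)) :=
    { toFun := family (fun t s => (γ (t * hi (lo s)) : X)) (by fun_prop)
        (fun t => by simp only [lo_zero, hi_zero, mul_zero, γ.source]) (fun t => (γ _).2)
      continuous_toFun := ContinuousMap.continuous _
      source' := ext_apply fun s => by
        change ((γ (0 * hi (lo s)) : A) : X) = x
        rw [zero_mul, γ.source]
      target' := ext_apply fun s => by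
        change ((γ (1 * hi (lo s)) : A) : X) =
          cat (incl ((Path.refl x).trans γ)) (fun _ => (x : X)) s
        rw [cat_const (incl ((Path.refl x).trans γ)) (x := x) (by simp), one_mul, ← hγ]
        rfl }
  have ha : (grow ((Path.refl x).trans γ)).Homotopic a := by
    refine homotopic_of_factor (pull γ) (z := ⟨ContinuousMap.const I 0, rfl⟩)
      (w := ⟨hi.comp lo, by simp [lo_zero, hi_zero]⟩)
      (reparamPath (fun t s => hi (t * lo s)) (by fun_prop)
        (fun t => by simp [lo_zero, hi_zero]) _ _ (fun s => by simp [hi_zero])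
        (fun s => by simp))
      (reparamPath (fun t s => t * hi (lo s)) (by fun_prop)
        (fun t => by simp [lo_zero, hi_zero]) _ _ (fun s => by simp)
        (fun s => by simp)) ?_ ?_
    · intro t
      refine ext_apply fun s => ?_
      change (((Path.refl x).trans γ) (t * lo s) : X) = γ (hi (t * lo s))
      rw [hγ]
    · intro t; rfl
  have key : (a.trans (K.evalAt (base A x))).Homotopic
      (((Path.refl _).trans p).trans (grow (Path.refl x))) := by
    let θ (e s : I) : I := Set.projIcc 0 1 zero_le_one ((1 - (e : ℝ)) * s + e * lo (lo s))
    have hθ : Continuous fun z : I × I => θ z.1 z.2 := by fun_prop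
    have θ0 (s : I) : θ 0 s = s := by simp [θ]
    have θ1 (s : I) : θ 1 s = lo (lo s) := by simp [θ]
    have θs (e : I) : θ e 0 = 0 := by simp [θ, lo_zero]
    have θt (e : I) : θ e 1 = 1 := by simp [θ, hl1]
    let Q : C(I × I × I, PathSpace A x) := family
      (fun z s => f (max z.2.1 (z.1 * hi (lo s))) (θ z.2.2 s))
      (hf.comp (f := fun z : (I × I × I) × I =>
        (max z.1.2.1 (z.1.1 * hi (lo z.2)), θ z.1.2.2 z.2))
        (Continuous.prodMk (by fun_prop)
          (hθ.comp (f := fun z : (I × I × I) × I => (z.1.2.2, z.2)) (by fun_prop))))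
      (fun z => by rw [θs, fb]) (fun z => by rw [θt, ft]; exact (γ _).2)
    refine homotopic_of_factor Q (z := (0, 0, 1)) (w := (1, 1, 1))
      (Path.trans (y := (1, 0, 1))
        (Path.prod Path.id (Path.prod (Path.refl 0) (Path.refl 1)))
        (Path.prod (Path.refl 1) (Path.prod Path.id (Path.refl 1))))
      (Path.trans (y := (0, 1, 0)) (Path.trans (y := (0, 0, 0))
        (Path.prod (Path.refl 0) (Path.prod (Path.refl 0) Path.id.symm))
        (Path.prod (Path.refl 0) (Path.prod Path.id (Path.refl 0))))
        (Path.prod Path.id (Path.prod (Path.refl 1) Path.id))) ?_ ?_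
    · intro t
      rw [trans_eq_cat, trans_eq_cat]
      unfold cat
      split_ifs
      · refine ext_apply fun s => ?_
        change ((γ (lo t * hi (lo s)) : A) : X) = f (max 0 (lo t * hi (lo s))) (θ 1 s)
        rw [θ1, max_eq_right unitInterval.nonneg']
        rcases le_total (lo s : ℝ) (1 / 2) with hr | hr
        · have : hi (lo s) = 0 := Subtype.ext (by
            rw [coe_hi]; simp only [Set.Icc.coe_zero]; rw [max_eq_left]; linarith)
          rw [this, mul_zero, γ.source, f0]
        · have : lo (lo s) = 1 := Subtype.ext (by
            rw [coe_lo (lo s)]; simp only [Set.Icc.coe_one]; rw [min_eq_left]; linarith)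
          rw [this, ft]
      · refine ext_apply fun s => ?_
        change cat (fun s => f (max (hi t) (hi s)) (lo s)) (fun _ => (x : X)) s =
          f (max (hi t) (1 * hi (lo s))) (θ 1 s)
        rw [cat_const _ (by
          rw [hi_one, hl1, max_eq_right unitInterval.le_one', f1]), θ1, one_mul]
    · intro t
      rw [trans_eq_cat, trans_eq_cat]
      unfold cat
      split_ifs
      · change cat (fun _ => base A x) p (lo t) = _
        rw [trans_eq_cat]
        unfold cat
        split_ifs
        · refine ext_apply fun s => ?_
          change (x : X) = f (max 0 (0 * hi (lo s))) (θ _ s)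
          rw [zero_mul, max_self, f0]
        · refine ext_apply fun s => ?_
          change f (hi (lo t)) s = f (max (hi (lo t)) (0 * hi (lo s))) (θ 0 s)
          rw [θ0, zero_mul, max_eq_left unitInterval.nonneg']
      · refine ext_apply fun s => ?_
        change (x : X) = f (max 1 (hi t * hi (lo s))) (θ (hi t) s)
        rw [max_eq_left unitInterval.le_one', f1]
  have hK : (Homotopic.Quotient.mk (grow ((Path.refl x).trans γ))).trans
      (Homotopic.Quotient.mk (K.evalAt (base A x))) =
      (Homotopic.Quotient.mk p).trans (Homotopic.Quotient.mk (grow (Path.refl x))) := by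
    rw [Homotopic.Quotient.eq.2 ha, ← Homotopic.Quotient.mk_trans, Homotopic.Quotient.eq.2 key,
      Homotopic.Quotient.mk_trans, Homotopic.Quotient.mk_trans, Homotopic.Quotient.mk_refl,
      Homotopic.Quotient.refl_trans]
  have hγγ : γ.Homotopic ((Path.refl x).trans γ) := ⟨(Path.Homotopy.reflTrans γ).symm⟩
  change transport γ ψ = _
  rw [transport_congr hγγ, transport_of K hK ψ, symm_trans_rev]
  conv_rhs => rw [← transport_refl ψ, transport]
  simp only [Homotopic.Quotient.trans_assoc]

theorem transport_mul (γ : Path x x) (φ ψ : Homotopic.Quotient (base A x) (base A x)) :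
    transport γ (φ.trans ψ) = (transport γ φ).trans (transport γ ψ) := by
  have h : (Homotopic.Quotient.mk (grow γ)).symm.trans ((Homotopic.Quotient.mk (grow γ)).trans
      ((ψ.map (precat (incl γ))).trans (Homotopic.Quotient.mk (grow γ)).symm)) =
      (ψ.map (precat (incl γ))).trans (Homotopic.Quotient.mk (grow γ)).symm := by
    rw [← Homotopic.Quotient.trans_assoc, Homotopic.Quotient.symm_trans,
      Homotopic.Quotient.refl_trans]
  simp only [transport, map_trans, Homotopic.Quotient.trans_assoc, h]

theorem transport_unit (γ : Path x x) :
    transport γ (Homotopic.Quotient.refl (base A x)) = Homotopic.Quotient.refl (base A x) := by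
  have h : (Homotopic.Quotient.refl (base A x)).map (precat (incl γ)) =
    Homotopic.Quotient.refl _ := rfl
  rw [transport, h, Homotopic.Quotient.trans_refl, Homotopic.Quotient.trans_symm]

theorem conj_assoc {Y : Type*} [TopologicalSpace Y] {a : Y} (p : Path a a)
    (q : Homotopic.Quotient a a) :
    ((Homotopic.Quotient.mk p.symm).trans q).trans (Homotopic.Quotient.mk p.symm).symm =
      (Homotopic.Quotient.mk p).symm.trans (q.trans (Homotopic.Quotient.mk p)) := by
  rw [← Homotopic.Quotient.mk_symm, Path.symm_symm, Homotopic.Quotient.mk_symm,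
    Homotopic.Quotient.trans_assoc]

/-- `transport` on homotopy classes of loops. -/
def transportClass (g : Homotopic.Quotient x x) (φ : Homotopic.Quotient (base A x) (base A x)) :
    Homotopic.Quotient (base A x) (base A x) :=
  _root_.Quotient.lift (fun γ => transport γ φ) (fun _ _ h => transport_congr h φ) g

end

end RelHomotopy

/-- The second relative homotopy group `π₂(X, A, x)`, `x ∈ A`: the fundamental group, at the
constant path, of the space of paths in `X` from `x` to points of `A`. By adjunction its elements
are the homotopy classes of maps of `[0, 1]²` to `X` that send one distinguished side into `A` and
the three other sides to `x`. -/
def RelPi2 {X : Type u} [TopologicalSpace X] (A : Set X) (x : A) : Type u :=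
  FundamentalGroup (RelHomotopy.PathSpace A x) (RelHomotopy.base A x)

namespace RelPi2

open RelHomotopy Path

variable {X : Type u} [TopologicalSpace X] (A : Set X) (x : A)

instance : Group (RelPi2 A x) :=
  inferInstanceAs (Group (FundamentalGroup (PathSpace A x) (base A x)))

/-- The left action of `π₁(A, x)` on `π₂(X, A, x)`. The product `g * h` of Mathlib's fundamental
group runs through `h` first, so the left action of `g` is the transport along `g⁻¹`. -/
instance : MulDistribMulAction (FundamentalGroup A x) (RelPi2 A x) where
  smul g φ := transportClass (Homotopic.Quotient.symm g) φ
  one_smul φ := transport_refl φ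
  mul_smul g h φ := by
    obtain ⟨g, rfl⟩ := Homotopic.Quotient.mk_surjective g
    obtain ⟨h, rfl⟩ := Homotopic.Quotient.mk_surjective h
    change transport (h.trans g).symm φ = transport g.symm (transport h.symm φ)
    exact (congrArg (fun γ => transport γ φ) (Path.trans_symm h g)).trans
      (transport_trans g.symm h.symm φ)
  smul_mul g φ ψ := by
    obtain ⟨g, rfl⟩ := Homotopic.Quotient.mk_surjective g
    exact transport_mul g.symm ψ φ
  smul_one g := by
    obtain ⟨g, rfl⟩ := Homotopic.Quotient.mk_surjective g
    exact transport_unit g.symm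

/-- The boundary homomorphism `π₂(X, A, x) → π₁(A, x)`. -/
def boundary : RelPi2 A x →* FundamentalGroup A x :=
  FundamentalGroup.map (endpoint A x) (base A x)

/-- `π₂(X, A, x)` as a crossed `π₁(A, x)`-module. -/
def crossedModule : CrossedModule (RelPi2 A x) (FundamentalGroup A x) where
  d := boundary A x
  equivariant g φ := by
    obtain ⟨g, rfl⟩ := Homotopic.Quotient.mk_surjective g
    exact (transport_endpoint g.symm φ).trans (conj_assoc g _)
  peiffer φ ψ := by
    obtain ⟨p, rfl⟩ := Homotopic.Quotient.mk_surjective φ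
    exact (transport_boundary p.symm ψ).trans (conj_assoc p ψ)

/-- The map `[0, 1]² → X`, `(s, t) ↦ p s t`, adjoint to a loop `p` in the space of paths. -/
def adjoint (p : Path (base A x) (base A x)) : C(I × I, X) :=
  ⟨fun z => (p z.1).1 z.2, continuous_eval_comp (by fun_prop) continuous_snd⟩

theorem adjoint_mem (p : Path (base A x) (base A x)) :
    Singular.squareChain (adjoint A x p) ∈ Singular.relCycles A 2 := by
  refine Singular.squareChain_mem _ (fun t => ?_) (fun t => ?_) (fun s => ?_) (fun s => ?_)
  · change (p 0).1 t ∈ A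
    rw [p.source]
    exact x.2
  · change (p 1).1 t ∈ A
    rw [p.target]
    exact x.2
  · change (p s).1 0 ∈ A
    rw [(p s).2.1]
    exact x.2
  · exact (p s).2.2

/-- The Hurewicz map `π₂(X, A, x) → H₂(X, A)`: the class of a map `[0, 1]² → X` goes to the
homology class of this map restricted to the two triangles that form the square. -/
def hurewicz : RelPi2 A x → Singular.RelHomology A 2 :=
  _root_.Quotient.lift (fun p : Path (base A x) (base A x) =>
    Submodule.Quotient.mk ⟨Singular.squareChain (adjoint A x p), adjoint_mem A x p⟩) (by
    rintro p q ⟨H⟩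
    refine ((Submodule.Quotient.eq _).2 ?_).symm
    change Singular.squareChain (adjoint A x q) - Singular.squareChain (adjoint A x p) ∈
      Singular.relBoundaries A 2
    refine Singular.squareChain_homologous _ _
      ⟨fun z => (H (z.1, z.2.1)).1 z.2.2, continuous_eval_comp (by fun_prop) (by fun_prop)⟩
      (fun z => ?_) (fun z => ?_) (fun r t => ?_) (fun r t => ?_) (fun r s => ?_) (fun r s => ?_)
    · change (H (0, z.1)).1 z.2 = (p z.1).1 z.2
      rw [H.apply_zero]
      rfl
    · change (H (1, z.1)).1 z.2 = (q z.1).1 z.2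
      rw [H.apply_one]
      rfl
    · change (H (r, 0)).1 t ∈ A
      rw [H.source]
      exact x.2
    · change (H (r, 1)).1 t ∈ A
      rw [H.target]
      exact x.2
    · change (H (r, s)).1 0 ∈ A
      rw [(H (r, s)).2.1]
      exact x.2
    · exact (H (r, s)).2.2)

end RelPi2

end

/-! The crossed module `π₂(W, V₁, x)` is finitely generated and the Hurewicz map to `H₂(W, V₁)` is
surjective and does not see the action of `π₁(V₁, x)`. Granted these two facts the rest is algebra:
a generating system of the crossed module with the least number of members maps to a generating
system of the abelian group `H₂(W, V₁)`, and elementary moves `α i ↦ α i * α j ^ q` keep the crossed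
module generated. In an abelian group such moves turn every generating system with too many members
into one with a zero member, hence eventually into a minimal generating system followed by zeros
(`Nielsen.exists_minimal_image`, `CrossedModule.exists_isMinimalGenerating`). The kernel of the
Hurewicz map plays no role.

Surjectivity of the Hurewicz map (`RelPi2.hurewicz_surjective`): every singular `1`-simplex spans a
square between chosen paths from `x` to its vertices. By homotopy extension for the square, pushing
a `2`-simplex down along the squares on its faces leaves a sphere based at `x`. So a relative cycle
is spherical up to squares spanned by simplices of `V₁`, and these are spherical as well. Since
`W` is simply connected, `π₂(W, V₁, x) → π₁(V₁, x)` is onto, so that the operators act through inner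
automorphisms.

Finite generation (`RelPi2.exists_finite_generates`): the group `π₁(V₁, x)` is finitely generated
because `V₁` is compact and locally contractible (`SmallPaths.exists_finite_generators`). The kernel
of the boundary map is central and is the image of the fundamental group of the loop space of `W`.
Its finite generation replaces that of `π₂(W)`, and is obtained without triangulations and spectral
sequences. Let `q` be a homomorphism from the fundamental group of the loop space to an abelian
group, extended to a functor on the fundamental groupoid, a *holonomy*. Over a contractible subset
of `W`, the paths from `x` into the subset can be closed up to loops, continuously and uniquely up
to homotopy, and `q` gives a holonomy on the space of these paths. On overlaps of a finite cover of
`W` these holonomies differ by coboundaries, which satisfy the cocycle condition up to finitely many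
constants. Modulo the subgroup generated by these constants the holonomies can be glued to one on
the contractible space of all paths from `x`, and therefore `q` takes its values in that subgroup
(`FreeEnd.exists_finite_holonomy`).

Local contractibility of the boundary and of its components needs that boundary points are detected
by every chart, `TopManifold.coord_eq_zero_of_coord_eq_zero`. This follows from the absence of
retractions of a ball onto its boundary sphere, which is proved by the volume argument of Milnor and
Rogers (`NoRetraction.exists_zero_of_eq_on_sphere`). -/

/-! ### No retraction of a ball onto its boundary sphere -/

namespace NoRetraction

open Metric MeasureTheory

variable {n : ℕ}

local notation "𝔼" n => EuclideanSpace ℝ (Fin n)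

/-- `det (1 + t A)` is a polynomial in `t` of degree at most `n`, so its value at `t = 1` is a
combination of its values at any `n + 1` nodes, with weights that do not depend on `A`. -/
theorem exists_det_interpolation (v : Fin (n + 1) → ℝ) (hv : Function.Injective v) :
    ∃ w : Fin (n + 1) → ℝ, ∑ i, w i = 1 ∧ ∀ A : (𝔼 n) →L[ℝ] (𝔼 n),
      (1 + A).det = ∑ i, w i * (1 + v i • A).det := by
  classical
  refine ⟨fun i => (Lagrange.basis Finset.univ v i).eval 1, ?_, fun A => ?_⟩
  · rw [← Polynomial.eval_finsetSum, Lagrange.sum_basis (fun _ _ _ _ h => hv h)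
      Finset.univ_nonempty, Polynomial.eval_one]
  · let b := (EuclideanSpace.basisFun (Fin n) ℝ).toBasis
    let M : Matrix (Fin n) (Fin n) ℝ := LinearMap.toMatrix b b A.toLinearMap
    let P : Polynomial ℝ := (((Polynomial.X : Polynomial ℝ) • M.map Polynomial.C +
      (1 : Matrix (Fin n) (Fin n) ℝ).map Polynomial.C).det)
    have hP (t : ℝ) : P.eval t = (1 + t • A).det := by
      have h1 : (1 + t • A).det = LinearMap.det (1 + t • A.toLinearMap) := rfl
      rw [h1, ← LinearMap.det_toMatrix b, map_add, map_smul, LinearMap.toMatrix_one]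
      change Polynomial.evalRingHom t P = _
      rw [RingHom.map_det]
      congr 1
      ext i j
      simp [M, Matrix.one_apply]
      split_ifs <;> simp <;> ring
    have hdeg : P.degree < (Finset.univ : Finset (Fin (n + 1))).card := by
      refine (Polynomial.degree_le_natDegree).trans_lt ?_
      have := Polynomial.natDegree_det_X_add_C_le M 1
      simp only [Fintype.card_fin] at this
      simp only [Finset.card_univ, Fintype.card_fin]
      exact_mod_cast Nat.lt_succ_of_le this
    have h := Lagrange.eq_interpolate (s := Finset.univ) (v := v) (fun _ _ _ _ h => hv h) hdeg
    have h2 := congrArg (Polynomial.eval 1) h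
    rw [Lagrange.interpolate_apply, Polynomial.eval_finsetSum] at h2
    simp only [Polynomial.eval_mul, Polynomial.eval_C, hP, one_smul] at h2
    rw [h2]
    exact Finset.sum_congr rfl fun i _ => mul_comm _ _

theorem det_one_add_pos (A : (𝔼 n) →L[ℝ] (𝔼 n)) (hA : ‖A‖ < 1) : 0 < (1 + A).det := by
  have hne (s : ℝ) (hs : s ∈ Set.Icc (0 : ℝ) 1) : (1 + s • A).det ≠ 0 := by
    have hu : IsUnit (1 + s • A) := by
      have : ‖-(s • A)‖ < 1 := by
        rw [norm_neg, norm_smul, Real.norm_eq_abs, abs_of_nonneg hs.1]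
        exact (mul_le_of_le_one_left (norm_nonneg _) hs.2).trans_lt hA
      simpa using isUnit_one_sub_of_norm_lt_one this
    obtain ⟨B, hB⟩ := hu.exists_right_inv
    have h1 : LinearMap.det ((1 + s • A).toLinearMap * B.toLinearMap) = 1 :=
      (congrArg ContinuousLinearMap.det hB).trans LinearMap.det_id
    rw [map_mul] at h1
    exact left_ne_zero_of_mul_eq_one h1
  have hc : Continuous fun s : ℝ => (1 + s • A).det :=
    ContinuousLinearMap.continuous_det.comp (by fun_prop)
  by_contra hneg
  have h0 : (1 + (0 : ℝ) • A).det = 1 := by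
    have : 1 + (0 : ℝ) • A = 1 := by ext y; simp
    rw [this]
    exact LinearMap.det_id
  have := intermediate_value_Icc' (zero_le_one' ℝ) hc.continuousOn
  obtain ⟨s, hs, hs0⟩ := this (show (0 : ℝ) ∈ Set.Icc _ _ from
    ⟨by simpa using not_lt.1 hneg, by rw [h0]; exact zero_le_one⟩)
  exact hne s hs hs0

/-- A map that is Lipschitz on the ball and vanishes on its boundary sphere stays Lipschitz when
it is extended by zero. -/
theorem lipschitz_extend {R : ℝ} {u : (𝔼 n) → 𝔼 n} {L : ℝ} (hL : 0 ≤ L)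
    (hu : ∀ x ∈ closedBall (0 : 𝔼 n) R, ∀ y ∈ closedBall (0 : 𝔼 n) R, ‖u x - u y‖ ≤ L * ‖x - y‖)
    (h0 : ∀ x, R ≤ ‖x‖ → u x = 0) (x y : 𝔼 n) : ‖u x - u y‖ ≤ L * ‖x - y‖ := by
  have key (x y : 𝔼 n) (hx : ‖x‖ ≤ R) (hy : R < ‖y‖) : ‖u x - u y‖ ≤ L * ‖x - y‖ := by
    have hc : Continuous fun s : ℝ => ‖x + s • (y - x)‖ := by fun_prop
    obtain ⟨s, hs, hs1⟩ := intermediate_value_Icc (zero_le_one' ℝ) hc.continuousOn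
      (show R ∈ Set.Icc _ _ from ⟨by simpa using hx, by simpa using hy.le⟩)
    simp only at hs1
    set z := x + s • (y - x)
    have hz : u z = u y := by rw [h0 z hs1.ge, h0 y hy.le]
    rw [← hz]
    refine (hu x (by simpa using hx) z (by simp [hs1])).trans ?_
    refine mul_le_mul_of_nonneg_left ?_ hL
    have : x - z = s • (x - y) := by simp only [z]; rw [← neg_sub y x, smul_neg]; abel
    rw [this, norm_smul, Real.norm_eq_abs, abs_of_nonneg hs.1]
    exact mul_le_of_le_one_left (norm_nonneg _) hs.2
  rcases le_or_gt ‖x‖ R with hx | hx <;> rcases le_or_gt ‖y‖ R with hy | hy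
  · exact hu x (by simpa using hx) y (by simpa using hy)
  · exact key x y hx hy
  · rw [norm_sub_rev, norm_sub_rev x]; exact key y x hy hx
  · rw [h0 x hx.le, h0 y hy.le]; simp; positivity

/-- For small `t` the perturbation `x + t u x` of the identity permutes the ball, so the integral
of its Jacobian determinant is the volume of the ball. -/
theorem integral_det_eq {R L t : ℝ} {u : (𝔼 n) → 𝔼 n} {u' : (𝔼 n) → (𝔼 n) →L[ℝ] (𝔼 n)}
    (hL : 0 ≤ L) (hu : ∀ x y, ‖u x - u y‖ ≤ L * ‖x - y‖)
    (h0 : ∀ x, R ≤ ‖x‖ → u x = 0) (hd : ∀ x ∈ ball (0 : 𝔼 n) R, HasFDerivAt u (u' x) x)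
    (ht : 0 ≤ t) (htL : t * L < 1) :
    ∫ x in ball (0 : 𝔼 n) R, (1 + t • u' x).det = volume.real (ball (0 : 𝔼 n) R) := by
  let f : (𝔼 n) → 𝔼 n := fun x => x + t • u x
  have hf : ApproximatesLinearOn f ((ContinuousLinearEquiv.refl ℝ (𝔼 n) : (𝔼 n) →L[ℝ] (𝔼 n)))
      Set.univ ⟨t * L, mul_nonneg ht hL⟩ := by
    intro x _ y _
    have : f x - f y - (ContinuousLinearEquiv.refl ℝ (𝔼 n) : (𝔼 n) →L[ℝ] (𝔼 n)) (x - y) =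
        t • (u x - u y) := by
      simp only [f, ContinuousLinearEquiv.coe_refl, ContinuousLinearMap.coe_id', id_eq, smul_sub]
      abel
    rw [this, norm_smul, Real.norm_eq_abs, abs_of_nonneg ht]
    change _ ≤ t * L * _
    rw [mul_assoc]
    exact mul_le_mul_of_nonneg_left (hu x y) ht
  have hc : Subsingleton (𝔼 n) ∨ (⟨t * L, mul_nonneg ht hL⟩ : NNReal) <
      ‖((ContinuousLinearEquiv.refl ℝ (𝔼 n)).symm : (𝔼 n) →L[ℝ] (𝔼 n))‖₊⁻¹ := by
    rcases subsingleton_or_nontrivial (𝔼 n) with h | h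
    · exact Or.inl h
    · right
      have : ‖((ContinuousLinearEquiv.refl ℝ (𝔼 n)).symm : (𝔼 n) →L[ℝ] (𝔼 n))‖₊ = 1 :=
        ContinuousLinearMap.nnnorm_id
      rw [this, inv_one]
      exact htL
  have hbij : Function.Bijective f := (hf.toHomeomorph f hc).bijective
  have hout (x : 𝔼 n) (hx : R ≤ ‖x‖) : f x = x := by simp [f, h0 x hx]
  have himg : f '' ball (0 : 𝔼 n) R = ball (0 : 𝔼 n) R := by
    apply Set.Subset.antisymm
    · rintro _ ⟨x, hx, rfl⟩
      by_contra hfx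
      have h1 : R ≤ ‖f x‖ := by simpa using hfx
      have := hbij.1 (hout _ h1)
      rw [this] at h1
      simp at hx
      linarith
    · intro y hy
      obtain ⟨x, rfl⟩ := hbij.2 y
      refine ⟨x, ?_, rfl⟩
      by_contra hx
      have h1 : R ≤ ‖x‖ := by simpa using hx
      rw [hout x h1] at hy
      exact hx hy
  have h1 := integral_image_eq_integral_abs_det_fderiv_smul volume (s := ball (0 : 𝔼 n) R)
    (f := f) (f' := fun x => 1 + t • u' x) isOpen_ball.measurableSet
    (fun x hx => ((hasFDerivAt_id x).add ((hd x hx).const_smul t)).hasFDerivWithinAt)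
    hbij.1.injOn (fun _ => (1 : ℝ))
  rw [himg] at h1
  simp only [integral_const, smul_eq_mul, mul_one] at h1
  rw [MeasureTheory.measureReal_restrict_apply_univ] at h1
  rw [h1]
  refine setIntegral_congr_fun isOpen_ball.measurableSet fun x hx => ?_
  have hn : ‖u' x‖ ≤ L := by
    refine (hd x hx).le_of_lip' hL (Filter.Eventually.of_forall fun y => ?_)
    exact hu y x
  refine (abs_of_pos (det_one_add_pos _ ?_)).symm
  rw [norm_smul, Real.norm_eq_abs, abs_of_nonneg ht]
  exact (mul_le_mul_of_nonneg_left hn ht).trans_lt htL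

/-- There is no continuously differentiable retraction of a ball onto its boundary sphere. -/
theorem no_smooth_retraction {R : ℝ} (hR : 0 < R) {V : Set (𝔼 n)} (hV : IsOpen V)
    (hRV : closedBall (0 : 𝔼 n) R ⊆ V) {g : (𝔼 n) → 𝔼 n} (hg : ContDiffOn ℝ 1 g V)
    (hgR : ∀ x ∈ V, ‖g x‖ = R) (hid : ∀ x, ‖x‖ = R → g x = x) : False := by
  classical
  have hn : 0 < n := by
    rcases Nat.eq_zero_or_pos n with rfl | h
    · have := hgR 0 (hRV (by simpa using hR.le))
      rw [Subsingleton.elim (g 0) 0, norm_zero] at this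
      exact absurd this hR.ne
    · exact h
  have hda (x : 𝔼 n) (hx : x ∈ V) : DifferentiableAt ℝ g x :=
    (hg.differentiableOn one_ne_zero).differentiableAt (hV.mem_nhds hx)
  have hcf : ContinuousOn (fderiv ℝ g) V := hg.continuousOn_fderiv_of_isOpen hV le_rfl
  obtain ⟨K, hK⟩ := ((isCompact_closedBall (0 : 𝔼 n) R).image_of_continuousOn
    (hcf.mono hRV)).isBounded.exists_norm_le
  have hK0 : 0 ≤ K := (norm_nonneg _).trans (hK _ ⟨0, by simpa using hR.le, rfl⟩)
  let u : (𝔼 n) → 𝔼 n := fun x => if ‖x‖ < R then g x - x else 0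
  have hu_in (x : 𝔼 n) (hx : ‖x‖ ≤ R) : u x = g x - x := by
    by_cases h : ‖x‖ < R
    · simp [u, h]
    · have : ‖x‖ = R := le_antisymm hx (not_lt.1 h)
      simp [u, hid x this]
  have hu_out (x : 𝔼 n) (hx : R ≤ ‖x‖) : u x = 0 := by simp [u, not_lt.2 hx]
  have hu_lip : ∀ x y, ‖u x - u y‖ ≤ (K + 1) * ‖x - y‖ := by
    refine lipschitz_extend (by linarith) (fun x hx y hy => ?_) hu_out
    rw [hu_in x (by simpa using hx), hu_in y (by simpa using hy)]
    have h1 : ‖g x - g y‖ ≤ K * ‖x - y‖ :=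
      (convex_closedBall (0 : 𝔼 n) R).norm_image_sub_le_of_norm_fderiv_le (𝕜 := ℝ)
        (fun z hz => hda z (hRV hz)) (fun z hz => hK _ ⟨z, hz, rfl⟩) hy hx
    calc ‖g x - x - (g y - y)‖ = ‖(g x - g y) - (x - y)‖ := by congr 1; abel
      _ ≤ ‖g x - g y‖ + ‖x - y‖ := norm_sub_le _ _
      _ ≤ _ := by linarith
  let u' : (𝔼 n) → (𝔼 n) →L[ℝ] (𝔼 n) := fun x => fderiv ℝ g x - 1
  have hud (x : 𝔼 n) (hx : x ∈ ball (0 : 𝔼 n) R) : HasFDerivAt u (u' x) x := by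
    have hxV : x ∈ V := hRV (ball_subset_closedBall hx)
    refine HasFDerivAt.congr_of_eventuallyEq ((hda x hxV).hasFDerivAt.sub (hasFDerivAt_id x)) ?_
    filter_upwards [isOpen_ball.mem_nhds hx] with y hy
    exact hu_in y (by simpa using (mem_ball_zero_iff.1 hy).le)
  -- nodes so small that every `x + t u x` permutes the ball
  let v : Fin (n + 1) → ℝ := fun i => (i : ℝ) / ((n + 1) * (K + 1))
  have hvpos : (0 : ℝ) < (n + 1) * (K + 1) := by positivity
  have hv : Function.Injective v := fun i j h => by
    have : (i : ℝ) = j := by simpa [v, div_left_inj' hvpos.ne'] using h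
    exact Fin.ext (by exact_mod_cast this)
  obtain ⟨w, hw1, hw⟩ := exists_det_interpolation v hv
  have hint (i : Fin (n + 1)) : ∫ x in ball (0 : 𝔼 n) R, (1 + v i • u' x).det =
      volume.real (ball (0 : 𝔼 n) R) := by
    refine integral_det_eq (L := K + 1) (by linarith) hu_lip hu_out hud (by positivity) ?_
    have : (i : ℝ) < n + 1 := by exact_mod_cast i.2
    simp only [v]
    rw [div_mul_eq_mul_div, div_lt_one hvpos]
    exact mul_lt_mul_of_pos_right this (by linarith)
  have hdet0 (x : 𝔼 n) (hx : x ∈ ball (0 : 𝔼 n) R) : (1 + u' x).det = 0 := by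
    have hxV : x ∈ V := hRV (ball_subset_closedBall hx)
    have e : 1 + u' x = fderiv ℝ g x := by simp [u']
    rw [e]
    -- all values of the derivative are orthogonal to `g x`
    have horth (y : 𝔼 n) : inner ℝ (g x) (fderiv ℝ g x y) = 0 := by
      have h1 : HasFDerivAt (fun z => ‖g z‖ ^ 2) _ x := (hda x hxV).hasFDerivAt.norm_sq
      have h2 : HasFDerivAt (fun z => ‖g z‖ ^ 2) (0 : (𝔼 n) →L[ℝ] ℝ) x := by
        refine (hasFDerivAt_const (R ^ 2) x).congr_of_eventuallyEq ?_
        filter_upwards [hV.mem_nhds hxV] with z hz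
        rw [hgR z hz]
      have := congrArg (fun T : (𝔼 n) →L[ℝ] ℝ => T y) (h1.unique h2)
      simpa using this
    by_contra hne
    have hsurj : Function.Surjective (fderiv ℝ g x) := by
      exact (LinearMap.equivOfDetNeZero (fderiv ℝ g x).toLinearMap hne).surjective
    obtain ⟨y, hy⟩ := hsurj (g x)
    have := horth y
    rw [hy, real_inner_self_eq_norm_sq, hgR x hxV] at this
    exact hR.ne' (by simpa using this)
  have hcont : ContinuousOn u' (closedBall (0 : 𝔼 n) R) := (hcf.mono hRV).sub continuousOn_const
  have hintegrable (i : Fin (n + 1)) :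
      IntegrableOn (fun x => w i * (1 + v i • u' x).det) (ball (0 : 𝔼 n) R) := by
    refine IntegrableOn.mono_set (ContinuousOn.integrableOn_compact (isCompact_closedBall _ _) ?_)
      ball_subset_closedBall
    exact continuousOn_const.mul (ContinuousLinearMap.continuous_det.comp_continuousOn
      (continuousOn_const.add (ContinuousOn.const_smul hcont (v i))))
  have hfinal : (0 : ℝ) = volume.real (ball (0 : 𝔼 n) R) := by
    calc (0 : ℝ) = ∫ x in ball (0 : 𝔼 n) R, (1 + u' x).det := by
          rw [setIntegral_congr_fun isOpen_ball.measurableSet (g := fun _ => (0 : ℝ)) hdet0]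
          simp
      _ = ∫ x in ball (0 : 𝔼 n) R, ∑ i, w i * (1 + v i • u' x).det := by simp_rw [← hw]
      _ = ∑ i, w i * volume.real (ball (0 : 𝔼 n) R) := by
          rw [integral_finsetSum _ fun i _ => hintegrable i]
          simp_rw [integral_const_mul, hint]
      _ = _ := by rw [← Finset.sum_mul, hw1, one_mul]
  have : 0 < volume.real (ball (0 : 𝔼 n) R) :=
    ENNReal.toReal_pos (measure_ball_pos _ _ hR).ne' measure_ball_lt_top.ne
  linarith

/-- A continuous map of the ball that fixes the boundary sphere has a zero. -/
theorem exists_zero_of_eq_on_sphere {r : (𝔼 n) → 𝔼 n} {R : ℝ} (hR : 0 < R)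
    (hr : ContinuousOn r (closedBall 0 R)) (hid : ∀ x, ‖x‖ = R → r x = x) :
    ∃ x ∈ closedBall (0 : 𝔼 n) R, r x = 0 := by
  classical
  by_contra! hne
  let F : (𝔼 n) → 𝔼 n := fun x => if ‖x‖ ≤ R then r x else x
  have hFc : Continuous F := by
    refine continuous_if_le (f := fun x : 𝔼 n => ‖x‖) (g := fun _ => R) continuous_norm
      continuous_const ?_ continuousOn_id hid
    convert hr using 1
    ext x
    simp
  have hFne (x : 𝔼 n) : F x ≠ 0 := by
    by_cases h : ‖x‖ ≤ R
    · simpa [F, h] using hne x (by simpa using h)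
    · have : x ≠ 0 := by rintro rfl; simp at h; linarith
      simpa [F, h] using this
  have hS : IsClosed {x : 𝔼 n | 2 * R ≤ ‖x‖} := isClosed_le continuous_const continuous_norm
  have hU : {x : 𝔼 n | R < ‖x‖} ∈ nhdsSet {x : 𝔼 n | 2 * R ≤ ‖x‖} :=
    (isOpen_lt continuous_const continuous_norm).mem_nhdsSet.2 fun x hx => by
      simp only [Set.mem_ofPred_eq] at hx ⊢; linarith
  obtain ⟨G, hG, hGF, hGS, -⟩ := hFc.exists_contDiff_approx_and_eqOn 1 (ε := fun x => ‖F x‖)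
    hFc.norm (fun x => norm_pos_iff.2 (hFne x)) hS hU
    (contDiffOn_id.congr fun x hx => by
      simp only [Set.mem_ofPred_eq] at hx; simp [F, not_le.2 hx])
  have hGne (x : 𝔼 n) : G x ≠ 0 := fun h => by
    have := hGF x
    rw [h, dist_zero_left] at this
    exact lt_irrefl _ this
  refine no_smooth_retraction (R := 2 * R) (by linarith) isOpen_univ (Set.subset_univ _)
    (g := fun x => (2 * R / ‖G x‖) • G x) ?_ ?_ ?_
  · exact (ContDiff.smul (contDiff_const.div (hG.norm ℝ hGne)
      fun x => norm_ne_zero_iff.2 (hGne x)) hG).contDiffOn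
  · intro x _
    rw [norm_smul, norm_div, norm_norm, div_mul_cancel₀ _ (norm_ne_zero_iff.2 (hGne x))]
    rw [Real.norm_eq_abs, abs_of_pos (by linarith)]
  · intro x hx
    have h1 : G x = x := by
      rw [hGS (show x ∈ {x : 𝔼 n | 2 * R ≤ ‖x‖} from hx.ge)]
      simp only [F]
      rw [if_neg]
      rw [hx]; linarith
    simp only [h1, hx]
    rw [div_self (by linarith), one_smul]

end NoRetraction

/-! ### The boundary of a topological manifold -/

namespace TopManifold

open Metric Set Topology

section Invariance

variable {n : ℕ} [NeZero n]

/-- Invariance of the boundary of the half space: a homeomorphism between open subsets of the half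
space cannot move an interior point to a boundary point. Otherwise let `j` be the homeomorphism on
a small ball around the interior point `y`; pushing `j v` into the half space by a distance
proportional to `ε - ‖v - y‖` and applying the inverse gives a map of the ball that avoids `y` and
is the identity on the boundary sphere. -/
theorem coord_eq_zero_of_coord_eq_zero
    (e : OpenPartialHomeomorph (EuclideanHalfSpace n) (EuclideanHalfSpace n))
    {y : EuclideanHalfSpace n} (hy : y ∈ e.source) (h : (e y).1 0 = 0) : y.1 0 = 0 := by
  classical
  by_contra hy0
  have hypos : 0 < y.1 0 := lt_of_le_of_ne y.2 (Ne.symm hy0)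
  let J := 𝓡∂ n
  have hJ (p : EuclideanHalfSpace n) : J p = p.1 := rfl
  have hsymm (v : EuclideanSpace ℝ (Fin n)) (hv : 0 ≤ v 0) : (J.symm v).1 = v :=
    J.right_inv (by rw [range_modelWithCornersEuclideanHalfSpace]; exact hv)
  have hleft (p : EuclideanHalfSpace n) : J.symm p.1 = p := J.left_inv p
  let e₀ : EuclideanSpace ℝ (Fin n) := EuclideanSpace.single 0 1
  -- a ball around `e y` that lies in the target
  have htarget : {v : EuclideanSpace ℝ (Fin n) | J.symm v ∈ e.target} ∈ 𝓝 (e y).1 := by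
    refine J.continuous_symm.continuousAt.preimage_mem_nhds ?_
    rw [hleft]
    exact e.open_target.mem_nhds (e.map_source hy)
  obtain ⟨δ, hδ, hδt⟩ := Metric.mem_nhds_iff.1 htarget
  -- a ball around `y` in the source on which `e` is `δ / 2`-close to `e y`
  have hsource : {v : EuclideanSpace ℝ (Fin n) | J.symm v ∈ e.source ∧ 0 < v 0 ∧
      dist (e (J.symm v)).1 (e y).1 < δ / 2} ∈ 𝓝 y.1 := by
    have h1 : Filter.Tendsto (fun v => J.symm v) (𝓝 y.1) (𝓝 y) := by
      have := J.continuous_symm.tendsto y.1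
      rwa [hleft] at this
    have h2 : Filter.Tendsto (fun v => (e (J.symm v)).1) (𝓝 y.1) (𝓝 (e y).1) :=
      (continuous_subtype_val.tendsto _).comp ((e.continuousAt hy).tendsto.comp h1)
    have h3 : Continuous fun v : EuclideanSpace ℝ (Fin n) => v 0 := by fun_prop
    filter_upwards [h1 (e.open_source.mem_nhds hy), h2 (ball_mem_nhds _ (half_pos hδ)),
      h3.continuousAt.preimage_mem_nhds (lt_mem_nhds hypos)] with v a b c
    exact ⟨a, c, b⟩
  obtain ⟨ε', hε', hεs⟩ := Metric.nhds_basis_closedBall.mem_iff.1 hsource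
  set ε := min ε' (δ / 4)
  have hε : 0 < ε := lt_min hε' (by linarith)
  have hin (w : EuclideanSpace ℝ (Fin n)) (hw : ‖w‖ ≤ ε) :
      J.symm (y.1 + w) ∈ e.source ∧ 0 < (y.1 + w) 0 ∧
        dist (e (J.symm (y.1 + w))).1 (e y).1 < δ / 2 :=
    hεs (by simpa using hw.trans (min_le_left _ _))
  let q : EuclideanSpace ℝ (Fin n) → EuclideanSpace ℝ (Fin n) := fun w =>
    (e (J.symm (y.1 + w))).1 + (ε - ‖w‖) • e₀
  have hq0 (w : EuclideanSpace ℝ (Fin n)) : q w 0 = (e (J.symm (y.1 + w))).1 0 + (ε - ‖w‖) := by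
    simp [q, e₀]
  have hqpos (w : EuclideanSpace ℝ (Fin n)) (hw : ‖w‖ ≤ ε) : 0 ≤ q w 0 := by
    rw [hq0]
    exact add_nonneg (e _).2 (by linarith)
  have hqt (w : EuclideanSpace ℝ (Fin n)) (hw : ‖w‖ ≤ ε) : J.symm (q w) ∈ e.target := by
    refine hδt ?_
    rw [mem_ball]
    have h1 : dist (q w) (e (J.symm (y.1 + w))).1 ≤ δ / 4 := by
      rw [dist_eq_norm]
      simp only [q, add_sub_cancel_left, norm_smul, e₀, PiLp.norm_single, norm_one,
        mul_one, Real.norm_eq_abs]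
      rw [abs_of_nonneg (by linarith)]
      have := min_le_right ε' (δ / 4)
      have := norm_nonneg w
      linarith
    have := dist_triangle (q w) (e (J.symm (y.1 + w))).1 (e y).1
    have := (hin w hw).2.2
    linarith
  have hjc : ContinuousOn (fun w => e (J.symm (y.1 + w))) (closedBall 0 ε) :=
    e.continuousOn.comp (by fun_prop : Continuous fun w => J.symm (y.1 + w)).continuousOn
      fun w hw => (hin w (by simpa using hw)).1
  have hqc : ContinuousOn q (closedBall 0 ε) :=
    (continuous_subtype_val.comp_continuousOn hjc).add (by fun_prop)
  obtain ⟨w, hw, hw0⟩ := NoRetraction.exists_zero_of_eq_on_sphere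
    (r := fun w => (e.symm (J.symm (q w))).1 - y.1) hε
    ((continuous_subtype_val.comp_continuousOn (e.symm.continuousOn.comp
      (J.continuous_symm.comp_continuousOn hqc)
      fun w hw => hqt w (by simpa using hw))).sub continuousOn_const) (fun w hw => by
      have hq : q w = (e (J.symm (y.1 + w))).1 := by simp [q, hw]
      rw [hq, hleft, e.left_inv (hin w hw.le).1, hsymm _ (hin w hw.le).2.1.le]
      simp)
  have hw' : ‖w‖ ≤ ε := by simpa using hw
  have h1 : e.symm (J.symm (q w)) = y := Subtype.ext (sub_eq_zero.1 hw0)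
  have h2 : J.symm (q w) = e y := by rw [← h1, e.right_inv (hqt w hw')]
  have h3 : q w 0 = 0 := by rw [← hsymm _ (hqpos w hw'), h2, h]
  rw [hq0] at h3
  have h4 := (e (J.symm (y.1 + w))).2
  have h5 : ‖w‖ = ε := le_antisymm hw' (by linarith)
  have hq : q w = (e (J.symm (y.1 + w))).1 := by simp [q, h5]
  have h6 : y.1 + w = y.1 := by
    have := e.left_inv (hin w hw').1
    rw [← hleft (e (J.symm (y.1 + w))), ← hq, h1] at this
    rw [← hsymm _ (hin w hw').2.1.le, ← this]
  have : w = 0 := by simpa using h6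
  rw [this, norm_zero] at h5
  linarith

variable {W : Type*} [TopologicalSpace W] [ChartedSpace (EuclideanHalfSpace n) W]

/-- In any of the preferred charts of a topological manifold, the boundary is the set of points
with vanishing first coordinate. -/
theorem mem_boundary_iff (y : W) {z : W} (hz : z ∈ (chartAt (EuclideanHalfSpace n) y).source) :
    z ∈ (𝓡∂ n).boundary W ↔ (chartAt (EuclideanHalfSpace n) y z).1 0 = 0 := by
  have h1 : z ∈ (𝓡∂ n).boundary W ↔ (chartAt (EuclideanHalfSpace n) z z).1 0 = 0 := by
    change extChartAt (𝓡∂ n) z z ∈ frontier (range (𝓡∂ n)) ↔ _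
    rw [frontier_range_modelWithCornersEuclideanHalfSpace]
    exact eq_comm
  rw [h1]
  have key (a b : W) (ha : z ∈ (chartAt (EuclideanHalfSpace n) a).source)
      (hb : z ∈ (chartAt (EuclideanHalfSpace n) b).source)
      (h : (chartAt (EuclideanHalfSpace n) b z).1 0 = 0) :
      (chartAt (EuclideanHalfSpace n) a z).1 0 = 0 := by
    have hl := (chartAt (EuclideanHalfSpace n) a).left_inv ha
    refine coord_eq_zero_of_coord_eq_zero
      ((chartAt (EuclideanHalfSpace n) a).symm.trans (chartAt (EuclideanHalfSpace n) b))
      (y := chartAt (EuclideanHalfSpace n) a z) ?_ ?_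
    · rw [OpenPartialHomeomorph.trans_source]
      exact ⟨(chartAt (EuclideanHalfSpace n) a).map_source ha, by
        rw [mem_preimage, hl]; exact hb⟩
    · rw [OpenPartialHomeomorph.trans_apply, hl]
      exact h
  exact ⟨key y z hz (mem_chart_source _ z), key z y (mem_chart_source _ z) hz⟩

theorem isClosed_boundary : IsClosed ((𝓡∂ n).boundary W) := by
  rw [← isOpen_compl_iff, isOpen_iff_mem_nhds]
  intro y hy
  have hs := mem_chart_source (EuclideanHalfSpace n) y
  have hc : ContinuousAt (fun z => (chartAt (EuclideanHalfSpace n) y z).1 0) y :=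
    (by fun_prop : Continuous fun v : EuclideanSpace ℝ (Fin n) => v 0).continuousAt.comp
      (continuous_subtype_val.continuousAt.comp
        ((chartAt (EuclideanHalfSpace n) y).continuousAt hs))
  filter_upwards [(chartAt (EuclideanHalfSpace n) y).open_source.mem_nhds hs,
    hc.eventually_ne fun h => hy ((mem_boundary_iff y hs).2 h)] with z hz hz0
  exact fun h => hz0 ((mem_boundary_iff y hz).1 h)

end Invariance

section LocallyContractible

theorem contractibleSpace_of_retract {Y Z : Type*} [TopologicalSpace Y] [TopologicalSpace Z]
    [ContractibleSpace Z] (f : C(Y, Z)) (g : C(Z, Y)) (h : g.comp f = ContinuousMap.id Y) :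
    ContractibleSpace Y := by
  rw [contractible_iff_id_nullhomotopic, ← h]
  have := ((id_nullhomotopic Z).comp_right g).comp_left f
  simpa using this

/-- A space that is locally homeomorphic to convex sets of a normed space is strongly locally
contractible. -/
theorem stronglyLocallyContractible_of_convex {Y E : Type*} [TopologicalSpace Y]
    [NormedAddCommGroup E] [NormedSpace ℝ E]
    (h : ∀ p : Y, ∃ (S : Set E) (O : Set Y) (φ : Y → E) (ψ : E → Y) (ρ : ℝ), Convex ℝ S ∧
      O ∈ 𝓝 p ∧ ContinuousOn φ O ∧ MapsTo φ O S ∧ 0 < ρ ∧ ContinuousOn ψ (S ∩ ball (φ p) ρ) ∧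
      MapsTo ψ (S ∩ ball (φ p) ρ) O ∧ (∀ q ∈ O, ψ (φ q) = q) ∧
      ∀ v ∈ S ∩ ball (φ p) ρ, φ (ψ v) = v) :
    StronglyLocallyContractibleSpace Y := by
  refine StronglyLocallyContractibleSpace.of_bases (ι := Set Y)
    (p := fun q s => s ∈ 𝓝 q ∧ ContractibleSpace s) (s := fun _ s => s) (fun p => ?_)
    fun _ _ h => h.2
  obtain ⟨S, O, φ, ψ, ρ, hS, hO, hφ, hφS, hρ, hψ, hψO, hl, hr⟩ := h p
  have hp := mem_of_mem_nhds hO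
  refine Filter.hasBasis_iff.2 fun N => ⟨fun hN => ?_, fun ⟨s, hs, hsN⟩ =>
    Filter.mem_of_superset hs.1 hsN⟩
  have hpS : φ p ∈ S ∩ ball (φ p) ρ := ⟨hφS hp, mem_ball_self hρ⟩
  have h1 : ψ ⁻¹' N ∈ 𝓝[S ∩ ball (φ p) ρ] (φ p) := hψ _ hpS (by rwa [hl p hp])
  obtain ⟨r, hr0, hrN⟩ := Metric.mem_nhdsWithin_iff.1 h1
  set r' := min r ρ
  have hr' : 0 < r' := lt_min hr0 hρ
  let C : Set E := S ∩ ball (φ p) r'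
  have hCρ : C ⊆ S ∩ ball (φ p) ρ :=
    inter_subset_inter_right _ (ball_subset_ball (min_le_right _ _))
  let U : Set Y := {q | q ∈ O ∧ φ q ∈ ball (φ p) r'}
  have hUC (q : Y) (hq : q ∈ U) : φ q ∈ C := ⟨hφS hq.1, hq.2⟩
  have hCU (v : E) (hv : v ∈ C) : ψ v ∈ U :=
    ⟨hψO (hCρ hv), by rw [hr v (hCρ hv)]; exact hv.2⟩
  refine ⟨U, ⟨?_, ?_⟩, ?_⟩
  · exact Filter.inter_mem hO ((hφ.continuousAt hO).preimage_mem_nhds (ball_mem_nhds _ hr'))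
  · have : ContractibleSpace C := (hS.inter (convex_ball _ _)).contractibleSpace
      ⟨φ p, hφS hp, mem_ball_self hr'⟩
    refine contractibleSpace_of_retract (Z := C)
      ⟨fun q => ⟨φ q, hUC q q.2⟩, ((hφ.mono fun q hq => hq.1).domRestrict).subtype_mk _⟩
      ⟨fun v => ⟨ψ v, hCU v v.2⟩, ((hψ.mono hCρ).domRestrict).subtype_mk _⟩ ?_
    ext q
    exact hl q q.2.1
  · intro q hq
    have : φ q ∈ ψ ⁻¹' N := hrN ⟨ball_subset_ball (min_le_left _ _) hq.2, hφS hq.1,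
      ball_subset_ball (min_le_right _ _) hq.2⟩
    rwa [mem_preimage, hl q hq.1] at this

variable {n : ℕ} [NeZero n] {W : Type*} [TopologicalSpace W]
  [ChartedSpace (EuclideanHalfSpace n) W]

theorem stronglyLocallyContractible (n : ℕ) [NeZero n] (W : Type*) [TopologicalSpace W]
    [ChartedSpace (EuclideanHalfSpace n) W] : StronglyLocallyContractibleSpace W := by
  refine stronglyLocallyContractible_of_convex (E := EuclideanSpace ℝ (Fin n)) fun p => ?_
  let e := chartAt (EuclideanHalfSpace n) p
  let J := 𝓡∂ n
  have hp : p ∈ e.source := mem_chart_source _ p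
  have hsymm (v : EuclideanSpace ℝ (Fin n)) (hv : v ∈ range J) : (J.symm v).1 = v :=
    J.right_inv hv
  have hleft (p : EuclideanHalfSpace n) : J.symm p.1 = p := J.left_inv p
  obtain ⟨ρ, hρ, hρt⟩ := Metric.mem_nhds_iff.1 (J.continuous_symm.continuousAt.preimage_mem_nhds
    (x := (e p).1) (by rw [hleft]; exact e.open_target.mem_nhds (e.map_source hp)))
  refine ⟨range J, e.source, fun q => (e q).1, fun v => e.symm (J.symm v), ρ, J.convex_range,
    e.open_source.mem_nhds hp, continuous_subtype_val.comp_continuousOn e.continuousOn,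
    fun q _ => ⟨e q, rfl⟩, hρ, ?_, ?_, ?_, ?_⟩
  · exact e.symm.continuousOn.comp J.continuous_symm.continuousOn fun v hv => hρt hv.2
  · exact fun v hv => e.map_target (hρt hv.2)
  · intro q hq
    change e.symm (J.symm (e q).1) = q
    rw [hleft, e.left_inv hq]
  · intro v hv
    change (e (e.symm (J.symm v))).1 = v
    rw [e.right_inv (hρt hv.2), hsymm v hv.1]

/-- A component of the boundary is locally homeomorphic to the hyperplane that bounds the half
space. -/
theorem stronglyLocallyContractible_boundary_component (y : W) :
    StronglyLocallyContractibleSpace (connectedComponentIn ((𝓡∂ n).boundary W) y) := by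
  classical
  refine stronglyLocallyContractible_of_convex (E := EuclideanSpace ℝ (Fin n)) fun p => ?_
  let e := chartAt (EuclideanHalfSpace n) p.1
  let J := 𝓡∂ n
  have hp : p.1 ∈ e.source := mem_chart_source _ p.1
  have hpb : p.1 ∈ (𝓡∂ n).boundary W := connectedComponentIn_subset _ _ p.2
  have hsymm (v : EuclideanSpace ℝ (Fin n)) (hv : 0 ≤ v 0) : (J.symm v).1 = v :=
    J.right_inv (by rw [range_modelWithCornersEuclideanHalfSpace]; exact hv)
  have hleft (p : EuclideanHalfSpace n) : J.symm p.1 = p := J.left_inv p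
  obtain ⟨ρ, hρ, hρt⟩ := Metric.mem_nhds_iff.1 (J.continuous_symm.continuousAt.preimage_mem_nhds
    (x := (e p).1) (by rw [hleft]; exact e.open_target.mem_nhds (e.map_source hp)))
  let S : Set (EuclideanSpace ℝ (Fin n)) := {v | v 0 = 0}
  have hS : Convex ℝ S := by
    intro a ha b hb s t _ _ _
    simp only [S, mem_ofPred_eq] at ha hb ⊢
    simp [ha, hb]
  have hψc : ContinuousOn (fun v => e.symm (J.symm v)) (S ∩ ball (e p).1 ρ) :=
    e.symm.continuousOn.comp J.continuous_symm.continuousOn fun v hv => hρt hv.2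
  have hψφ (v) (hv : v ∈ S ∩ ball (e p).1 ρ) : (e (e.symm (J.symm v))).1 = v := by
    rw [e.right_inv (hρt hv.2), hsymm v (le_of_eq hv.1.symm)]
  have hψV (v) (hv : v ∈ S ∩ ball (e p).1 ρ) :
      e.symm (J.symm v) ∈ connectedComponentIn ((𝓡∂ n).boundary W) y := by
    rw [connectedComponentIn_eq p.2]
    have hpre : IsPreconnected ((fun v => e.symm (J.symm v)) '' (S ∩ ball (e p).1 ρ)) :=
      (hS.inter (convex_ball _ _)).isPreconnected.image _ hψc
    refine hpre.subset_connectedComponentIn (x := p.1) ⟨(e p).1, ⟨?_, mem_ball_self hρ⟩, ?_⟩ ?_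
      ⟨v, hv, rfl⟩
    · exact (mem_boundary_iff p.1 hp).1 hpb
    · change e.symm (J.symm (e p).1) = p
      rw [hleft, e.left_inv hp]
    · rintro _ ⟨w, hw, rfl⟩
      rw [mem_boundary_iff p.1 (e.map_target (hρt hw.2))]
      exact (congrArg (fun u : EuclideanSpace ℝ (Fin n) => u 0) (hψφ w hw)).trans hw.1
  let ψ : EuclideanSpace ℝ (Fin n) → connectedComponentIn ((𝓡∂ n).boundary W) y := fun v =>
    if h : e.symm (J.symm v) ∈ connectedComponentIn ((𝓡∂ n).boundary W) y then
      ⟨e.symm (J.symm v), h⟩ else p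
  have hψ (v) (hv : v ∈ S ∩ ball (e p).1 ρ) : (ψ v).1 = e.symm (J.symm v) := by
    simp only [ψ, dif_pos (hψV v hv)]
  refine ⟨S, {q | q.1 ∈ e.source}, fun q => (e q.1).1, ψ, ρ, hS, ?_, ?_, ?_, hρ, ?_, ?_, ?_, ?_⟩
  · exact continuous_subtype_val.continuousAt.preimage_mem_nhds (e.open_source.mem_nhds hp)
  · exact continuous_subtype_val.comp_continuousOn
      (e.continuousOn.comp continuous_subtype_val.continuousOn fun q hq => hq)
  · exact fun q hq => (mem_boundary_iff p.1 hq).1 (connectedComponentIn_subset _ _ q.2)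
  · rw [Topology.IsInducing.subtypeVal.continuousOn_iff]
    exact hψc.congr hψ
  · intro v hv
    rw [mem_ofPred_eq, hψ v hv]
    exact e.map_target (hρt hv.2)
  · intro q hq
    have h1 : e.symm (J.symm (e q.1).1) = q.1 := by rw [hleft, e.left_inv hq]
    have h2 : e.symm (J.symm (e q.1).1) ∈ connectedComponentIn ((𝓡∂ n).boundary W) y := by
      rw [h1]; exact q.2
    simp only [ψ, dif_pos h2]
    exact Subtype.ext h1
  · intro v hv
    change (e (ψ v).1).1 = v
    rw [hψ v hv, hψφ v hv]

theorem pathConnected_boundary_component {y : W} (hy : y ∈ (𝓡∂ n).boundary W) :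
    PathConnectedSpace (connectedComponentIn ((𝓡∂ n).boundary W) y) := by
  have := stronglyLocallyContractible_boundary_component (n := n) y
  have : ConnectedSpace (connectedComponentIn ((𝓡∂ n).boundary W) y) :=
    isConnected_iff_connectedSpace.1 (isConnected_connectedComponentIn_iff.2 hy)
  exact pathConnectedSpace_iff_connectedSpace.2 this

theorem compact_boundary_component [CompactSpace W] {y : W} :
    CompactSpace (connectedComponentIn ((𝓡∂ n).boundary W) y) := by
  refine isCompact_iff_compactSpace.1 (IsClosed.isCompact ?_)
  by_cases hy : y ∈ (𝓡∂ n).boundary W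
  · rw [connectedComponentIn_eq_image hy]
    exact isClosed_boundary.isClosedEmbedding_subtypeVal.isClosedMap _ isClosed_connectedComponent
  · rw [connectedComponentIn_eq_empty hy]
    exact isClosed_empty

end LocallyContractible

end TopManifold

/-! ### Nested covers and the fundamental group of a compact space -/

namespace SmallPaths

open Path Set Topology Metric

variable {Y : Type*} [TopologicalSpace Y]

/-- A property of homotopy classes of paths that is stable under concatenation holds for all
paths as soon as it holds for the paths contained in a member of an open cover. -/
theorem induction_small {ι : Type*} {c : ι → Set Y} (ho : ∀ i, IsOpen (c i)) (hc : ⋃ i, c i = univ)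
    (D : ∀ {a b : Y}, Homotopic.Quotient a b → Prop)
    (h_refl : ∀ a : Y, D (Homotopic.Quotient.refl a))
    (h_trans : ∀ {a b e : Y} (p : Homotopic.Quotient a b) (q : Homotopic.Quotient b e),
      D p → D q → D (p.trans q))
    (h_small : ∀ {a b : Y} (p : Path a b) (i : ι), range p ⊆ c i → D (Homotopic.Quotient.mk p))
    {a b : Y} (p : Path a b) : D (Homotopic.Quotient.mk p) := by
  obtain ⟨t, ht0, htm, ⟨n, hn⟩, hts⟩ := exists_monotone_Icc_subset_open_cover_unitInterval
    (c := fun i => p ⁻¹' c i) (fun i => (ho i).preimage p.continuous)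
    (by rw [← preimage_iUnion, hc, preimage_univ])
  have key (m : ℕ) : D (Homotopic.Quotient.mk (p.subpath 0 (t m))) := by
    induction m with
    | zero =>
      rw [ht0, Path.subpath_self]
      exact h_refl _
    | succ m ih =>
      rw [← Homotopic.Quotient.eq.2 ⟨Path.Homotopy.subpathTransSubpath p 0 (t m) (t (m + 1))⟩,
        Homotopic.Quotient.mk_trans]
      obtain ⟨i, hi⟩ := hts m
      refine h_trans _ _ ih (h_small _ i ?_)
      rw [Path.range_subpath_of_le _ _ _ (htm (Nat.le_succ m))]
      exact image_subset_iff.2 hi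
  have h1 := key n
  rw [hn n le_rfl] at h1
  rw [Path.subpath_zero_one] at h1
  have cast {a' b' : Y} (ha : a' = a) (hb : b' = b)
      (h : D (Homotopic.Quotient.mk (p.cast ha hb))) : D (Homotopic.Quotient.mk p) := by
    subst ha hb
    exact h
  exact cast p.source p.target h1

theorem mk_eq_of_range_subset {Z : Set Y} [SimplyConnectedSpace Z] {a b : Y} {p q : Path a b}
    (hp : range p ⊆ Z) (hq : range q ⊆ Z) : Homotopic.Quotient.mk p = Homotopic.Quotient.mk q := by
  have ha : a ∈ Z := by rw [← p.source]; exact hp ⟨0, rfl⟩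
  have hb : b ∈ Z := by rw [← p.target]; exact hp ⟨1, rfl⟩
  exact Homotopic.Quotient.eq.2 (RelHomotopy.homotopic_of_factor (Y := Z)
    ⟨Subtype.val, continuous_subtype_val⟩ (z := ⟨a, ha⟩) (w := ⟨b, hb⟩)
    ⟨⟨fun t => ⟨p t, hp ⟨t, rfl⟩⟩, by fun_prop⟩, Subtype.ext p.source, Subtype.ext p.target⟩
    ⟨⟨fun t => ⟨q t, hq ⟨t, rfl⟩⟩, by fun_prop⟩, Subtype.ext q.source, Subtype.ext q.target⟩
    (fun _ => rfl) (fun _ => rfl))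

theorem exists_path_subset {U : Set Y} [PathConnectedSpace U] {a b : Y} (ha : a ∈ U) (hb : b ∈ U) :
    ∃ p : Path a b, range p ⊆ U := by
  let p := PathConnectedSpace.somePath (⟨a, ha⟩ : U) ⟨b, hb⟩
  exact ⟨p.map continuous_subtype_val, by rintro _ ⟨t, rfl⟩; exact (p t).2⟩

/-- A family of triples of contractible sets `U i ⊆ Z i ⊆ O i` such that the interiors of
the `U i` cover the space, `Z i` contains every `U j` that meets `U i`, and `O i` contains `Z j`
for these `j`. -/
structure NestedCover (Y : Type*) [TopologicalSpace Y] (ι : Type*) where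
  U : ι → Set Y
  Z : ι → Set Y
  O : ι → Set Y
  contractible_U : ∀ i, ContractibleSpace (U i)
  contractible_Z : ∀ i, ContractibleSpace (Z i)
  contractible_O : ∀ i, ContractibleSpace (O i)
  exists_mem_nhds : ∀ y, ∃ i, U i ∈ 𝓝 y
  U_subset_Z : ∀ i j, (U i ∩ U j).Nonempty → U j ⊆ Z i
  Z_subset_O : ∀ i j, (U i ∩ U j).Nonempty → Z i ⊆ O j

theorem exists_contractible_between {Y : Type*} [MetricSpace Y] [CompactSpace Y]
    [StronglyLocallyContractibleSpace Y] {η : ℝ} (hη : 0 < η) :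
    ∃ δ > 0, ∀ y : Y, ∃ S : Set Y, ContractibleSpace S ∧ ball y δ ⊆ S ∧ S ⊆ ball y η := by
  have h (q : Y) : ∃ S : Set Y, S ∈ 𝓝 q ∧ ContractibleSpace S ∧ S ⊆ ball q (η / 2) := by
    obtain ⟨S, ⟨h1, h2⟩, h3⟩ := (StronglyLocallyContractibleSpace.contractible_basis q).mem_iff.1
      (ball_mem_nhds q (half_pos hη))
    exact ⟨S, h1, h2, h3⟩
  choose S hS hc hb using h
  obtain ⟨δ, hδ, hδS⟩ := lebesgue_number_lemma_of_metric (s := (univ : Set Y))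
    (c := fun q => interior (S q)) isCompact_univ (fun _ => isOpen_interior)
    fun q _ => mem_iUnion.2 ⟨q, mem_interior_iff_mem_nhds.2 (hS q)⟩
  refine ⟨δ, hδ, fun y => ?_⟩
  obtain ⟨q, hq⟩ := hδS y trivial
  have hqS := hq.trans interior_subset
  refine ⟨S q, hc q, hqS, fun z hz => ?_⟩
  have h1 := hb q hz
  have h2 := hb q (hqS (mem_ball_self hδ))
  rw [mem_ball] at *
  have := dist_triangle_right z y q
  linarith

theorem exists_nestedCover (Y : Type*) [TopologicalSpace Y] [TopologicalSpace.MetrizableSpace Y]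
    [CompactSpace Y] [StronglyLocallyContractibleSpace Y] :
    ∃ n : ℕ, Nonempty (NestedCover Y (Fin n)) := by
  let _ := TopologicalSpace.metrizableSpaceMetric Y
  obtain ⟨δ, hδ, hO⟩ := exists_contractible_between (Y := Y) one_pos
  obtain ⟨δ₁, hδ₁, hZ⟩ := exists_contractible_between (Y := Y) (half_pos hδ)
  set m := min δ δ₁
  have hm : 0 < m := lt_min hδ hδ₁
  obtain ⟨δ₂, hδ₂, hU⟩ := exists_contractible_between (Y := Y) (η := m / 4) (by linarith)
  choose O hOc hOb hO1 using hO
  choose Z hZc hZb hZ1 using hZ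
  choose U hUc hUb hU1 using hU
  obtain ⟨F, hF⟩ := (isCompact_univ (X := Y)).elim_finite_subcover (fun q => ball q δ₂)
    (fun _ => isOpen_ball) fun q _ => mem_iUnion.2 ⟨q, mem_ball_self hδ₂⟩
  let f : Fin F.card → Y := fun i => (F.equivFin.symm i).1
  have hm1 : m ≤ δ := min_le_left _ _
  have hm2 : m ≤ δ₁ := min_le_right _ _
  have hd (a b : Y) (h : (U a ∩ U b).Nonempty) : dist a b < m / 2 := by
    obtain ⟨z, hza, hzb⟩ := h
    have h1 := hU1 a hza
    have h2 := hU1 b hzb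
    rw [mem_ball] at h1 h2
    have := dist_triangle_left a b z
    linarith
  refine ⟨F.card, ⟨{
    U := fun i => U (f i)
    Z := fun i => Z (f i)
    O := fun i => O (f i)
    contractible_U := fun i => hUc _
    contractible_Z := fun i => hZc _
    contractible_O := fun i => hOc _
    exists_mem_nhds := fun y => ?_
    U_subset_Z := fun i j h z hz => hZb _ ?_
    Z_subset_O := fun i j h z hz => hOb _ ?_ }⟩⟩
  · obtain ⟨q, hq⟩ := mem_iUnion.1 (hF (mem_univ y))
    obtain ⟨hqF, hq⟩ := mem_iUnion.1 hq
    refine ⟨F.equivFin ⟨q, hqF⟩, Filter.mem_of_superset (isOpen_ball.mem_nhds hq) ?_⟩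
    simp only [f, Equiv.symm_apply_apply]
    exact hUb q
  · have h1 := hU1 _ hz
    have h2 := hd _ _ h
    rw [mem_ball] at *
    have := dist_triangle z (f j) (f i)
    rw [dist_comm (f j)] at this
    linarith
  · have h1 := hZ1 _ hz
    have h2 := hd _ _ h
    rw [mem_ball] at *
    have := dist_triangle z (f i) (f j)
    linarith

/-- The fundamental group of a compact, path connected, locally contractible space is finitely
generated. Joining every point `a` to the base point by a path that passes through the centre of a
fixed member of the cover containing `a`, one assigns a loop to every path; small paths lead only
to finitely many classes of loops. -/
theorem exists_finite_generators [TopologicalSpace.MetrizableSpace Y] [CompactSpace Y]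
    [StronglyLocallyContractibleSpace Y] [PathConnectedSpace Y] (y : Y) :
    ∃ S : Set (FundamentalGroup Y y), S.Finite ∧ Subgroup.closure S = ⊤ := by
  classical
  obtain ⟨n, ⟨N⟩⟩ := exists_nestedCover Y
  have := N.contractible_U
  have := N.contractible_Z
  choose i hi using N.exists_mem_nhds
  let c (j : Fin n) : Y := (Classical.arbitrary (N.U j)).1
  have hc (j : Fin n) : c j ∈ N.U j := (Classical.arbitrary (N.U j)).2
  have hu (a : Y) : ∃ p : Path (c (i a)) a, range p ⊆ N.U (i a) :=
    exists_path_subset (hc _) (mem_of_mem_nhds (hi a))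
  choose u hu using hu
  let ν (j : Fin n) : Homotopic.Quotient y (c j) :=
    Homotopic.Quotient.mk (PathConnectedSpace.somePath _ _)
  let μ (a : Y) : Homotopic.Quotient y a := (ν (i a)).trans (Homotopic.Quotient.mk (u a))
  let w (j l k : Fin n) : Homotopic.Quotient (c j) (c k) :=
    if h : c j ∈ N.Z l ∧ c k ∈ N.Z l then
      Homotopic.Quotient.mk (exists_path_subset (U := N.Z l) h.1 h.2).choose
    else Homotopic.Quotient.mk (PathConnectedSpace.somePath _ _)
  let S : Set (FundamentalGroup Y y) :=
    range fun z : Fin n × Fin n × Fin n => ((ν z.1).trans (w z.1 z.2.1 z.2.2)).trans (ν z.2.2).symm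
  refine ⟨S, finite_range _, ?_⟩
  let val {a b : Y} (q : Homotopic.Quotient a b) : FundamentalGroup Y y :=
    ((μ a).trans q).trans (μ b).symm
  have hsmall {a b : Y} (p : Path a b) (l : Fin n) (hp : range p ⊆ interior (N.U l)) :
      val (Homotopic.Quotient.mk p) ∈ S := by
    have hpU := hp.trans interior_subset
    have ha : a ∈ N.U l := by rw [← p.source]; exact hpU ⟨0, rfl⟩
    have hb : b ∈ N.U l := by rw [← p.target]; exact hpU ⟨1, rfl⟩
    have h1 : N.U (i a) ⊆ N.Z l := N.U_subset_Z _ _ ⟨a, ha, mem_of_mem_nhds (hi a)⟩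
    have h2 : N.U (i b) ⊆ N.Z l := N.U_subset_Z _ _ ⟨b, hb, mem_of_mem_nhds (hi b)⟩
    have h3 : N.U l ⊆ N.Z l := N.U_subset_Z _ _ ⟨b, hb, hb⟩
    refine ⟨(i a, l, i b), ?_⟩
    have hw : w (i a) l (i b) = ((Homotopic.Quotient.mk (u a)).trans
        (Homotopic.Quotient.mk p)).trans (Homotopic.Quotient.mk (u b)).symm := by
      have h : c (i a) ∈ N.Z l ∧ c (i b) ∈ N.Z l := ⟨h1 (hc _), h2 (hc _)⟩
      simp only [w, dif_pos h]
      rw [← Homotopic.Quotient.mk_symm, ← Homotopic.Quotient.mk_trans,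
        ← Homotopic.Quotient.mk_trans]
      refine mk_eq_of_range_subset (Z := N.Z l) (exists_path_subset h.1 h.2).choose_spec ?_
      rw [Path.trans_range, Path.trans_range, Path.symm_range]
      exact union_subset (union_subset ((hu a).trans h1) (hpU.trans h3)) ((hu b).trans h2)
    simp only [val, hw, μ, RelHomotopy.symm_trans_rev, Homotopic.Quotient.trans_assoc]
  rw [eq_top_iff]
  intro g _
  have key {a b : Y} (p : Path a b) :
      val (Homotopic.Quotient.mk p) ∈ Subgroup.closure S := by
    refine induction_small (c := fun l => interior (N.U l)) (fun _ => isOpen_interior)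
      (eq_univ_of_forall fun z => mem_iUnion.2 ⟨i z, mem_interior_iff_mem_nhds.2 (hi z)⟩)
      (fun q => val q ∈ Subgroup.closure S) (fun a => ?_) (fun {a b e} p q hp hq => ?_)
      (fun p l hp => Subgroup.subset_closure (hsmall p l hp)) p
    · have : val (Homotopic.Quotient.refl a) = 1 := by
        simp only [val]
        rw [Homotopic.Quotient.trans_refl, Homotopic.Quotient.trans_symm]
        rfl
      rw [this]
      exact Subgroup.one_mem _
    · have : val (p.trans q) = val q * val p := by
        change val (p.trans q) = (val p).trans (val q)
        simp only [val, Homotopic.Quotient.trans_assoc]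
        congr 2
        rw [← Homotopic.Quotient.trans_assoc _ (μ b), Homotopic.Quotient.symm_trans,
          Homotopic.Quotient.refl_trans]
      rw [this]
      exact Subgroup.mul_mem _ hq hp
  -- conjugation by the loop `μ y` removes the dependence on the chosen paths at the base point
  obtain ⟨p, rfl⟩ := Homotopic.Quotient.mk_surjective g
  obtain ⟨m, hm⟩ := Homotopic.Quotient.mk_surjective (μ y)
  have h1 := key (m.symm.trans (p.trans m))
  have : val (Homotopic.Quotient.mk (m.symm.trans (p.trans m))) = Homotopic.Quotient.mk p := by
    simp only [val]
    rw [Homotopic.Quotient.mk_trans, Homotopic.Quotient.mk_trans, Homotopic.Quotient.mk_symm, hm]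
    rw [← Homotopic.Quotient.trans_assoc (μ y), Homotopic.Quotient.trans_symm,
      Homotopic.Quotient.refl_trans, Homotopic.Quotient.trans_assoc, Homotopic.Quotient.trans_symm,
      Homotopic.Quotient.trans_refl]
  rwa [this] at h1

end SmallPaths

/-! ### Holonomy: assigning group elements to homotopy classes of paths -/

/-- A holonomy on `Y` with values in `M` assigns an element of `M` to each homotopy class of paths,
multiplicatively; that is a functor from the fundamental groupoid to the group `M`. -/
structure Holonomy (Y : Type*) [TopologicalSpace Y] (M : Type*) [CommGroup M] where
  val : ∀ {a b : Y}, Path.Homotopic.Quotient a b → M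
  val_trans : ∀ {a b c : Y} (p : Path.Homotopic.Quotient a b) (q : Path.Homotopic.Quotient b c),
    val (p.trans q) = val p * val q

namespace Holonomy

open Path Set

variable {Y Z : Type*} [TopologicalSpace Y] [TopologicalSpace Z] {M : Type*} [CommGroup M]

theorem val_refl (χ : Holonomy Y M) (a : Y) : χ.val (Homotopic.Quotient.refl a) = 1 := by
  have := χ.val_trans (Homotopic.Quotient.refl a) (Homotopic.Quotient.refl a)
  rwa [Homotopic.Quotient.refl_trans, left_eq_mul] at this

/-- The holonomy pulled back along a continuous map. -/
def comap (χ : Holonomy Y M) (f : C(Z, Y)) : Holonomy Z M where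
  val p := χ.val (p.map f)
  val_trans p q := by rw [RelHomotopy.map_trans, χ.val_trans]

/-- Two holonomies are cohomologous if they differ by the coboundary of a function. -/
def Cohomologous (χ χ' : Holonomy Y M) : Prop :=
  ∃ g : Y → M, ∀ {a b : Y} (p : Homotopic.Quotient a b), χ'.val p = χ.val p * (g b / g a)

theorem comap_cohomologous (χ : Holonomy Y M) {f g : C(Z, Y)} (h : f.Homotopic g) :
    (χ.comap f).Cohomologous (χ.comap g) := by
  obtain ⟨K⟩ := h
  refine ⟨fun a => χ.val (Homotopic.Quotient.mk (K.evalAt a)), fun {a b} p => ?_⟩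
  obtain ⟨p, rfl⟩ := Homotopic.Quotient.mk_surjective p
  have h := congrArg χ.val (Homotopic.Quotient.eq.2 (Path.Homotopic.map_trans_evalAt K p))
  rw [Homotopic.Quotient.mk_trans, Homotopic.Quotient.mk_trans, χ.val_trans, χ.val_trans] at h
  change χ.val (Homotopic.Quotient.mk (p.map g.continuous)) =
    χ.val (Homotopic.Quotient.mk (p.map f.continuous)) * _
  rw [← mul_div_assoc, h, mul_div_cancel_left]

/-- Every homomorphism from the fundamental group of a path connected space to an abelian group
extends to a holonomy. -/
theorem exists_extension [PathConnectedSpace Y] {y : Y} (φ : FundamentalGroup Y y →* M) :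
    ∃ χ : Holonomy Y M, ∀ p : FundamentalGroup Y y, χ.val (FundamentalGroup.toPath p) = φ p := by
  let μ (a : Y) : Homotopic.Quotient y a := Homotopic.Quotient.mk (PathConnectedSpace.somePath _ _)
  let v {a b : Y} (p : Homotopic.Quotient a b) : FundamentalGroup Y y :=
    ((μ a).trans p).trans (μ b).symm
  refine ⟨⟨fun p => φ (v p), fun {a b c} p q => ?_⟩, fun p => ?_⟩
  · have : v (p.trans q) = v q * v p := by
      change v (p.trans q) = (v p).trans (v q)
      simp only [v, Homotopic.Quotient.trans_assoc]
      congr 2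
      rw [← Homotopic.Quotient.trans_assoc _ (μ b), Homotopic.Quotient.symm_trans,
        Homotopic.Quotient.refl_trans]
    rw [this, map_mul, mul_comm]
  · let m : FundamentalGroup Y y := μ y
    have : v (FundamentalGroup.toPath p) = m⁻¹ * (p * m) := rfl
    change φ (v _) = φ p
    rw [this, map_mul, map_mul, map_inv, inv_mul_cancel_comm_assoc]

/-- The value of a holonomy on the subspace `S` along a path contained in `S`. -/
def along {S : Set Y} (χ : Holonomy S M) (f : C(I, Y)) (h : ∀ t, f t ∈ S) : M :=
  χ.val (a := ⟨f 0, h 0⟩) (b := ⟨f 1, h 1⟩)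
    (Homotopic.Quotient.mk ⟨⟨fun t => ⟨f t, h t⟩, by fun_prop⟩, rfl, rfl⟩)

theorem along_const {S : Set Y} (χ : Holonomy S M) (f : C(I, Y)) (h : ∀ t, f t ∈ S) {y : Y}
    (hy : ∀ t, f t = y) : χ.along f h = 1 := by
  obtain rfl : f = ContinuousMap.const I y := ContinuousMap.ext hy
  exact χ.val_refl _

theorem val_cast (χ : Holonomy Y M) {a b a' b' : Y} (p : Path a b) (ha : a' = a) (hb : b' = b) :
    χ.val (Homotopic.Quotient.mk (p.cast ha hb)) = χ.val (Homotopic.Quotient.mk p) := by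
  subst ha hb
  rfl

/-! ### Gluing holonomies -/

section Glue

variable {ι : Type*} {S : ι → Set Y} (χ : ∀ i, Holonomy (S i) M)

/-- The straight path from `z` to `w`, mapped by `G`. -/
def edge (G : C(ℝ × ℝ, Y)) (z w : ℝ × ℝ) : C(I, Y) :=
  G.comp ⟨fun u : I => AffineMap.lineMap z w (u : ℝ), by
    simp only [AffineMap.lineMap_apply]; fun_prop⟩

open Classical in
/-- The value, along the image of the straight path from `z` to `w`, of any of the holonomies that
is defined there; it is set to `1` if there is none. -/
noncomputable def edgeVal (G : C(ℝ × ℝ, Y)) (z w : ℝ × ℝ) : M :=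
  if h : ∃ i, ∀ t, edge G z w t ∈ S i then (χ h.choose).along (edge G z w) h.choose_spec else 1

variable {χ}

theorem edgeVal_eq (hχ : ∀ i j (f : C(I, Y)) (hi : ∀ t, f t ∈ S i) (hj : ∀ t, f t ∈ S j),
    (χ i).along f hi = (χ j).along f hj) {G : C(ℝ × ℝ, Y)} {z w : ℝ × ℝ} {i : ι}
    (h : ∀ t, edge G z w t ∈ S i) : edgeVal χ G z w = (χ i).along (edge G z w) h := by
  have h' : ∃ i, ∀ t, edge G z w t ∈ S i := ⟨i, h⟩
  rw [edgeVal, dif_pos h']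
  exact hχ _ _ _ _ _

theorem edgeVal_const {G : C(ℝ × ℝ, Y)} {z w : ℝ × ℝ} {y : Y} (h : ∀ t, edge G z w t = y) :
    edgeVal χ G z w = 1 := by
  rw [edgeVal]
  split_ifs with h'
  · exact along_const _ _ _ h
  · rfl

theorem edge_mem {G : C(ℝ × ℝ, Y)} {R : Set (ℝ × ℝ)} (hR : Convex ℝ R) {s : Set Y}
    (hG : ∀ z ∈ R, G z ∈ s) {a b : ℝ × ℝ} (ha : a ∈ R) (hb : b ∈ R) (t : I) :
    edge G a b t ∈ s := hG _ (hR.lineMap_mem ha hb t.2)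

theorem edgeVal_triangle (hχ : ∀ i j (f : C(I, Y)) (hi : ∀ t, f t ∈ S i) (hj : ∀ t, f t ∈ S j),
    (χ i).along f hi = (χ j).along f hj) {G : C(ℝ × ℝ, Y)} {R : Set (ℝ × ℝ)} (hR : Convex ℝ R)
    {i : ι} (hG : ∀ z ∈ R, G z ∈ S i) {a b c : ℝ × ℝ} (ha : a ∈ R) (hb : b ∈ R) (hc : c ∈ R) :
    edgeVal χ G a b * edgeVal χ G b c = edgeVal χ G a c := by
  rw [edgeVal_eq hχ (edge_mem hR hG ha hb), edgeVal_eq hχ (edge_mem hR hG hb hc),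
    edgeVal_eq hχ (edge_mem hR hG ha hc)]
  have : ContractibleSpace R := hR.contractibleSpace ⟨a, ha⟩
  let Γ : C(R, S i) := ⟨fun z => ⟨G z, hG z z.2⟩, by fun_prop⟩
  let seg {a b : ℝ × ℝ} (ha : a ∈ R) (hb : b ∈ R) : Path (⟨a, ha⟩ : R) ⟨b, hb⟩ :=
    ⟨⟨fun u => ⟨AffineMap.lineMap a b (u : ℝ), hR.lineMap_mem ha hb u.2⟩, by
      simp only [AffineMap.lineMap_apply]; fun_prop⟩, Subtype.ext (by simp),
      Subtype.ext (by simp)⟩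
  have key {a b : ℝ × ℝ} (ha : a ∈ R) (hb : b ∈ R) :
      (χ i).along (edge G a b) (edge_mem hR hG ha hb) =
        ((χ i).comap Γ).val (Homotopic.Quotient.mk (seg ha hb)) := by
    have h0 : edge G a b 0 = G a := by simp [edge]
    have h1 : edge G a b 1 = G b := by simp [edge]
    refine Eq.trans ?_ ((χ i).val_cast ((seg ha hb).map Γ.continuous)
      (a' := ⟨edge G a b 0, edge_mem hR hG ha hb 0⟩) (b' := ⟨edge G a b 1, edge_mem hR hG ha hb 1⟩)
      (Subtype.ext h0) (Subtype.ext h1))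
    rfl
  rw [key ha hb, key hb hc, key ha hc, ← val_trans]
  exact congrArg _ (Subsingleton.elim _ _)

/-- Holonomies on the members of an open cover that agree wherever two of them are defined vanish
on the loops that contract in the whole space. -/
theorem along_eq_one_of_nullhomotopic
    (hχ : ∀ i j (f : C(I, Y)) (hi : ∀ t, f t ∈ S i) (hj : ∀ t, f t ∈ S j),
      (χ i).along f hi = (χ j).along f hj)
    (hcov : ∀ y, ∃ i, S i ∈ nhds y) (K : C(I × I, Y)) {y : Y}
    (h0 : ∀ r, K (r, 0) = y) (h1 : ∀ r, K (r, 1) = y) (h2 : ∀ s, K (1, s) = y) {i₀ : ι}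
    (f : C(I, Y)) (hfK : ∀ s, K (0, s) = f s) (hf : ∀ s, f s ∈ S i₀) : (χ i₀).along f hf = 1 := by
  obtain ⟨t, ht0, htm, ⟨N, hN⟩, hts⟩ := exists_monotone_Icc_subset_open_cover_unitInterval_prod_self
    (c := fun i => K ⁻¹' interior (S i)) (fun i => isOpen_interior.preimage K.continuous)
    (fun z _ => by
      obtain ⟨i, hi⟩ := hcov (K z)
      exact mem_iUnion.2 ⟨i, mem_interior_iff_mem_nhds.2 hi⟩)
  let P : ℝ → I := projIcc 0 1 zero_le_one
  have hP (s : I) : P s = s := projIcc_val zero_le_one s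
  let G : C(ℝ × ℝ, Y) := ⟨fun z => K (P z.1, P z.2), by fun_prop⟩
  let pt (n m : ℕ) : ℝ × ℝ := ((t n : ℝ), (t m : ℝ))
  let E (z w : ℝ × ℝ) : M := edgeVal χ G z w
  have hedge (z w : ℝ × ℝ) (u : I) : edge G z w u =
      K (P (AffineMap.lineMap z.1 w.1 (u : ℝ)), P (AffineMap.lineMap z.2 w.2 (u : ℝ))) := by
    simp [edge, G, AffineMap.lineMap_apply]
  -- the relation given by a small rectangle
  have square (n m : ℕ) : E (pt n m) (pt n (m + 1)) * E (pt n (m + 1)) (pt (n + 1) (m + 1)) =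
      E (pt n m) (pt (n + 1) m) * E (pt (n + 1) m) (pt (n + 1) (m + 1)) := by
    obtain ⟨i, hi⟩ := hts n m
    have hR : Convex ℝ (Icc (t n : ℝ) (t (n + 1)) ×ˢ Icc (t m : ℝ) (t (m + 1))) :=
      (convex_Icc _ _).prod (convex_Icc _ _)
    have hG (z) (hz : z ∈ Icc (t n : ℝ) (t (n + 1)) ×ˢ Icc (t m : ℝ) (t (m + 1))) :
        G z ∈ S i := by
      refine interior_subset (hi (a := (P z.1, P z.2)) ⟨⟨?_, ?_⟩, ?_, ?_⟩)
      · rw [← hP (t n)]; exact monotone_projIcc _ hz.1.1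
      · rw [← hP (t (n + 1))]; exact monotone_projIcc _ hz.1.2
      · rw [← hP (t m)]; exact monotone_projIcc _ hz.2.1
      · rw [← hP (t (m + 1))]; exact monotone_projIcc _ hz.2.2
    have hn : (t n : ℝ) ≤ t (n + 1) := htm (Nat.le_succ n)
    have hm : (t m : ℝ) ≤ t (m + 1) := htm (Nat.le_succ m)
    have ha : pt n m ∈ Icc (t n : ℝ) (t (n + 1)) ×ˢ Icc (t m : ℝ) (t (m + 1)) :=
      ⟨⟨le_rfl, hn⟩, le_rfl, hm⟩
    have hb : pt n (m + 1) ∈ Icc (t n : ℝ) (t (n + 1)) ×ˢ Icc (t m : ℝ) (t (m + 1)) :=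
      ⟨⟨le_rfl, hn⟩, hm, le_rfl⟩
    have hc : pt (n + 1) m ∈ Icc (t n : ℝ) (t (n + 1)) ×ˢ Icc (t m : ℝ) (t (m + 1)) :=
      ⟨⟨hn, le_rfl⟩, le_rfl, hm⟩
    have hd : pt (n + 1) (m + 1) ∈ Icc (t n : ℝ) (t (n + 1)) ×ˢ Icc (t m : ℝ) (t (m + 1)) :=
      ⟨⟨hn, le_rfl⟩, hm, le_rfl⟩
    simp only [E]
    rw [edgeVal_triangle hχ hR hG ha hb hd, edgeVal_triangle hχ hR hG ha hc hd]
  have row (n k : ℕ) : (∏ m ∈ Finset.range k, E (pt n m) (pt n (m + 1))) *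
      E (pt n k) (pt (n + 1) k) = E (pt n 0) (pt (n + 1) 0) *
      ∏ m ∈ Finset.range k, E (pt (n + 1) m) (pt (n + 1) (m + 1)) := by
    induction k with
    | zero => simp
    | succ k ih =>
      rw [Finset.prod_range_succ, Finset.prod_range_succ, mul_assoc, square, ← mul_assoc, ih,
        mul_assoc]
  -- the two ends of the rows are constant
  have hleft (n : ℕ) : E (pt n 0) (pt (n + 1) 0) = 1 := edgeVal_const (y := y) fun u => by
    rw [hedge]
    simp only [pt, ht0, AffineMap.lineMap_same_apply, hP, h0]
  have hright (n : ℕ) : E (pt n N) (pt (n + 1) N) = 1 := edgeVal_const (y := y) fun u => by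
    rw [hedge]
    simp only [pt, hN N le_rfl, AffineMap.lineMap_same_apply, hP, h1]
  have hrows (n : ℕ) : ∏ m ∈ Finset.range N, E (pt 0 m) (pt 0 (m + 1)) =
      ∏ m ∈ Finset.range N, E (pt n m) (pt n (m + 1)) := by
    induction n with
    | zero => rfl
    | succ n ih =>
      rw [ih]
      have := row n N
      rwa [hleft, hright, mul_one, one_mul] at this
  have hlast : ∏ m ∈ Finset.range N, E (pt N m) (pt N (m + 1)) = 1 :=
    Finset.prod_eq_one fun m _ => edgeVal_const (y := y) fun u => by
      rw [hedge]
      simp only [pt, hN N le_rfl, AffineMap.lineMap_same_apply, hP, h2]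
  have hR : Convex ℝ ({0} ×ˢ univ : Set (ℝ × ℝ)) := (convex_singleton 0).prod convex_univ
  have hG (z : ℝ × ℝ) (hz : z ∈ ({0} ×ˢ univ : Set (ℝ × ℝ))) : G z ∈ S i₀ := by
    have : P z.1 = 0 := by rw [hz.1]; exact hP 0
    change K (P z.1, P z.2) ∈ _
    rw [this, hfK]
    exact hf _
  have hmem (m : ℕ) : pt 0 m ∈ ({0} ×ˢ univ : Set (ℝ × ℝ)) := ⟨by simp [pt, ht0], trivial⟩
  have hfirst (k : ℕ) : ∏ m ∈ Finset.range k, E (pt 0 m) (pt 0 (m + 1)) = E (pt 0 0) (pt 0 k) := by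
    induction k with
    | zero => exact (edgeVal_const (y := y) fun u => by
        rw [hedge]; simp only [pt, ht0, AffineMap.lineMap_same_apply]
        rw [show ((0 : I) : ℝ) = ((0 : I) : ℝ) from rfl, hP, h0]).symm
    | succ k ih =>
      rw [Finset.prod_range_succ, ih]
      exact edgeVal_triangle hχ hR hG (hmem _) (hmem _) (hmem _)
  have hfe : edge G (pt 0 0) (pt 0 N) = f := ContinuousMap.ext fun u => by
    rw [hedge]
    simp only [pt, ht0, hN N le_rfl, AffineMap.lineMap_same_apply, hP]
    rw [← hfK]
    congr 2
    rw [← hP u]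
    congr 1
    simp [AffineMap.lineMap_apply, hP]
  have h3 : edgeVal χ G (pt 0 0) (pt 0 N) = 1 := by
    rw [← hlast, ← hrows, hfirst]
  rw [edgeVal_eq hχ (i := i₀) (by rw [hfe]; exact hf)] at h3
  simpa only [hfe] using h3

end Glue

end Holonomy

/-! ### Spaces of paths with a free end point -/

namespace FreeEnd

open RelHomotopy Path Set

theorem cat_const_left {X : Type*} {g : I → X} {y : X} (h : g 0 = y) (s : I) :
    cat (fun _ => y) g s = g (hi s) := by
  unfold cat
  split_ifs with hs
  · have : hi s = 0 := Subtype.ext (by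
      rw [coe_hi]; simp only [Set.Icc.coe_zero]; rw [max_eq_left]; linarith)
    rw [this, h]
  · rfl

variable {X : Type*} [TopologicalSpace X]

/-- The space of paths of `X` that start at `x`. -/
abbrev Paths (x : X) : Type _ := {p : C(I, X) // p 0 = x}

/-- The set of the paths that start at `x` and end in `U`. -/
def endsIn (x : X) (U : Set X) : Set (Paths x) := {p | p.1 1 ∈ U}

variable {x : X} {U V : Set X}

theorem continuous_eval : Continuous fun z : Paths x × I => z.1.1 z.2 :=
  (ContinuousEval.continuous_eval (F := C(I, X))).comp
    (continuous_subtype_val.prodMap continuous_id)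

theorem continuous_eval_comp {Y : Type*} [TopologicalSpace Y] {f : Y → Paths x} {g : Y → I}
    (hf : Continuous f) (hg : Continuous g) : Continuous fun y => (f y).1 (g y) :=
  continuous_eval.comp (hf.prodMk hg)

/-- A continuous map into the space of paths that start at `x` and end in `U`, from its adjoint. -/
def lift {Y : Type*} [TopologicalSpace Y] (f : Y → I → X)
    (hf : Continuous fun z : Y × I => f z.1 z.2) (h0 : ∀ y, f y 0 = x) (h1 : ∀ y, f y 1 ∈ U) :
    C(Y, endsIn x U) :=
  ⟨fun y => ⟨⟨(ContinuousMap.curry ⟨fun z : Y × I => f z.1 z.2, hf⟩) y, h0 y⟩, h1 y⟩,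
    ((ContinuousMap.continuous _).subtype_mk _).subtype_mk _⟩

theorem ext_apply {p q : endsIn x U} (h : ∀ s, p.1.1 s = q.1.1 s) : p = q :=
  Subtype.ext (Subtype.ext (ContinuousMap.ext h))

theorem homotopic_of_family {Y : Type*} [TopologicalSpace Y] {f g : C(Y, endsIn x U)}
    (H : I × Y → I → X) (hH : Continuous fun z : (I × Y) × I => H z.1 z.2)
    (h0 : ∀ z, H z 0 = x) (h1 : ∀ z, H z 1 ∈ U) (hf : ∀ y s, H (0, y) s = (f y).1.1 s)
    (hg : ∀ y s, H (1, y) s = (g y).1.1 s) : f.Homotopic g :=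
  ⟨⟨lift H hH h0 h1, fun y => ext_apply (hf y), fun y => ext_apply (hg y)⟩⟩

theorem joined_of_family {p q : endsIn x U} (H : I → I → X)
    (hH : Continuous fun z : I × I => H z.1 z.2) (h0 : ∀ r, H r 0 = x) (h1 : ∀ r, H r 1 ∈ U)
    (hp : ∀ s, H 0 s = p.1.1 s) (hq : ∀ s, H 1 s = q.1.1 s) : Joined p q :=
  ⟨⟨lift H hH h0 h1, ext_apply hp, ext_apply hq⟩⟩

/-- Linear interpolation between the identity and a time change. -/
noncomputable def slide (θ : C(I, I)) (r s : I) : I :=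
  Set.projIcc 0 1 zero_le_one ((1 - (r : ℝ)) * s + r * θ s)

theorem continuous_slide (θ : C(I, I)) : Continuous fun z : I × I => slide θ z.1 z.2 := by
  unfold slide
  fun_prop

theorem slide_zero (θ : C(I, I)) (s : I) : slide θ 0 s = s := by simp [slide]

theorem slide_one (θ : C(I, I)) (s : I) : slide θ 1 s = θ s := by simp [slide]

theorem slide_fix (θ : C(I, I)) (r s : I) (h : θ s = s) : slide θ r s = s := by
  simp [slide, h, ← add_mul]

theorem lo_one : lo 1 = 1 := Subtype.ext (by rw [coe_lo]; norm_num)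

/-- If `X` is simply connected and `U` is path connected, the space of paths from `x` to points
of `U` is path connected. -/
theorem pathConnected_endsIn [SimplyConnectedSpace X] (hU : PathConnectedSpace U) :
    PathConnectedSpace (endsIn x U) := by
  have : Nonempty (endsIn x U) := by
    obtain ⟨u⟩ := hU.nonempty
    let p := PathConnectedSpace.somePath x u.1
    exact ⟨⟨⟨p, p.source⟩, by simp [endsIn]⟩⟩
  refine ⟨this, fun p q => ?_⟩
  obtain ⟨τ, hτ⟩ := SmallPaths.exists_path_subset (U := U) p.2 q.2
  have h1 : Joined p (lift (U := U) (fun (_ : Unit) s => p.1.1 (lo s)) (by fun_prop)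
      (fun _ => by rw [lo_zero, p.1.2]) (fun _ => by rw [lo_one]; exact p.2) ()) :=
    joined_of_family (fun r s => p.1.1 (slide lo r s))
      (p.1.1.continuous.comp (continuous_slide lo))
      (fun r => by rw [slide_fix lo r 0 lo_zero, p.1.2])
      (fun r => by rw [slide_fix lo r 1 lo_one]; exact p.2)
      (fun s => by rw [slide_zero]) (fun s => by rw [slide_one]; rfl)
  let p' : Path x (p.1.1 1) := ⟨p.1.1, p.1.2, rfl⟩
  let q' : Path x (q.1.1 1) := ⟨q.1.1, q.1.2, rfl⟩
  have hc : Continuous fun z : I × I => cat p' (fun s => τ (z.1 * s)) z.2 :=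
    continuous_cat (f := fun _ s => p' s) (g := fun (r : I) s => τ (r * s)) (by fun_prop)
      (by fun_prop) (fun r => by simp)
  have h2 : Joined (lift (U := U) (fun (_ : Unit) s => p.1.1 (lo s)) (by fun_prop)
      (fun _ => by rw [lo_zero, p.1.2]) (fun _ => by rw [lo_one]; exact p.2) ())
      (lift (U := U) (fun (_ : Unit) s => p'.trans τ s) (by fun_prop) (fun _ => by simp)
        (fun _ => by rw [Path.target]; exact q.2) ()) :=
    joined_of_family (fun r s => cat p' (fun s => τ (r * s)) s) hc
      (fun r => by rw [cat_zero]; exact p'.source)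
      (fun r => by rw [cat_one]; exact hτ ⟨_, rfl⟩)
      (fun s => by
        simp only [zero_mul, τ.source]
        exact cat_const p' (x := p.1.1 1) rfl s)
      (fun s => by simp only [one_mul]; rfl)
  obtain ⟨K⟩ := SimplyConnectedSpace.paths_homotopic (p'.trans τ) q'
  have h3 : Joined (lift (U := U) (fun (_ : Unit) s => p'.trans τ s) (by fun_prop)
      (fun _ => by simp) (fun _ => by rw [Path.target]; exact q.2) ()) q :=
    joined_of_family (fun r s => K (r, s)) K.continuous (fun r => by simp)
      (fun r => by rw [K.target]; exact q.2) (fun s => by simp; rfl) (fun s => by simp; rfl)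
  exact (h1.trans h2).trans h3

/-- A continuous choice of paths from the points of `U` to `x`. -/
structure Return (x : X) (U : Set X) where
  toFun : U → I → X
  continuous_toFun : Continuous fun z : U × I => toFun z.1 z.2
  source : ∀ y, toFun y 0 = y
  target : ∀ y, toFun y 1 = x

/-- The restriction to a smaller set. -/
def Return.restrict (κ : Return x V) (h : U ⊆ V) : Return x U where
  toFun y := κ.toFun ⟨y, h y.2⟩
  continuous_toFun := κ.continuous_toFun.comp
    (((continuous_subtype_val.comp continuous_fst).subtype_mk _).prodMk continuous_snd)
  source _ := κ.source _
  target _ := κ.target _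

theorem continuous_end : Continuous fun p : endsIn x U => (⟨p.1.1 1, p.2⟩ : U) :=
  (continuous_eval_comp continuous_subtype_val continuous_const).subtype_mk _

/-- Closing up the paths that end in `U`, by a continuous choice of paths back to `x`. -/
noncomputable def Return.close (κ : Return x U) : C(endsIn x U, endsIn x {x}) :=
  lift (fun p => cat p.1.1 (κ.toFun ⟨p.1.1 1, p.2⟩))
    (continuous_cat (f := fun (p : endsIn x U) s => p.1.1 s)
      (g := fun (p : endsIn x U) => κ.toFun ⟨p.1.1 1, p.2⟩)
      (continuous_eval_comp (continuous_subtype_val.comp continuous_fst) continuous_snd)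
      (κ.continuous_toFun.comp ((continuous_end.comp continuous_fst).prodMk continuous_snd))
      fun p => (κ.source ⟨p.1.1 1, p.2⟩).symm)
    (fun p => by rw [cat_zero, p.1.2]) (fun p => by rw [cat_one, κ.target]; rfl)

theorem nonempty_return [PathConnectedSpace X] [ContractibleSpace U] : Nonempty (Return x U) := by
  obtain ⟨c, ⟨k⟩⟩ := id_nullhomotopic U
  let p := PathConnectedSpace.somePath (c : X) x
  refine ⟨⟨fun y => cat (fun u => (k (u, y) : X)) p, ?_, fun y => ?_, fun y => ?_⟩⟩
  · exact continuous_cat (f := fun (y : U) u => (k (u, y) : X)) (g := fun _ s => p s)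
      (by fun_prop) (by fun_prop) (fun y => by simp)
  · rw [cat_zero, k.apply_zero]; rfl
  · rw [cat_one, p.target]

/-- Over a contractible set, all ways of closing up paths are homotopic. -/
theorem Return.close_homotopic [SimplyConnectedSpace X] [ContractibleSpace U] (κ κ' : Return x U) :
    κ.close.Homotopic κ'.close := by
  obtain ⟨c, ⟨k⟩⟩ := id_nullhomotopic U
  have hk0 (y : U) : k (0, y) = y := k.apply_zero y
  have hk1 (y : U) : k (1, y) = c := k.apply_one y
  let e (p : endsIn x U) : U := ⟨p.1.1 1, p.2⟩
  have he : Continuous e := continuous_end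
  have hev {Y : Type _} [TopologicalSpace Y] {f : Y → endsIn x U} (hf : Continuous f) :
      Continuous fun z : Y × I => (f z.1).1.1 z.2 :=
    continuous_eval_comp (continuous_subtype_val.comp (hf.comp continuous_fst)) continuous_snd
  -- first follow the contraction of `U` to its centre `c`, then `g`
  let via (g : Path (c : X) x) : C(endsIn x U, endsIn x {x}) :=
    lift (fun p => cat p.1.1 (cat (fun u => (k (u, e p) : X)) g))
      (continuous_cat (f := fun (p : endsIn x U) s => p.1.1 s)
        (g := fun p => cat (fun u => (k (u, e p) : X)) g) (hev continuous_id)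
        (continuous_cat (f := fun p u => (k (u, e p) : X)) (g := fun _ s => g s) (by fun_prop)
          (by fun_prop) (fun p => by rw [hk1, g.source]))
        (fun p => by rw [cat_zero, hk0]))
      (fun p => by rw [cat_zero, p.1.2]) (fun p => by rw [cat_one, cat_one, g.target]; rfl)
  have step (κ : Return x U) :
      κ.close.Homotopic (via ⟨⟨κ.toFun c, κ.continuous_toFun.comp (by fun_prop :
        Continuous fun s : I => (c, s))⟩, κ.source c, κ.target c⟩) := by
    have hcat (g : (I × endsIn x U) → I → X) (hg : Continuous fun z : (I × endsIn x U) × I =>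
        g z.1 z.2) (h0 : ∀ z, g z 0 = e z.2) : Continuous fun z : (I × endsIn x U) × I =>
        cat z.1.2.1.1 (g z.1) z.2 :=
      continuous_cat (f := fun (z : I × endsIn x U) s => z.2.1.1 s) (g := g)
        (hev continuous_snd) hg (fun z => (h0 z).symm)
    have hend : Continuous fun z : (I × endsIn x U) × I => e z.1.2 := by fun_prop
    let mid : C(endsIn x U, endsIn x {x}) :=
      lift (fun p => cat p.1.1 (cat (fun _ => (e p : X)) (κ.toFun (e p))))
        (continuous_cat (f := fun (p : endsIn x U) s => p.1.1 s)
          (g := fun p => cat (fun _ => (e p : X)) (κ.toFun (e p))) (hev continuous_id)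
          (continuous_cat (f := fun p _ => (e p : X)) (g := fun p => κ.toFun (e p)) (by fun_prop)
            (κ.continuous_toFun.comp (f := fun z : endsIn x U × I => (e z.1, z.2)) (by fun_prop))
            (fun p => (κ.source (e p)).symm))
          (fun p => by rw [cat_zero]))
        (fun p => by rw [cat_zero, p.1.2]) (fun p => by rw [cat_one, cat_one, κ.target]; rfl)
    have h1 : κ.close.Homotopic mid := homotopic_of_family
      (fun z => cat z.2.1.1 (fun s => κ.toFun (e z.2) (slide hi z.1 s)))
      (hcat (fun z s => κ.toFun (e z.2) (slide hi z.1 s))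
        (κ.continuous_toFun.comp (hend.prodMk
          ((continuous_slide hi).comp (by fun_prop :
            Continuous fun z : (I × endsIn x U) × I => (z.1.1, z.2)))))
        (fun z => by rw [slide_fix hi _ 0 hi_zero, κ.source]))
      (fun z => by rw [cat_zero, z.2.1.2])
      (fun z => by rw [cat_one, slide_fix hi _ 1 hi_one, κ.target]; rfl)
      (fun p s => by simp only [slide_zero]; rfl)
      (fun p s => by
        simp only [slide_one]
        exact congrArg (fun g => cat p.1.1 g s)
          (funext fun s => (cat_const_left (κ.source (e p)) s).symm))
    have h2 : mid.Homotopic (via ⟨⟨κ.toFun c, κ.continuous_toFun.comp (by fun_prop :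
        Continuous fun s : I => (c, s))⟩, κ.source c, κ.target c⟩) := homotopic_of_family
      (fun z => cat z.2.1.1 (cat (fun u => (k (z.1 * u, e z.2) : X)) (κ.toFun (k (z.1, e z.2)))))
      (hcat (fun z => cat (fun u => (k (z.1 * u, e z.2) : X)) (κ.toFun (k (z.1, e z.2))))
        (continuous_cat (f := fun (z : I × endsIn x U) u => (k (z.1 * u, e z.2) : X))
          (g := fun z => κ.toFun (k (z.1, e z.2))) (by fun_prop)
          (κ.continuous_toFun.comp (f := fun z : (I × endsIn x U) × I => (k (z.1.1, e z.1.2), z.2))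
            (by fun_prop))
          (fun z => by rw [mul_one, κ.source]))
        (fun z => by rw [cat_zero, mul_zero, hk0]))
      (fun z => by rw [cat_zero, z.2.1.2])
      (fun z => by rw [cat_one, cat_one, κ.target]; rfl)
      (fun p s => by simp only [zero_mul, hk0]; rfl)
      (fun p s => by simp only [one_mul, hk1]; rfl)
    exact h1.trans h2
  have hvia (g g' : Path (c : X) x) : (via g).Homotopic (via g') := by
    obtain ⟨L⟩ := SimplyConnectedSpace.paths_homotopic g g'
    exact homotopic_of_family
      (fun z => cat z.2.1.1 (cat (fun u => (k (u, e z.2) : X)) (fun s => L (z.1, s))))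
      (continuous_cat (f := fun (z : I × endsIn x U) s => z.2.1.1 s)
        (g := fun z => cat (fun u => (k (u, e z.2) : X)) (fun s => L (z.1, s)))
        (hev continuous_snd)
        (continuous_cat (f := fun (z : I × endsIn x U) u => (k (u, e z.2) : X))
          (g := fun z s => L (z.1, s)) (by fun_prop) (by fun_prop)
          (fun z => by rw [hk1, L.source]))
        (fun z => by rw [cat_zero, hk0]))
      (fun z => by rw [cat_zero, z.2.1.2])
      (fun z => by rw [cat_one, cat_one, L.target]; rfl)
      (fun p s => by simp only [L.apply_zero]; rfl)
      (fun p s => by simp only [L.apply_one]; rfl)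
  exact ((step κ).trans (hvia _ _)).trans (step κ').symm

/-- Closing up loops by the constant path does nothing, up to homotopy. -/
theorem Return.close_homotopic_id [SimplyConnectedSpace X] (κ : Return x {x}) :
    κ.close.Homotopic (ContinuousMap.id (endsIn x {x})) := by
  let κ₀ : Return x {x} := ⟨fun _ _ => x, continuous_const, fun y => y.2.symm, fun _ => rfl⟩
  refine (κ.close_homotopic κ₀).trans (ContinuousMap.Homotopic.symm ?_)
  refine homotopic_of_family (fun z s => z.2.1.1 (slide lo z.1 s)) ?_
    (fun z => by rw [slide_fix lo _ 0 lo_zero, z.2.1.2])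
    (fun z => by rw [slide_fix lo _ 1 lo_one]; exact z.2.2)
    (fun p s => by rw [slide_zero]; rfl)
    (fun p s => by
      rw [slide_one]
      exact (cat_const p.1.1 (x := x) (show p.1.1 1 = x from p.2) s).symm)
  exact continuous_eval_comp (by fun_prop) ((continuous_slide lo).comp (by fun_prop :
    Continuous fun z : (I × endsIn x {x}) × I => (z.1.1, z.2)))

end FreeEnd

/-! ### The Čech bound for holonomies of the loop space -/

namespace FreeEnd

open RelHomotopy Path Set Topology

variable {X : Type*} [TopologicalSpace X] {x : X} {M : Type*} [CommGroup M]

open Classical in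
/-- The holonomy, along a path `f` in the space of paths, of the loops obtained by closing up with
`κ`; it is set to `1` if `f` leaves the domain of `κ`. -/
noncomputable def holonomyVia (Φ : Holonomy (endsIn x {x}) M) {U : Set X} (κ : Return x U)
    (f : C(I, Paths x)) : M :=
  if h : ∀ t, f t ∈ endsIn x U then (Φ.comap κ.close).along f h else 1

theorem holonomyVia_eq (Φ : Holonomy (endsIn x {x}) M) {U V : Set X} (κ : Return x V) (hUV : U ⊆ V)
    (f : C(I, Paths x)) (h : ∀ t, f t ∈ endsIn x U) :
    holonomyVia Φ κ f = (Φ.comap (κ.restrict hUV).close).along f h := by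
  have hV (t : I) : f t ∈ endsIn x V := hUV (h t)
  rw [holonomyVia, dif_pos hV]
  rfl

/-- Over a contractible set, two ways of closing up give cohomologous holonomies. -/
theorem exists_transition [SimplyConnectedSpace X] (Φ : Holonomy (endsIn x {x}) M) {Z V V' : Set X}
    [ContractibleSpace Z] (κ : Return x V) (κ' : Return x V') (h : Z ⊆ V) (h' : Z ⊆ V') :
    ∃ g : Paths x → M, ∀ f : C(I, Paths x), (∀ t, f t ∈ endsIn x Z) →
      holonomyVia Φ κ' f = holonomyVia Φ κ f * (g (f 1) / g (f 0)) := by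
  classical
  obtain ⟨g, hg⟩ := Φ.comap_cohomologous ((κ.restrict h).close_homotopic (κ'.restrict h'))
  refine ⟨fun p => if hp : p ∈ endsIn x Z then g ⟨p, hp⟩ else 1, fun f hf => ?_⟩
  rw [holonomyVia_eq Φ κ h f hf, holonomyVia_eq Φ κ' h' f hf]
  beta_reduce
  rw [dif_pos (hf 1), dif_pos (hf 0)]
  exact hg _

theorem holonomyVia_loop [SimplyConnectedSpace X] (Φ : Holonomy (endsIn x {x}) M) {V : Set X}
    (hx : x ∈ V) (κ : Return x V) (f : C(I, Paths x)) (hf : ∀ t, f t ∈ endsIn x {x})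
    (h01 : f 0 = f 1) : holonomyVia Φ κ f = Φ.along f hf := by
  have hV : {x} ⊆ V := singleton_subset_iff.2 hx
  obtain ⟨g, hg⟩ := Φ.comap_cohomologous (κ.restrict hV).close_homotopic_id
  rw [holonomyVia_eq Φ κ hV f hf]
  have h := hg (Homotopic.Quotient.mk (⟨⟨fun t => ⟨f t, hf t⟩, by fun_prop⟩, rfl, rfl⟩ :
    Path (⟨f 0, hf 0⟩ : endsIn x {x}) ⟨f 1, hf 1⟩))
  have e : (⟨f 0, hf 0⟩ : endsIn x {x}) = ⟨f 1, hf 1⟩ := Subtype.ext h01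
  rw [congrArg g e, div_self', mul_one] at h
  exact h.symm

/-- The holonomies of a loop space around loops lie in a finitely generated subgroup, if the space
is simply connected and has a finite cover by nested contractible sets: the transition functions
between the holonomies over the members of the cover satisfy the cocycle condition up to finitely
many constants, and modulo these constants the holonomy extends to the contractible space of all
paths. -/
theorem exists_finite_holonomy [SimplyConnectedSpace X] {ι : Type*} [Finite ι]
    (N : SmallPaths.NestedCover X ι) (Φ : Holonomy (endsIn x {x}) M) {c : endsIn x {x}}
    (hc : ∀ s, c.1.1 s = x) : ∃ S : Set M, S.Finite ∧
      ∀ p : Path c c, Φ.val (Homotopic.Quotient.mk p) ∈ Subgroup.closure S := by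
  classical
  have hκ (i : ι) : Nonempty (Return x (N.O i)) := by
    have := N.contractible_O i
    exact nonempty_return
  let κ (i : ι) : Return x (N.O i) := (hκ i).some
  have hU (i : ι) : (N.U i ∩ N.U i).Nonempty := by
    have := N.contractible_U i
    obtain ⟨u⟩ := (inferInstance : Nonempty (N.U i))
    exact ⟨u, u.2, u.2⟩
  let L (i : ι) (f : C(I, Paths x)) : M := holonomyVia Φ (κ i) f
  have hg (i j : ι) (hij : (N.U i ∩ N.U j).Nonempty) : ∃ g : Paths x → M, ∀ f : C(I, Paths x),
      (∀ t, f t ∈ endsIn x (N.Z i)) → L j f = L i f * (g (f 1) / g (f 0)) := by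
    have := N.contractible_Z i
    exact exists_transition Φ (κ i) (κ j) (N.Z_subset_O i i (hU i)) (N.Z_subset_O i j hij)
  choose! g hg using hg
  have const (i j k : ι) {a b : Paths x} (ha : a ∈ endsIn x (N.U i ∩ N.U j ∩ N.U k))
      (hb : b ∈ endsIn x (N.U i ∩ N.U j ∩ N.U k)) :
      g i j a * g j k a / g i k a = g i j b * g j k b / g i k b := by
    have := N.contractible_U i
    have := pathConnected_endsIn (x := x) (U := N.U i) inferInstance
    let p := PathConnectedSpace.somePath (⟨a, ha.1.1⟩ : endsIn x (N.U i)) ⟨b, hb.1.1⟩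
    let f : C(I, Paths x) := ⟨fun t => (p t).1, by fun_prop⟩
    have hf (t : I) : f t ∈ endsIn x (N.U i) := (p t).2
    have h0 : f 0 = a := by simp [f]
    have h1 : f 1 = b := by simp [f]
    have hij : (N.U i ∩ N.U j).Nonempty := ⟨_, ha.1⟩
    have hji : (N.U j ∩ N.U i).Nonempty := ⟨_, ha.1.2, ha.1.1⟩
    have hjk : (N.U j ∩ N.U k).Nonempty := ⟨_, ha.1.2, ha.2⟩
    have hik : (N.U i ∩ N.U k).Nonempty := ⟨_, ha.1.1, ha.2⟩
    have e1 := hg i j hij f fun t => N.U_subset_Z i i (hU i) (hf t)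
    have e2 := hg j k hjk f fun t => N.U_subset_Z j i hji (hf t)
    have e3 := hg i k hik f fun t => N.U_subset_Z i i (hU i) (hf t)
    rw [e1, e3, mul_assoc] at e2
    have e4 := mul_left_cancel e2
    rw [h0, h1, div_mul_div_comm, div_eq_div_iff_mul_eq_mul] at e4
    rw [div_eq_div_iff_mul_eq_mul, mul_comm, e4, mul_comm]
  let γ (z : ι × ι × ι) : M :=
    if h : (endsIn x (N.U z.1 ∩ N.U z.2.1 ∩ N.U z.2.2)).Nonempty then
      g z.1 z.2.1 h.choose * g z.2.1 z.2.2 h.choose / g z.1 z.2.2 h.choose else 1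
  refine ⟨range γ, finite_range γ, fun p => ?_⟩
  let Γ : Subgroup M := Subgroup.closure (range γ)
  have hcocycle (i j k : ι) (a : Paths x) (ha : a ∈ endsIn x (N.U i ∩ N.U j ∩ N.U k)) :
      (g i j a : M ⧸ Γ) * g j k a = g i k a := by
    have h : (endsIn x (N.U i ∩ N.U j ∩ N.U k)).Nonempty := ⟨a, ha⟩
    have e : γ (i, j, k) = g i j a * g j k a / g i k a := by
      simp only [γ]
      rw [dif_pos h]
      exact const i j k h.choose_spec ha
    have hm : g i j a * g j k a / g i k a ∈ Γ := e ▸ Subgroup.subset_closure ⟨_, rfl⟩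
    rw [← QuotientGroup.mk_mul]
    exact (QuotientGroup.eq_iff_div_mem).2 hm
  -- a label for each path, locating its end point
  choose l hl using fun a : Paths x => N.exists_mem_nhds (a.1 1)
  have hl' (a : Paths x) : a.1 1 ∈ N.U (l a) := mem_of_mem_nhds (hl a)
  let w (i : ι) (a : Paths x) : M ⧸ Γ := g i (l a) a
  let χ (i : ι) : Holonomy (endsIn x (N.U i)) (M ⧸ Γ) :=
    { val := fun {a b} q => ((Φ.comap ((κ i).restrict ((N.U_subset_Z i i (hU i)).trans
        (N.Z_subset_O i i (hU i)))).close).val q : M ⧸ Γ) * (w i b / w i a)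
      val_trans := fun q q' => by
        rw [Holonomy.val_trans, QuotientGroup.mk_mul, mul_mul_mul_comm, mul_comm (w i _ / _),
          div_mul_div_cancel] }
  have hχ (i : ι) (f : C(I, Paths x)) (hf : ∀ t, f t ∈ endsIn x (N.U i)) :
      (χ i).along f hf = (L i f : M ⧸ Γ) * (w i (f 1) / w i (f 0)) := by
    simp only [L]
    rw [holonomyVia_eq Φ (κ i) ((N.U_subset_Z i i (hU i)).trans (N.Z_subset_O i i (hU i))) f hf]
    rfl
  let f : C(I, Paths x) := ⟨fun t => (p t).1, by fun_prop⟩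
  have f0 : f 0 = c.1 := by simp [f]
  have f1 : f 1 = c.1 := by simp [f]
  have hfx (t : I) : (f t).1 1 = x := (p t).2
  have hx : x ∈ N.U (l c.1) := by
    have := hl' c.1
    rwa [hc] at this
  have hf (t : I) : f t ∈ endsIn x (N.U (l c.1)) := by
    change (f t).1 1 ∈ N.U (l c.1)
    rw [hfx]
    exact hx
  -- the loop is contracted by shrinking all paths to their starting point
  let K : C(I × I, Paths x) :=
    ⟨fun z => ⟨(ContinuousMap.curry ⟨fun y : (I × I) × I => (f y.1.2).1 (σ y.1.1 * y.2),
      continuous_eval_comp (by fun_prop) (by fun_prop)⟩) z, by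
        change (f z.2).1 (σ z.1 * 0) = x
        rw [mul_zero, (f z.2).2]⟩, (ContinuousMap.continuous _).subtype_mk _⟩
  have hK (z : I × I) (s : I) : (K z).1 s = (f z.2).1 (σ z.1 * s) := rfl
  have hext {a b : Paths x} (h : ∀ s, a.1 s = b.1 s) : a = b :=
    Subtype.ext (ContinuousMap.ext h)
  have key := Holonomy.along_eq_one_of_nullhomotopic (χ := χ) (fun i j f hi hj => by
      have hij : (N.U i ∩ N.U j).Nonempty := ⟨_, hi 0, hj 0⟩
      rw [hχ, hχ, hg i j hij f fun t => N.U_subset_Z i i (hU i) (hi t), QuotientGroup.mk_mul,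
        mul_assoc, QuotientGroup.mk_div, div_mul_div_comm]
      have h (t : I) : (g i j (f t) : M ⧸ Γ) * w j (f t) = w i (f t) :=
        hcocycle _ _ _ _ ⟨⟨hi t, hj t⟩, hl' _⟩
      rw [h, h])
    (fun a => ⟨l a, (continuous_eval_comp continuous_id continuous_const).continuousAt (hl a)⟩)
    K (y := c.1) (fun r => hext fun s => by rw [hK, f0, hc, hc])
    (fun r => hext fun s => by rw [hK, f1, hc, hc])
    (fun s => hext fun u => by rw [hK, unitInterval.symm_one, zero_mul, (f s).2, hc])
    f (fun s => hext fun u => by rw [hK, unitInterval.symm_zero, one_mul]) hf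
  rw [hχ, f0, f1, div_self', mul_one] at key
  have hmem : L (l c.1) f ∈ Γ := (QuotientGroup.eq_one_iff _).1 key
  have hxO : x ∈ N.O (l c.1) := N.Z_subset_O _ _ (hU _) (N.U_subset_Z _ _ (hU _) hx)
  have hloop := holonomyVia_loop Φ hxO (κ (l c.1)) f (fun t => (p t).2) (f0.trans f1.symm)
  have hval : Φ.along f (fun t => (p t).2) = Φ.val (Homotopic.Quotient.mk p) :=
    Eq.trans rfl (Φ.val_cast p (a' := ⟨f 0, (p 0).2⟩) (b' := ⟨f 1, (p 1).2⟩) (by simp [f])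
      (by simp [f]))
  rw [← hval, ← hloop]
  exact hmem

end FreeEnd

/-! ### Finite generation of the second relative homotopy group -/

namespace RelPi2

open RelHomotopy Path

variable {X : Type u} [TopologicalSpace X] {A : Set X} {x : A}

theorem boundary_mk (p : Path (base A x) (base A x)) :
    boundary A x (Homotopic.Quotient.mk p) =
      (Homotopic.Quotient.mk (p.map (endpoint A x).continuous) : Homotopic.Quotient x x) := rfl

/-- In a simply connected space every loop in `A` bounds. -/
theorem boundary_surjective [SimplyConnectedSpace X] : Function.Surjective (boundary A x) := by
  intro g
  obtain ⟨γ, rfl⟩ := Homotopic.Quotient.mk_surjective g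
  obtain ⟨K⟩ := SimplyConnectedSpace.paths_homotopic (Path.refl (x : X))
    (γ.map continuous_subtype_val)
  let p : Path (base A x) (base A x) :=
    ⟨family (fun s t => K (t, s)) (K.continuous.comp continuous_swap)
      (fun s => by rw [K.apply_zero]; rfl) (fun s => by rw [K.apply_one]; exact (γ s).2),
      ext_apply fun t => K.source t, ext_apply fun t => K.target t⟩
  refine ⟨Homotopic.Quotient.mk p, (boundary_mk p).trans (congrArg Homotopic.Quotient.mk ?_)⟩
  exact Path.ext (funext fun s => Subtype.ext (K.apply_one s))

theorem mem_center_of_boundary_eq_one {c : RelPi2 A x} (h : boundary A x c = 1) :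
    c ∈ Subgroup.center (RelPi2 A x) := by
  refine Subgroup.mem_center_iff.2 fun c' => ?_
  have := (crossedModule A x).peiffer c c'
  change boundary A x c • c' = _ at this
  rw [h, one_smul] at this
  rw [eq_mul_inv_iff_mul_eq] at this
  exact this

variable (A x) in
/-- The constant loop. -/
def constLoop : FreeEnd.endsIn (x : X) {(x : X)} := ⟨⟨ContinuousMap.const I x, rfl⟩, rfl⟩

variable (A x) in
/-- Loops at `x` as paths from `x` to points of `A`. -/
def ofLoop : C(FreeEnd.endsIn (x : X) {(x : X)}, PathSpace A x) :=
  ⟨fun p => ⟨p.1.1, p.1.2, by rw [show p.1.1 1 = x from p.2]; exact x.2⟩, by fun_prop⟩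

theorem boundary_ofLoop (p : Path (constLoop A x) (constLoop A x)) :
    boundary A x (Homotopic.Quotient.mk (p.map (ofLoop A x).continuous)) = 1 := by
  refine (boundary_mk _).trans (congrArg Homotopic.Quotient.mk (?_ : _ = Path.refl x))
  exact Path.ext (funext fun s => Subtype.ext (p s).2)

/-- The kernel of the boundary map consists of the classes of the loops of loops. -/
theorem exists_ofLoop {c : RelPi2 A x} (h : boundary A x c = 1) :
    ∃ p : Path (constLoop A x) (constLoop A x),
      c = Homotopic.Quotient.mk (p.map (ofLoop A x).continuous) := by
  obtain ⟨p, rfl⟩ := Homotopic.Quotient.mk_surjective c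
  rw [boundary_mk] at h
  obtain ⟨H⟩ := Homotopic.Quotient.eq.1
    (h : Homotopic.Quotient.mk _ = Homotopic.Quotient.mk (Path.refl x))
  have H0 (r : I) : H (r, 0) = x := H.source r
  have H1 (r : I) : H (r, 1) = x := H.target r
  have hb (s : I) : (p s).1 1 = (H (0, s) : A) := by rw [H.apply_zero]; rfl
  have hp : Continuous fun z : I × I => (p z.1).1 z.2 :=
    continuous_eval_comp (by fun_prop) continuous_snd
  have hH : Continuous fun z : (I × I) × I =>
      cat (p z.1.2).1 (fun u => (H (z.1.1 * u, z.1.2) : X)) z.2 :=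
    continuous_cat (f := fun (z : I × I) s => (p z.2).1 s)
      (g := fun z u => (H (z.1 * u, z.2) : X))
      (hp.comp (f := fun z : (I × I) × I => (z.1.2, z.2)) (by fun_prop))
      (by fun_prop) (fun z => by rw [mul_zero, hb])
  have hconst (s : I) : cat (fun _ => (x : X)) (fun _ => (x : X)) s = x := by
    unfold cat; split_ifs <;> rfl
  let m : Path (constLoop A x) (constLoop A x) :=
    ⟨FreeEnd.lift (fun s => cat (p s).1 (fun u => (H (u, s) : X)))
      (by
        have := hH.comp (by fun_prop : Continuous fun z : I × I => (((1 : I), z.1), z.2))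
        simpa only [Function.comp_def, one_mul] using this)
      (fun s => by rw [cat_zero, (p s).2.1])
      (fun s => by rw [cat_one, H.apply_one]; rfl),
      FreeEnd.ext_apply fun t => by
        change cat (p 0).1 (fun u => (H (u, 0) : X)) t = x
        simp only [p.source, H0]
        exact hconst t,
      FreeEnd.ext_apply fun t => by
        change cat (p 1).1 (fun u => (H (u, 1) : X)) t = x
        simp only [p.target, H1]
        exact hconst t⟩
  let n : Path (base A x) (base A x) :=
    ⟨family (fun s t => (p s).1 (lo t))
      (hp.comp (f := fun z : I × I => (z.1, lo z.2)) (by fun_prop))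
      (fun s => by rw [lo_zero, (p s).2.1]) (fun s => by rw [FreeEnd.lo_one]; exact (p s).2.2),
      ext_apply fun t => by change (p 0).1 (lo t) = x; rw [p.source]; rfl,
      ext_apply fun t => by change (p 1).1 (lo t) = x; rw [p.target]; rfl⟩
  have h1 : p.Homotopic n :=
    ⟨{ toContinuousMap := family (fun z t => (p z.2).1 (FreeEnd.slide lo z.1 t))
        (hp.comp (f := fun z : (I × I) × I => (z.1.2, FreeEnd.slide lo z.1.1 z.2))
          (Continuous.prodMk (by fun_prop) ((FreeEnd.continuous_slide lo).comp
            (by fun_prop : Continuous fun z : (I × I) × I => (z.1.1, z.2)))))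
        (fun z => by rw [FreeEnd.slide_fix lo _ 0 lo_zero, (p _).2.1])
        (fun z => by rw [FreeEnd.slide_fix lo _ 1 FreeEnd.lo_one]; exact (p _).2.2)
       map_zero_left := fun s => ext_apply fun t => by
        change (p s).1 (FreeEnd.slide lo 0 t) = _
        rw [FreeEnd.slide_zero]; rfl
       map_one_left := fun s => ext_apply fun t => by
        change (p s).1 (FreeEnd.slide lo 1 t) = _
        rw [FreeEnd.slide_one]; rfl
       prop' := fun r s hs => ext_apply fun t => by
        change (p s).1 (FreeEnd.slide lo r t) = (p s).1 t
        rcases hs with rfl | rfl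
        · rw [p.source]; rfl
        · rw [p.target]; rfl }⟩
  have h2 : n.Homotopic (m.map (ofLoop A x).continuous) :=
    ⟨{ toContinuousMap := family (fun z t => cat (p z.2).1 (fun u => (H (z.1 * u, z.2) : X)) t) hH
        (fun z => by rw [cat_zero, (p _).2.1]) (fun z => by rw [cat_one]; exact (H _).2)
       map_zero_left := fun s => ext_apply fun t => by
        change cat (p s).1 (fun u => (H (0 * u, s) : X)) t = (p s).1 (lo t)
        simp only [zero_mul]
        exact cat_const _ (hb s) t
       map_one_left := fun s => ext_apply fun t => by
        change cat (p s).1 (fun u => (H (1 * u, s) : X)) t = cat (p s).1 (fun u => (H (u, s) : X)) t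
        simp only [one_mul]
       prop' := fun r s hs => ext_apply fun t => by
        change cat (p s).1 (fun u => (H (r * u, s) : X)) t = (p s).1 (lo t)
        rcases hs with rfl | rfl
        · simp only [p.source, H0]; exact hconst t
        · simp only [p.target, H1]; exact hconst t }⟩
  exact ⟨m, Homotopic.Quotient.eq.2 (h1.trans h2)⟩

/-- If `X` is a compact, metrizable, locally contractible, simply connected space, then
`π₂(X, A, x)` is finitely generated as a crossed module as soon as `π₁(A, x)` is a finitely
generated group. -/
theorem exists_finite_generates [SimplyConnectedSpace X] [CompactSpace X]
    [TopologicalSpace.MetrizableSpace X] [StronglyLocallyContractibleSpace X]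
    (hG : ∃ S : Set (FundamentalGroup A x), S.Finite ∧ Subgroup.closure S = ⊤) :
    ∃ (k : ℕ) (β : Fin k → RelPi2 A x), (crossedModule A x).Generates β := by
  obtain ⟨S, hS, hST⟩ := hG
  obtain ⟨n, ⟨N⟩⟩ := SmallPaths.exists_nestedCover X
  let ψ : FundamentalGroup (FreeEnd.endsIn (x : X) {(x : X)}) (constLoop A x) →* RelPi2 A x :=
    FundamentalGroup.map (ofLoop A x) (constLoop A x)
  have hψ (p) : boundary A x (ψ p) = 1 := by
    obtain ⟨p, rfl⟩ := Homotopic.Quotient.mk_surjective p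
    exact boundary_ofLoop p
  let q := ψ.codRestrict (Subgroup.center (RelPi2 A x))
    fun p => mem_center_of_boundary_eq_one (hψ p)
  have : PathConnectedSpace ({(x : X)} : Set X) :=
    isPathConnected_iff_pathConnectedSpace.1 (isPathConnected_singleton _)
  have := FreeEnd.pathConnected_endsIn (x := (x : X)) (U := {(x : X)}) inferInstance
  let _ : CommGroup (Subgroup.center (RelPi2 A x)) :=
    { mul_comm := fun a b => Subtype.ext (Subgroup.mem_center_iff.1 b.2 a.1) }
  obtain ⟨Φ, hΦ⟩ := Holonomy.exists_extension (M := Subgroup.center (RelPi2 A x)) q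
  obtain ⟨R, hR, hΦR⟩ := FreeEnd.exists_finite_holonomy N Φ (c := constLoop A x) fun _ => rfl
  let l := Function.surjInv (boundary_surjective (A := A) (x := x))
  have hl := Function.surjInv_eq (boundary_surjective (A := A) (x := x))
  have hfin : (l '' S ∪ Subtype.val '' R).Finite := (hS.image _).union (hR.image _)
  have := hfin.to_subtype
  obtain ⟨k, ⟨e⟩⟩ := Finite.exists_equiv_fin ↑(l '' S ∪ Subtype.val '' R)
  refine ⟨k, fun i => (e.symm i).1, fun K _ hK => ?_⟩
  have hKm (c) (hc : c ∈ l '' S ∪ Subtype.val '' R) : c ∈ K := by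
    simpa using hK (e ⟨c, hc⟩)
  have hker (c) (hc : boundary A x c = 1) : c ∈ K := by
    obtain ⟨p, rfl⟩ := exists_ofLoop hc
    have h1 : Φ.val (Homotopic.Quotient.mk p) ∈ Subgroup.closure R := hΦR p
    have h2 : Φ.val (Homotopic.Quotient.mk p) = q (Homotopic.Quotient.mk p) := hΦ _
    rw [h2] at h1
    have h3 : Subgroup.closure R ≤ K.comap (Subgroup.center (RelPi2 A x)).subtype :=
      (Subgroup.closure_le _).2 fun r hr => hKm _ (Or.inr ⟨r, hr, rfl⟩)
    exact h3 h1
  have himage : K.map (boundary A x) = ⊤ := by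
    rw [eq_top_iff, ← hST, Subgroup.closure_le]
    exact fun g hg => ⟨l g, hKm _ (Or.inl ⟨g, hg, rfl⟩), hl g⟩
  refine eq_top_iff.2 fun c _ => ?_
  obtain ⟨c', hc', hcc'⟩ : boundary A x c ∈ K.map (boundary A x) := himage ▸ Subgroup.mem_top _
  have : c'⁻¹ * c ∈ K := hker _ (by rw [map_mul, map_inv, hcc', inv_mul_cancel])
  simpa using K.mul_mem hc' this

end RelPi2

/-! ### Squares as relative chains -/

namespace Singular

open Set

variable {X : Type*} [TopologicalSpace X]

theorem face_face {n : ℕ} (τ : Simplex X (n + 2)) (i : Fin (n + 3)) (j : Fin (n + 2)) :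
    face j (face i τ) = τ.comp ⟨stdSimplex.map (i.succAbove ∘ j.succAbove),
      stdSimplex.continuous_map _⟩ := by
  refine ContinuousMap.ext fun t => ?_
  simp only [face, ContinuousMap.comp_apply, ContinuousMap.coe_mk]
  rw [stdSimplex.map_comp_apply]

theorem bdry_bdry (c : Chain X 3) : bdry X 1 (bdry X 2 c) = 0 := by
  suffices h : (bdry X 1).comp (bdry X 2) = 0 from LinearMap.congr_fun h c
  refine Finsupp.lhom_ext' fun τ => LinearMap.ext_ring ?_
  have e1 : (1 : Fin 4).succAbove ∘ (0 : Fin 3).succAbove =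
    (0 : Fin 4).succAbove ∘ (0 : Fin 3).succAbove := by decide
  have e2 : (2 : Fin 4).succAbove ∘ (0 : Fin 3).succAbove =
    (0 : Fin 4).succAbove ∘ (1 : Fin 3).succAbove := by decide
  have e3 : (3 : Fin 4).succAbove ∘ (0 : Fin 3).succAbove =
    (0 : Fin 4).succAbove ∘ (2 : Fin 3).succAbove := by decide
  have e4 : (2 : Fin 4).succAbove ∘ (1 : Fin 3).succAbove =
    (1 : Fin 4).succAbove ∘ (1 : Fin 3).succAbove := by decide
  have e5 : (3 : Fin 4).succAbove ∘ (1 : Fin 3).succAbove =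
    (1 : Fin 4).succAbove ∘ (2 : Fin 3).succAbove := by decide
  have e6 : (3 : Fin 4).succAbove ∘ (2 : Fin 3).succAbove =
    (2 : Fin 4).succAbove ∘ (2 : Fin 3).succAbove := by decide
  have hs (i : Fin 4) (k : ℤ) : bdry X 1 (Finsupp.single (face i τ) k) =
      ∑ j, Finsupp.single (face j (face i τ)) (k * (-1) ^ (j : ℕ)) := by
    simp [bdry, Finset.smul_sum]
  simp only [LinearMap.comp_apply, Finsupp.lsingle_apply, bdry_single, map_sum, hs, face_face,
    LinearMap.zero_apply]
  change (∑ i : Fin 4, ∑ j : Fin 3, Finsupp.single (τ.comp ⟨stdSimplex.map (i.succAbove ∘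
    j.succAbove), stdSimplex.continuous_map _⟩ : Simplex X 1) ((-1) ^ (i : ℕ) * (-1) ^ (j : ℕ))) = 0
  simp only [Fin.sum_univ_four, Fin.sum_univ_three, e1, e2, e3, e4, e5, e6]
  norm_num
  abel

theorem face_const {n : ℕ} (i : Fin (n + 2)) (y : X) :
    face i (ContinuousMap.const _ y : Simplex X (n + 1)) = ContinuousMap.const _ y := rfl

theorem bdry_mem_chainsIn {A : Set X} {n : ℕ} {c : Chain X (n + 1)} (h : c ∈ chainsIn A (n + 1)) :
    bdry X n c ∈ chainsIn A n := by
  rw [chainsIn, Finsupp.supported_eq_span_single] at h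
  suffices h' : Submodule.span ℤ ((fun τ => Finsupp.single τ (1 : ℤ)) ''
      {τ : Simplex X (n + 1) | range τ ⊆ A}) ≤ (chainsIn A n).comap (bdry X n) from h' h
  rw [Submodule.span_le]
  rintro _ ⟨τ, hτ, rfl⟩
  change bdry X n (Finsupp.single τ 1) ∈ chainsIn A n
  rw [bdry_single]
  refine Submodule.sum_mem _ fun i _ => Finsupp.single_mem_supported ℤ _ ?_
  rintro _ ⟨t, rfl⟩
  exact hτ ⟨_, rfl⟩

/-- Relative boundaries together with the constant simplices. Modulo this submodule, all degenerate
`2`-simplices vanish. -/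
noncomputable def constBoundaries (A : Set X) : Submodule ℤ (Chain X 2) :=
  relBoundaries A 2 ⊔ LinearMap.range (Finsupp.lmapDomain ℤ ℤ
    (fun y : X => (ContinuousMap.const _ y : Simplex X 2)))

theorem single_const_mem (A : Set X) (y : X) :
    Finsupp.single (ContinuousMap.const _ y : Simplex X 2) 1 ∈ constBoundaries A :=
  Submodule.mem_sup_right ⟨Finsupp.single y 1, by simp⟩

theorem bdry_const (e : X →₀ ℤ) :
    bdry X 1 (e.mapDomain fun y : X => (ContinuousMap.const _ y : Simplex X 2)) =
      e.mapDomain fun y : X => (ContinuousMap.const _ y : Simplex X 1) := by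
  suffices h : (bdry X 1).comp (Finsupp.lmapDomain ℤ ℤ fun y : X =>
      (ContinuousMap.const _ y : Simplex X 2)) = Finsupp.lmapDomain ℤ ℤ fun y : X =>
      (ContinuousMap.const _ y : Simplex X 1) from LinearMap.congr_fun h e
  refine Finsupp.lhom_ext' fun y => LinearMap.ext_ring ?_
  simp [bdry_single, face_const, Fin.sum_univ_three]

/-- Dividing out the constant simplices loses no relative homology class: the boundary of a constant
`2`-simplex is a constant `1`-simplex, so a combination of them is a relative cycle only if it lies
in `A`. -/
theorem mem_relBoundaries_of_mem_constBoundaries {A : Set X} {c : Chain X 2}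
    (hc : c ∈ relCycles A 2) (h : c ∈ constBoundaries A) : c ∈ relBoundaries A 2 := by
  obtain ⟨b, hb, d, ⟨e, rfl⟩, rfl⟩ := Submodule.mem_sup.1 h
  refine Submodule.add_mem _ hb (Submodule.mem_sup_right ?_)
  have hb' : bdry X 1 b ∈ chainsIn A 1 := by
    obtain ⟨_, ⟨c, rfl⟩, a, ha, rfl⟩ := Submodule.mem_sup.1 hb
    rw [map_add, bdry_bdry, zero_add]
    exact bdry_mem_chainsIn ha
  have hd : bdry X 1 (e.mapDomain fun y : X => (ContinuousMap.const _ y : Simplex X 2)) ∈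
      chainsIn A 1 := by
    have h2 : bdry X 1 (b + _) ∈ chainsIn A 1 := hc
    rw [map_add] at h2
    exact (Submodule.add_mem_iff_right _ hb').1 h2
  rw [bdry_const] at hd
  have hinj : Function.Injective fun y : X => (ContinuousMap.const _ y : Simplex X 1) :=
    fun y z hyz => DFunLike.congr_fun hyz (Classical.arbitrary _)
  have heA (y : X) (hy : y ∈ e.support) : y ∈ A := by
    have : (ContinuousMap.const _ y : Simplex X 1) ∈
        (e.mapDomain fun y : X => (ContinuousMap.const _ y : Simplex X 1)).support := by
      rw [Finsupp.mem_support_iff, Finsupp.mapDomain_apply hinj]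
      exact Finsupp.mem_support_iff.1 hy
    exact hd this ⟨Classical.arbitrary _, rfl⟩
  refine (Finsupp.mem_supported _ _).2 fun τ hτ => ?_
  classical
  obtain ⟨y, hy, rfl⟩ := Finset.mem_image.1 (Finsupp.mapDomain_support hτ)
  rintro _ ⟨t, rfl⟩
  exact heA y hy

/-- Chains modulo relative boundaries and constant simplices. -/
noncomputable abbrev ChainClass (A : Set X) : Type _ := Chain X 2 ⧸ constBoundaries A

/-- The map from relative homology classes to classes of chains. -/
noncomputable def toChainClass (A : Set X) : RelHomology A 2 →ₗ[ℤ] ChainClass A :=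
  Submodule.mapQ _ _ (relCycles A 2).subtype fun _ h => Submodule.mem_sup_left h

theorem toChainClass_injective (A : Set X) : Function.Injective (toChainClass A) := by
  rw [← LinearMap.ker_eq_bot, LinearMap.ker_eq_bot']
  intro c hc
  obtain ⟨c, rfl⟩ := Submodule.Quotient.mk_surjective _ c
  exact (Submodule.Quotient.mk_eq_zero _).2
    (mem_relBoundaries_of_mem_constBoundaries c.2 ((Submodule.Quotient.mk_eq_zero _).1 hc))

/-- The class of a square. -/
noncomputable def squareClass (A : Set X) (f : C(I × I, X)) : ChainClass A :=
  Submodule.Quotient.mk (squareChain f)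

variable {A : Set X}

theorem squareClass_swap (f : C(I × I, X)) :
    squareClass A (f.comp ⟨Prod.swap, continuous_swap⟩) = -squareClass A f := by
  rw [squareClass, squareClass, ← Submodule.Quotient.mk_neg]
  congr 1
  rw [squareChain, squareChain, neg_sub]
  rfl

/-- The relation between the six faces of a cube. -/
theorem squareClass_cube (H : C(I × I × I, X)) :
    squareClass A (H.comp ⟨fun z => (1, z.1, z.2), by fun_prop⟩) -
      squareClass A (H.comp ⟨fun z => (0, z.1, z.2), by fun_prop⟩) -
      squareClass A (H.comp ⟨fun z => (z.1, 1, z.2), by fun_prop⟩) +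
      squareClass A (H.comp ⟨fun z => (z.1, 0, z.2), by fun_prop⟩) +
      squareClass A (H.comp ⟨fun z => (z.1, z.2, 1), by fun_prop⟩) -
      squareClass A (H.comp ⟨fun z => (z.1, z.2, 0), by fun_prop⟩) = 0 := by
  simp only [squareClass, ← Submodule.Quotient.mk_sub, ← Submodule.Quotient.mk_add]
  refine (Submodule.Quotient.mk_eq_zero _).2 (Submodule.mem_sup_left (Submodule.mem_sup_left
    ⟨cubeChain H, ?_⟩))
  have h1 (a b : ℕ) : squareSimplex (H.comp ⟨fun z => (1, z.1, z.2), by fun_prop⟩) 2 a b =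
      cubeSimplex H 2 0 a b :=
    ContinuousMap.ext fun t => by simp [cubeSimplex, squareSimplex, tail_zero]
  have h2 (a b : ℕ) : squareSimplex (H.comp ⟨fun z => (0, z.1, z.2), by fun_prop⟩) 2 a b =
      cubeSimplex H 2 3 a b :=
    ContinuousMap.ext fun t => by simp [cubeSimplex, squareSimplex, tail_top]
  have h3 (a b : ℕ) : squareSimplex (H.comp ⟨fun z => (z.1, 1, z.2), by fun_prop⟩) 2 a b =
      cubeSimplex H 2 a 0 b :=
    ContinuousMap.ext fun t => by simp [cubeSimplex, squareSimplex, tail_zero]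
  have h4 (a b : ℕ) : squareSimplex (H.comp ⟨fun z => (z.1, 0, z.2), by fun_prop⟩) 2 a b =
      cubeSimplex H 2 a 3 b :=
    ContinuousMap.ext fun t => by simp [cubeSimplex, squareSimplex, tail_top]
  have h5 (a b : ℕ) : squareSimplex (H.comp ⟨fun z => (z.1, z.2, 1), by fun_prop⟩) 2 a b =
      cubeSimplex H 2 a b 0 :=
    ContinuousMap.ext fun t => by simp [cubeSimplex, squareSimplex, tail_zero]
  have h6 (a b : ℕ) : squareSimplex (H.comp ⟨fun z => (z.1, z.2, 0), by fun_prop⟩) 2 a b =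
      cubeSimplex H 2 a b 3 :=
    ContinuousMap.ext fun t => by simp [cubeSimplex, squareSimplex, tail_top]
  rw [bdry_cubeChain]
  simp only [squareChain, h1, h2, h3, h4, h5, h6]
  abel

theorem squareClass_eq_zero_of_mem {f : C(I × I, X)} (h : ∀ z, f z ∈ A) : squareClass A f = 0 :=
  (Submodule.Quotient.mk_eq_zero _).2 (Submodule.mem_sup_left (Submodule.mem_sup_right
    (Submodule.sub_mem _ (single_mem fun _ => h _) (single_mem fun _ => h _))))

/-- The degenerate simplex `t ↦ g (t₁ + t₂)` is a boundary up to a constant simplex. -/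
theorem single_tail_one_mem (g : C(I, X)) :
    Finsupp.single (g.comp (tail 1) : Simplex X 2) 1 ∈ constBoundaries A := by
  have h : bdry X 2 (Finsupp.single (g.comp (tail 1) : Simplex X 3) 1) =
      Finsupp.single (ContinuousMap.const _ (g 1) : Simplex X 2) 1 -
        Finsupp.single (g.comp (tail 1) : Simplex X 2) 1 := by
    have hf (i : Fin 4) : face i (g.comp (tail 1) : Simplex X 3) =
        g.comp (tail (if 1 ≤ (i : ℕ) then 1 else 0)) :=
      ContinuousMap.ext fun t => by simp [face, tail_face]
    have h0 : g.comp (tail 0) = (ContinuousMap.const _ (g 1) : Simplex X 2) :=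
      ContinuousMap.ext fun t => by simp [tail_zero]
    simp [bdry_single, hf, h0, Fin.sum_univ_succ]
    abel
  rw [← sub_sub_cancel (Finsupp.single (ContinuousMap.const _ (g 1) : Simplex X 2) 1)
    (Finsupp.single (g.comp (tail 1) : Simplex X 2) 1), ← h]
  exact Submodule.sub_mem _ (single_const_mem A _)
    (Submodule.mem_sup_left (Submodule.mem_sup_left ⟨_, rfl⟩))

/-- The degenerate simplex `t ↦ g t₂` is a boundary up to a constant simplex. -/
theorem single_tail_two_mem (g : C(I, X)) :
    Finsupp.single (g.comp (tail 2) : Simplex X 2) 1 ∈ constBoundaries A := by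
  have h : bdry X 2 (Finsupp.single (g.comp (tail 3) : Simplex X 3) 1) =
      Finsupp.single (g.comp (tail 2) : Simplex X 2) 1 -
        Finsupp.single (ContinuousMap.const _ (g 0) : Simplex X 2) 1 := by
    have hf (i : Fin 4) : face i (g.comp (tail 3) : Simplex X 3) =
        g.comp (tail (if 3 ≤ (i : ℕ) then 3 else 2)) :=
      ContinuousMap.ext fun t => by simp [face, tail_face]
    have h0 : g.comp (tail 3) = (ContinuousMap.const _ (g 0) : Simplex X 2) :=
      ContinuousMap.ext fun t => by simp [tail_top]
    simp [bdry_single, hf, h0, Fin.sum_univ_succ]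
    abel
  rw [← sub_add_cancel (Finsupp.single (g.comp (tail 2) : Simplex X 2) 1)
    (Finsupp.single (ContinuousMap.const _ (g 0) : Simplex X 2) 1), ← h]
  exact Submodule.add_mem _ (Submodule.mem_sup_left (Submodule.mem_sup_left ⟨_, rfl⟩))
    (single_const_mem A _)

theorem squareClass_fst {f : C(I × I, X)} (h : ∀ s t, f (s, t) = f (s, 0)) :
    squareClass A f = 0 := by
  let g : C(I, X) := f.comp ⟨fun s => (s, 0), by fun_prop⟩
  have hs (a b : ℕ) : squareSimplex f 2 a b = g.comp (tail a) :=
    ContinuousMap.ext fun t => h _ _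
  rw [squareClass, squareChain, hs, hs]
  exact (Submodule.Quotient.mk_eq_zero _).2
    (Submodule.sub_mem _ (single_tail_one_mem g) (single_tail_two_mem g))

theorem squareClass_snd {f : C(I × I, X)} (h : ∀ s t, f (s, t) = f (0, t)) :
    squareClass A f = 0 := by
  rw [← neg_eq_zero, ← squareClass_swap]
  exact squareClass_fst fun s t => h t s

end Singular

/-! ### Additivity and invariance of the Hurewicz map -/

namespace RelPi2

open RelHomotopy Path Singular

variable {X : Type u} [TopologicalSpace X] {A : Set X} {x : A}

/-- The square adjoint to a path in the space of paths. -/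
def square {a b : PathSpace A x} (p : Path a b) : C(I × I, X) :=
  ⟨fun z => (p z.1).1 z.2, continuous_eval_comp (by fun_prop) continuous_snd⟩

/-- The square of a concatenation is homologous to the sum of the squares: the tops lie in `A` and
the bottoms are constant. -/
theorem squareClass_trans {a b c : PathSpace A x} (p : Path a b) (q : Path b c) :
    squareClass A (square (p.trans q)) = squareClass A (square p) + squareClass A (square q) := by
  -- the cube interpolating between `p` and the whole concatenation
  have hmem (r : I) : (1 + (r : ℝ)) / 2 ∈ I := by
    have := r.2.1; have := r.2.2; constructor <;> linarith
  let θ : C(I × I, I) := ⟨fun z => z.2 * ⟨(1 + (z.1 : ℝ)) / 2, hmem z.1⟩, by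
    have : Continuous fun z : I × I => (⟨(1 + (z.1 : ℝ)) / 2, hmem z.1⟩ : I) := by fun_prop
    fun_prop⟩
  have hθ (r s : I) : (θ (r, s) : ℝ) = s * ((1 + (r : ℝ)) / 2) := rfl
  let H : C(I × I × I, X) :=
    (square (p.trans q)).comp ⟨fun z => (θ (z.1, z.2.1), z.2.2), by fun_prop⟩
  have hH (r s t : I) : H (r, s, t) = (p.trans q (θ (r, s))).1 t := rfl
  have h := squareClass_cube (A := A) H
  have e1 : H.comp ⟨fun z => (1, z.1, z.2), by fun_prop⟩ = square (p.trans q) :=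
    ContinuousMap.ext fun z => by
      change (p.trans q (θ (1, z.1))).1 z.2 = (p.trans q z.1).1 z.2
      rw [show θ (1, z.1) = z.1 from Subtype.ext (by rw [hθ]; norm_num)]
  have e2 : H.comp ⟨fun z => (0, z.1, z.2), by fun_prop⟩ = square p :=
    ContinuousMap.ext fun z => by
      change (p.trans q (θ (0, z.1))).1 z.2 = (p z.1).1 z.2
      rw [trans_left p q (v := z.1) (by rw [hθ]; simp; ring)]
  have e3 : H.comp ⟨fun z => (z.1, 1, z.2), by fun_prop⟩ = square q :=
    ContinuousMap.ext fun z => by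
      change (p.trans q (θ (z.1, 1))).1 z.2 = (q z.1).1 z.2
      rw [trans_right p q (v := z.1) (by rw [hθ]; simp; ring)]
  have e4 : squareClass A (H.comp ⟨fun z => (z.1, 0, z.2), by fun_prop⟩) = 0 :=
    squareClass_snd fun s t => by
      change (p.trans q (θ (s, 0))).1 t = (p.trans q (θ (0, 0))).1 t
      rw [show θ (s, 0) = θ (0, 0) from Subtype.ext (by simp [hθ])]
  have e5 : squareClass A (H.comp ⟨fun z => (z.1, z.2, 1), by fun_prop⟩) = 0 :=
    squareClass_eq_zero_of_mem fun z => (p.trans q _).2.2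
  have e6 : squareClass A (H.comp ⟨fun z => (z.1, z.2, 0), by fun_prop⟩) = 0 :=
    squareClass_eq_zero_of_mem fun z => by
      change (p.trans q _).1 0 ∈ A
      rw [(p.trans q _).2.1]
      exact x.2
  rw [e1, e2, e3, e4, e5, e6, add_zero, add_zero, sub_zero, sub_sub] at h
  exact sub_eq_zero.1 h

theorem toChainClass_hurewicz (p : Path (base A x) (base A x)) :
    toChainClass A (hurewicz A x (Homotopic.Quotient.mk p)) = squareClass A (square p) := rfl

theorem hurewicz_mul (c c' : RelPi2 A x) :
    hurewicz A x (c * c') = hurewicz A x c + hurewicz A x c' := by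
  obtain ⟨p, rfl⟩ := Homotopic.Quotient.mk_surjective c
  obtain ⟨q, rfl⟩ := Homotopic.Quotient.mk_surjective c'
  refine toChainClass_injective A ?_
  rw [map_add, add_comm]
  exact squareClass_trans q p

variable (A x) in
/-- The Hurewicz map as a homomorphism. -/
noncomputable def hurewiczHom : RelPi2 A x →* Multiplicative (RelHomology A 2) :=
  MonoidHom.mk' (fun c => Multiplicative.ofAdd (hurewicz A x c)) hurewicz_mul

/-- Every element of `π₁(A, x)` bounds, hence acts on `π₂(X, A, x)` as an inner automorphism. -/
theorem hurewiczHom_smul [SimplyConnectedSpace X] (g : FundamentalGroup A x) (c : RelPi2 A x) :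
    hurewiczHom A x (g • c) = hurewiczHom A x c := by
  obtain ⟨c', rfl⟩ := boundary_surjective g
  have : boundary A x c' • c = c' * c * c'⁻¹ := (crossedModule A x).peiffer c' c
  rw [this, map_mul, map_mul, map_inv, mul_inv_cancel_comm]

end RelPi2

/-! ### Homotopy extension for the square -/

namespace Cube

open Set

/-- The denominator of the central projection of the cube, from a point above it, to its bottom and
lateral faces. -/
noncomputable def scale (z : I × I × I) : ℝ :=
  max (max |2 * (z.2.1 : ℝ) - 1| |2 * (z.2.2 : ℝ) - 1|) ((2 - z.1) / 2)

theorem scale_pos (z : I × I × I) : 0 < scale z :=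
  lt_max_of_lt_right (by have := z.1.2.2; linarith)

theorem continuous_scale : Continuous scale := by unfold scale; fun_prop

/-- The central projection from the point over the centre of the cube `[0, 1] × [0, 1]²` at height
`2` to the union of the bottom and the lateral faces. -/
noncomputable def retract : C(I × I × I, I × I × I) where
  toFun z := (projIcc 0 1 zero_le_one (2 - (2 - (z.1 : ℝ)) / scale z),
    projIcc 0 1 zero_le_one (((2 * (z.2.1 : ℝ) - 1) / scale z + 1) / 2),
    projIcc 0 1 zero_le_one (((2 * (z.2.2 : ℝ) - 1) / scale z + 1) / 2))
  continuous_toFun := by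
    have h := continuous_scale
    have h0 (z) : scale z ≠ 0 := (scale_pos z).ne'
    have h1 : Continuous fun z : I × I × I => 2 - (2 - (z.1 : ℝ)) / scale z :=
      continuous_const.sub (Continuous.div (by fun_prop) h h0)
    have h2 : Continuous fun z : I × I × I => ((2 * (z.2.1 : ℝ) - 1) / scale z + 1) / 2 :=
      ((Continuous.div (by fun_prop) h h0).add continuous_const).div_const _
    have h3 : Continuous fun z : I × I × I => ((2 * (z.2.2 : ℝ) - 1) / scale z + 1) / 2 :=
      ((Continuous.div (by fun_prop) h h0).add continuous_const).div_const _
    exact (continuous_projIcc.comp h1).prodMk ((continuous_projIcc.comp h2).prodMk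
      (continuous_projIcc.comp h3))

/-- The union of the bottom and the lateral faces of the cube. -/
def box : Set (I × I × I) := {z | z.2.1 = 0} ∪ ({z | z.2.1 = 1} ∪ ({z | z.2.2 = 0} ∪
  ({z | z.2.2 = 1} ∪ {z | z.1 = 0})))

theorem projIcc_eq_zero_or_one {u m : ℝ} (hm : 0 < m) (h : |2 * u - 1| = m) :
    projIcc 0 1 zero_le_one (((2 * u - 1) / m + 1) / 2) = (0 : I) ∨
      projIcc 0 1 zero_le_one (((2 * u - 1) / m + 1) / 2) = (1 : I) := by
  rcases (abs_eq hm.le).1 h with h | h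
  · right
    rw [h, div_self hm.ne']
    exact projIcc_of_right_le _ (by norm_num)
  · left
    rw [h, neg_div, div_self hm.ne']
    exact projIcc_of_le_left _ (by norm_num)

theorem retract_mem (z : I × I × I) : retract z ∈ box := by
  have hm := scale_pos z
  rcases max_choice (max |2 * (z.2.1 : ℝ) - 1| |2 * (z.2.2 : ℝ) - 1|) ((2 - (z.1 : ℝ)) / 2)
    with h | h
  · rcases max_choice |2 * (z.2.1 : ℝ) - 1| |2 * (z.2.2 : ℝ) - 1| with h' | h'
    · rcases projIcc_eq_zero_or_one hm (h'.symm.trans h.symm) with e | e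
      · exact Or.inl e
      · exact Or.inr (Or.inl e)
    · rcases projIcc_eq_zero_or_one hm (h'.symm.trans h.symm) with e | e
      · exact Or.inr (Or.inr (Or.inl e))
      · exact Or.inr (Or.inr (Or.inr (Or.inl e)))
  · refine Or.inr (Or.inr (Or.inr (Or.inr (projIcc_of_le_left zero_le_one ?_))))
    have : scale z = (2 - (z.1 : ℝ)) / 2 := h
    rw [this] at hm ⊢
    rw [div_div_cancel₀ (by linarith)]
    norm_num

theorem retract_eq_self {z : I × I × I} (hz : z ∈ box) : retract z = z := by
  obtain ⟨r, s, t⟩ := z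
  have hr0 := r.2.1
  have hs : |2 * (s : ℝ) - 1| ≤ 1 := abs_le.2 ⟨by linarith [s.2.1], by linarith [s.2.2]⟩
  have ht : |2 * (t : ℝ) - 1| ≤ 1 := abs_le.2 ⟨by linarith [t.2.1], by linarith [t.2.2]⟩
  have h1 : scale (r, s, t) = 1 := by
    refine le_antisymm (max_le (max_le hs ht) (by simp only; linarith)) ?_
    rcases hz with h | h | h | h | h <;> simp only [mem_ofPred_eq] at h <;> subst h
    · exact le_max_of_le_left (le_max_of_le_left (by norm_num))
    · exact le_max_of_le_left (le_max_of_le_left (by norm_num))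
    · exact le_max_of_le_left (le_max_of_le_right (by norm_num))
    · exact le_max_of_le_left (le_max_of_le_right (by norm_num))
    · exact le_max_of_le_right (by norm_num)
  have hP (u : I) (v : ℝ) (h : v = u) : projIcc 0 1 zero_le_one v = u := by
    rw [h, projIcc_val]
  change (projIcc 0 1 _ _, projIcc 0 1 _ _, projIcc 0 1 _ _) = _
  rw [h1, hP r _ (by simp only; ring), hP s _ (by simp only; ring), hP t _ (by simp only; ring)]

/-- A square and a homotopy of its four sides extend to a homotopy of the square. -/
theorem exists_fill {X : Type*} [TopologicalSpace X] (f b₀ b₁ c₀ c₁ : C(I × I, X))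
    (hb₀ : ∀ t, b₀ (0, t) = f (0, t)) (hb₁ : ∀ t, b₁ (0, t) = f (1, t))
    (hc₀ : ∀ s, c₀ (0, s) = f (s, 0)) (hc₁ : ∀ s, c₁ (0, s) = f (s, 1))
    (h₀₀ : ∀ r, b₀ (r, 0) = c₀ (r, 0)) (h₀₁ : ∀ r, b₀ (r, 1) = c₁ (r, 0))
    (h₁₀ : ∀ r, b₁ (r, 0) = c₀ (r, 1)) (h₁₁ : ∀ r, b₁ (r, 1) = c₁ (r, 1)) :
    ∃ H : C(I × I × I, X), (∀ s t, H (0, s, t) = f (s, t)) ∧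
      (∀ r t, H (r, 0, t) = b₀ (r, t)) ∧ (∀ r t, H (r, 1, t) = b₁ (r, t)) ∧
      (∀ r s, H (r, s, 0) = c₀ (r, s)) ∧ ∀ r s, H (r, s, 1) = c₁ (r, s) := by
  classical
  let G (z : I × I × I) : X :=
    if z.2.1 = 0 then b₀ (z.1, z.2.2) else if z.2.1 = 1 then b₁ (z.1, z.2.2) else
      if z.2.2 = 0 then c₀ (z.1, z.2.1) else if z.2.2 = 1 then c₁ (z.1, z.2.1) else f z.2
  have g1 (r t : I) : G (r, 0, t) = b₀ (r, t) := by simp [G]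
  have g2 (r t : I) : G (r, 1, t) = b₁ (r, t) := by simp [G]
  have g3 (r s : I) : G (r, s, 0) = c₀ (r, s) := by
    by_cases h0 : s = 0
    · rw [h0, g1, h₀₀]
    by_cases h1 : s = 1
    · rw [h1, g2, h₁₀]
    simp [G, h0, h1]
  have g4 (r s : I) : G (r, s, 1) = c₁ (r, s) := by
    by_cases h0 : s = 0
    · rw [h0, g1, h₀₁]
    by_cases h1 : s = 1
    · rw [h1, g2, h₁₁]
    simp [G, h0, h1]
  have g5 (s t : I) : G (0, s, t) = f (s, t) := by
    by_cases h0 : s = 0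
    · rw [h0, g1, hb₀]
    by_cases h1 : s = 1
    · rw [h1, g2, hb₁]
    by_cases h2 : t = 0
    · rw [h2, g3, hc₀]
    by_cases h3 : t = 1
    · rw [h3, g4, hc₁]
    simp [G, h0, h1, h2, h3]
  have hG : ContinuousOn G box := by
    have k1 : IsClosed {z : I × I × I | z.2.1 = 0} := isClosed_eq (by fun_prop) (by fun_prop)
    have k2 : IsClosed {z : I × I × I | z.2.1 = 1} := isClosed_eq (by fun_prop) (by fun_prop)
    have k3 : IsClosed {z : I × I × I | z.2.2 = 0} := isClosed_eq (by fun_prop) (by fun_prop)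
    have k4 : IsClosed {z : I × I × I | z.2.2 = 1} := isClosed_eq (by fun_prop) (by fun_prop)
    have k5 : IsClosed {z : I × I × I | z.1 = 0} := isClosed_eq (by fun_prop) (by fun_prop)
    refine ContinuousOn.union_of_isClosed ?_ (ContinuousOn.union_of_isClosed ?_
      (ContinuousOn.union_of_isClosed ?_ (ContinuousOn.union_of_isClosed ?_ ?_ k4 k5) k3
        (k4.union k5)) k2 (k3.union (k4.union k5))) k1 (k2.union (k3.union (k4.union k5)))
    · refine (Continuous.continuousOn (f := fun z : I × I × I => b₀ (z.1, z.2.2))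
        (by fun_prop)).congr ?_
      rintro ⟨r, s, t⟩ (rfl : s = 0)
      exact g1 r t
    · refine (Continuous.continuousOn (f := fun z : I × I × I => b₁ (z.1, z.2.2))
        (by fun_prop)).congr ?_
      rintro ⟨r, s, t⟩ (rfl : s = 1)
      exact g2 r t
    · refine (Continuous.continuousOn (f := fun z : I × I × I => c₀ (z.1, z.2.1))
        (by fun_prop)).congr ?_
      rintro ⟨r, s, t⟩ (rfl : t = 0)
      exact g3 r s
    · refine (Continuous.continuousOn (f := fun z : I × I × I => c₁ (z.1, z.2.1))
        (by fun_prop)).congr ?_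
      rintro ⟨r, s, t⟩ (rfl : t = 1)
      exact g4 r s
    · refine (Continuous.continuousOn (f := fun z : I × I × I => f z.2) (by fun_prop)).congr ?_
      rintro ⟨r, s, t⟩ (rfl : r = 0)
      exact g5 s t
  refine ⟨⟨fun z => G (retract z), hG.comp_continuous retract.continuous retract_mem⟩,
    fun s t => ?_, fun r t => ?_, fun r t => ?_, fun r s => ?_, fun r s => ?_⟩ <;>
    simp only [ContinuousMap.coe_mk]
  · rw [retract_eq_self (Or.inr (Or.inr (Or.inr (Or.inr rfl)))), g5]
  · rw [retract_eq_self (Or.inl rfl), g1]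
  · rw [retract_eq_self (Or.inr (Or.inl rfl)), g2]
  · rw [retract_eq_self (Or.inr (Or.inr (Or.inl rfl))), g3]
  · rw [retract_eq_self (Or.inr (Or.inr (Or.inr (Or.inl rfl)))), g4]

end Cube

/-! ### Surjectivity of the Hurewicz map -/

namespace Singular

open RelHomotopy

variable {X : Type*} [TopologicalSpace X]

theorem triangle_mem (s t : I) :
    ![1 - (s : ℝ), s - min (s : ℝ) t, min (s : ℝ) t] ∈ stdSimplex ℝ (Fin 3) := by
  constructor
  · intro i
    fin_cases i
    · simpa using s.2.2
    · simp
    · simpa using ⟨s.2.1, t.2.1⟩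
  · simp [Fin.sum_univ_succ]

/-- The parametrization `(s, t) ↦ (1 - s, s - min s t, min s t)` of the standard `2`-simplex by the
square; it collapses the triangle `s ≤ t` to an edge. -/
def triangle : C(I × I, stdSimplex ℝ (Fin 3)) where
  toFun z := ⟨_, triangle_mem z.1 z.2⟩
  continuous_toFun := by
    refine Continuous.subtype_mk (continuous_pi fun i => ?_) _
    fin_cases i
    · exact (by fun_prop : Continuous fun z : I × I => 1 - (z.1 : ℝ))
    · exact (by fun_prop : Continuous fun z : I × I => (z.1 : ℝ) - min (z.1 : ℝ) z.2)
    · exact (by fun_prop : Continuous fun z : I × I => min (z.1 : ℝ) z.2)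

theorem segment_mem (s : I) : ![1 - (s : ℝ), s] ∈ stdSimplex ℝ (Fin 2) := by
  constructor
  · intro i
    fin_cases i
    · simpa using s.2.2
    · simpa using s.2.1
  · simp [Fin.sum_univ_succ]

/-- The parametrization `s ↦ (1 - s, s)` of the standard `1`-simplex. -/
def segment : C(I, stdSimplex ℝ (Fin 2)) where
  toFun s := ⟨_, segment_mem s⟩
  continuous_toFun := by
    refine Continuous.subtype_mk (continuous_pi fun i => ?_) _
    fin_cases i
    · exact (by fun_prop : Continuous fun s : I => 1 - (s : ℝ))
    · exact (by fun_prop : Continuous fun s : I => (s : ℝ))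

theorem simplex_ext {p q : stdSimplex ℝ (Fin 3)} (h0 : p 0 = q 0) (h1 : p 1 = q 1)
    (h2 : p 2 = q 2) : p = q :=
  Subtype.ext (funext fun i => by
    fin_cases i
    exacts [h0, h1, h2])

theorem triangle_apply_zero (z : I × I) : triangle z 0 = 1 - (z.1 : ℝ) := rfl

theorem triangle_apply_one (z : I × I) : triangle z 1 = z.1 - min (z.1 : ℝ) z.2 := rfl

theorem triangle_apply_two (z : I × I) : triangle z 2 = min (z.1 : ℝ) z.2 := rfl

theorem coe_tail_one (t : stdSimplex ℝ (Fin 3)) : ((tail 1 t : I) : ℝ) = t 1 + t 2 := by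
  change (∑ j ∈ Finset.univ.filter (fun j : Fin 3 => 1 ≤ (j : ℕ)), t j) = _
  rw [show Finset.univ.filter (fun j : Fin 3 => 1 ≤ (j : ℕ)) = {1, 2} by decide]
  simp

theorem coe_tail_two (t : stdSimplex ℝ (Fin 3)) : ((tail 2 t : I) : ℝ) = t 2 := by
  change (∑ j ∈ Finset.univ.filter (fun j : Fin 3 => 2 ≤ (j : ℕ)), t j) = _
  rw [show Finset.univ.filter (fun j : Fin 3 => 2 ≤ (j : ℕ)) = {2} by decide]
  simp

theorem tail_two_le (t : stdSimplex ℝ (Fin 3)) : ((tail 2 t : I) : ℝ) ≤ (tail 1 t : I) := by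
  rw [coe_tail_one, coe_tail_two]
  exact le_add_of_nonneg_left (t.2.1 1)

theorem triangle_tail (t : stdSimplex ℝ (Fin 3)) : triangle (tail 1 t, tail 2 t) = t := by
  have h : t 0 + t 1 + t 2 = 1 := by
    rw [← Fin.sum_univ_three]
    exact t.2.2
  have hm := min_eq_right (tail_two_le t)
  refine simplex_ext ?_ ?_ ?_
  · rw [triangle_apply_zero, coe_tail_one]; linarith
  · rw [triangle_apply_one, hm, coe_tail_one, coe_tail_two]; ring
  · rw [triangle_apply_two, hm, coe_tail_two]

theorem map_segment_apply (i : Fin 3) (s : I) (j : Fin 3) :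
    stdSimplex.map i.succAbove (segment s) j =
      (if i.succAbove 0 = j then 1 - (s : ℝ) else 0) +
        if i.succAbove 1 = j then (s : ℝ) else 0 := by
  rw [stdSimplex.map_coe, FunOnFinite.linearMap_apply_apply, Finset.sum_filter, Fin.sum_univ_two]
  rfl

theorem face_zero_segment (τ : Simplex X 2) (s : I) :
    face 0 τ (segment s) = τ (triangle (1, s)) := by
  have hs : min 1 (s : ℝ) = s := min_eq_right s.2.2
  refine congrArg τ (?_ : stdSimplex.map (Fin.succAbove 0) (segment s) = triangle (1, s))
  refine simplex_ext ?_ ?_ ?_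
  · rw [triangle_apply_zero, map_segment_apply, if_neg (by decide), if_neg (by decide)]; simp
  · rw [triangle_apply_one, map_segment_apply, if_pos (by decide), if_neg (by decide)]; simp [hs]
  · rw [triangle_apply_two, map_segment_apply, if_neg (by decide), if_pos (by decide)]; simp [hs]

theorem face_one_segment (τ : Simplex X 2) (s : I) :
    face 1 τ (segment s) = τ (triangle (s, 1)) := by
  have hs : min (s : ℝ) 1 = s := min_eq_left s.2.2
  refine congrArg τ (?_ : stdSimplex.map (Fin.succAbove 1) (segment s) = triangle (s, 1))
  refine simplex_ext ?_ ?_ ?_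
  · rw [triangle_apply_zero, map_segment_apply, if_pos (by decide), if_neg (by decide)]; simp
  · rw [triangle_apply_one, map_segment_apply, if_neg (by decide), if_neg (by decide)]; simp [hs]
  · rw [triangle_apply_two, map_segment_apply, if_neg (by decide), if_pos (by decide)]; simp [hs]

theorem face_two_segment (τ : Simplex X 2) (s : I) :
    face 2 τ (segment s) = τ (triangle (s, 0)) := by
  have hs : min (s : ℝ) 0 = 0 := min_eq_right s.2.1
  refine congrArg τ (?_ : stdSimplex.map (Fin.succAbove 2) (segment s) = triangle (s, 0))
  refine simplex_ext ?_ ?_ ?_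
  · rw [triangle_apply_zero, map_segment_apply, if_pos (by decide), if_neg (by decide)]; simp
  · rw [triangle_apply_one, map_segment_apply, if_neg (by decide), if_pos (by decide)]; simp [hs]
  · rw [triangle_apply_two, map_segment_apply, if_neg (by decide), if_neg (by decide)]; simp [hs]

theorem triangle_zero (t : I) : triangle (0, t) = triangle (0, 0) := by
  have ht : min 0 (t : ℝ) = 0 := min_eq_left t.2.1
  refine simplex_ext rfl ?_ ?_ <;> simp [triangle_apply_one, triangle_apply_two, ht]

theorem squareClass_triangle {A : Set X} (τ : Simplex X 2) :
    squareClass A (τ.comp triangle) = Submodule.Quotient.mk (Finsupp.single τ 1) := by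
  have h1 : squareSimplex (τ.comp triangle) 2 1 2 = τ :=
    ContinuousMap.ext fun t => congrArg τ (triangle_tail t)
  let g : C(I, X) := τ.comp (triangle.comp ⟨fun s => (s, 1), by fun_prop⟩)
  have h2 : squareSimplex (τ.comp triangle) 2 2 1 = g.comp (tail 2) :=
    ContinuousMap.ext fun t => by
      change τ (triangle (tail 2 t, tail 1 t)) = τ (triangle (tail 2 t, 1))
      have h := min_eq_left (tail_two_le t)
      have h' : min ((tail 2 t : I) : ℝ) 1 = (tail 2 t : I) := min_eq_left (tail 2 t).2.2
      refine congrArg τ (simplex_ext rfl ?_ ?_) <;>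
        simp [triangle_apply_one, triangle_apply_two, h, h']
  rw [squareClass, squareChain, h1, h2, Submodule.Quotient.eq, sub_sub_cancel_left]
  exact Submodule.neg_mem _ (single_tail_two_mem g)

end Singular

namespace RelPi2

open RelHomotopy Path Singular

variable {X : Type u} [TopologicalSpace X] {A : Set X} {x : A}

/-- A square whose bottom is constant and whose top lies in `A`, as a path in the space of paths. -/
def ofSquare (f : C(I × I, X)) (a b : PathSpace A x) (h0 : ∀ s, f (s, 0) = x)
    (h1 : ∀ s, f (s, 1) ∈ A) (ha : ∀ t, f (0, t) = a.1 t) (hb : ∀ t, f (1, t) = b.1 t) :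
    Path a b :=
  ⟨family (fun s t => f (s, t)) (by fun_prop) h0 h1, ext_apply ha, ext_apply hb⟩

theorem square_ofSquare (f : C(I × I, X)) (a b : PathSpace A x) (h0 : ∀ s, f (s, 0) = x)
    (h1 : ∀ s, f (s, 1) ∈ A) (ha : ∀ t, f (0, t) = a.1 t) (hb : ∀ t, f (1, t) = b.1 t) :
    square (ofSquare f a b h0 h1 ha hb) = f := rfl

variable (A x) in
/-- The classes of chains that represent elements of the image of the Hurewicz map. -/
noncomputable def sphericalClasses : Submodule ℤ (ChainClass A) :=
  AddSubgroup.toIntSubmodule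
    { carrier := Set.range fun c => toChainClass A (hurewicz A x c)
      zero_mem' := ⟨1, by
        have h := hurewicz_mul (1 : RelPi2 A x) 1
        rw [one_mul, left_eq_add] at h
        change toChainClass A (hurewicz A x 1) = 0
        rw [h, map_zero]⟩
      add_mem' := by
        rintro _ _ ⟨c, rfl⟩ ⟨c', rfl⟩
        exact ⟨c * c', by simp only [hurewicz_mul, map_add]⟩
      neg_mem' := by
        rintro _ ⟨c, rfl⟩
        exact ⟨c⁻¹, by
          have h := map_inv (hurewiczHom A x) c
          have h' : hurewicz A x c⁻¹ = -hurewicz A x c := h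
          simp only [h', map_neg]⟩ }

theorem squareClass_mem_sphericalClasses {p : Path (base A x) (base A x)} :
    squareClass A (square p) ∈ sphericalClasses A x :=
  ⟨Homotopic.Quotient.mk p, toChainClass_hurewicz p⟩

/-- A `1`-simplex spans a square whose bottom is constant and whose sides are chosen paths to the
vertices. -/
theorem exists_square [SimplyConnectedSpace X] (γ : ∀ y : X, Path (x : X) y) (ρ : Simplex X 1) :
    ∃ e : C(I × I, X), (∀ s, e (s, 0) = x) ∧ (∀ s, e (s, 1) = ρ (segment s)) ∧
      (∀ t, e (0, t) = γ (ρ (segment 0)) t) ∧ ∀ t, e (1, t) = γ (ρ (segment 1)) t := by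
  let p := γ (ρ (segment 0))
  let g : Path (ρ (segment 0)) (ρ (segment 1)) := ⟨ρ.comp segment, rfl, rfl⟩
  have hg (s : I) : g s = ρ (segment s) := rfl
  obtain ⟨K⟩ := SimplyConnectedSpace.paths_homotopic (p.trans g) (γ (ρ (segment 1)))
  obtain ⟨H, -, h1, h2, h3, h4⟩ := Cube.exists_fill
    ⟨fun z => cat p (fun u => g (z.1 * u)) z.2, continuous_cat (f := fun _ s => p s)
      (g := fun (r : I) s => g (r * s)) (by fun_prop) (by fun_prop) (fun r => by simp)⟩
    ⟨fun z => p (FreeEnd.slide lo (unitInterval.symm z.1) z.2),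
      p.continuous.comp ((FreeEnd.continuous_slide lo).comp
        (by fun_prop : Continuous fun z : I × I => (unitInterval.symm z.1, z.2)))⟩
    K.toContinuousMap (ContinuousMap.const _ (x : X)) ⟨fun z => g z.2, by fun_prop⟩
    (fun t => by
      change p (FreeEnd.slide lo (unitInterval.symm 0) t) = cat p (fun u => g (0 * u)) t
      rw [unitInterval.symm_zero, FreeEnd.slide_one]
      simp only [zero_mul, g.source]
      exact (cat_const p p.target t).symm)
    (fun t => by
      change K (0, t) = cat p (fun u => g (1 * u)) t
      rw [K.apply_zero]
      simp only [one_mul]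
      rfl)
    (fun s => by
      change (x : X) = cat p (fun u => g (s * u)) 0
      rw [cat_zero, p.source])
    (fun s => by
      change g s = cat p (fun u => g (s * u)) 1
      rw [cat_one, mul_one])
    (fun r => by
      change p (FreeEnd.slide lo _ 0) = x
      rw [FreeEnd.slide_fix lo _ 0 lo_zero, p.source])
    (fun r => by
      change p (FreeEnd.slide lo _ 1) = g 0
      rw [FreeEnd.slide_fix lo _ 1 FreeEnd.lo_one, p.target, g.source])
    (fun r => K.source r) (fun r => (K.target r).trans g.target.symm)
  refine ⟨H.comp ⟨fun z => (1, z.1, z.2), by fun_prop⟩, fun s => h3 1 s, fun s => h4 1 s,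
    fun t => (h1 1 t).trans ?_, fun t => (h2 1 t).trans (K.apply_one t)⟩
  change p (FreeEnd.slide lo (unitInterval.symm 1) t) = p t
  rw [unitInterval.symm_one, FreeEnd.slide_zero]

/-- Up to classes in the image of the Hurewicz map, a `2`-simplex is the sum of the squares that its
faces span: push the simplex down along these squares, to a sphere based at `x`. -/
theorem mk_single_sub_mem {γ : ∀ y : X, Path (x : X) y} {e : Simplex X 1 → C(I × I, X)}
    (he0 : ∀ ρ s, e ρ (s, 0) = x) (he1 : ∀ ρ s, e ρ (s, 1) = ρ (segment s))
    (hel : ∀ ρ t, e ρ (0, t) = γ (ρ (segment 0)) t)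
    (her : ∀ ρ t, e ρ (1, t) = γ (ρ (segment 1)) t) (τ : Simplex X 2) :
    (Submodule.Quotient.mk (Finsupp.single τ 1) : ChainClass A) +
      (squareClass A (e (face 0 τ)) - squareClass A (e (face 1 τ)) +
        squareClass A (e (face 2 τ))) ∈ sphericalClasses A x := by
  have hγ {y z : X} (h : y = z) (t : I) : γ y t = γ z t := by
    subst h
    rfl
  obtain ⟨H, h0, h1, h2, h3, h4⟩ := Cube.exists_fill (τ.comp triangle)
    ⟨fun z => γ (τ (triangle (0, 0))) (unitInterval.symm z.1), by fun_prop⟩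
    ⟨fun z => e (face 0 τ) (z.2, unitInterval.symm z.1), by fun_prop⟩
    ⟨fun z => e (face 2 τ) (z.2, unitInterval.symm z.1), by fun_prop⟩
    ⟨fun z => e (face 1 τ) (z.2, unitInterval.symm z.1), by fun_prop⟩
    (fun t => by simp [triangle_zero])
    (fun t => by simp [he1, face_zero_segment])
    (fun s => by simp [he1, face_two_segment])
    (fun s => by simp [he1, face_one_segment])
    (fun r => ((hel _ _).trans (hγ (face_two_segment τ 0) _)).symm)
    (fun r => ((hel _ _).trans (hγ ((face_one_segment τ 0).trans (by rw [triangle_zero])) _)).symm)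
    (fun r => (hel _ _).trans ((hγ ((face_zero_segment τ 0).trans
      (face_two_segment τ 1).symm) _).trans (her _ _).symm))
    (fun r => (her _ _).trans ((hγ ((face_zero_segment τ 1).trans
      (face_one_segment τ 1).symm) _).trans (her _ _).symm))
  simp only [ContinuousMap.coe_mk, ContinuousMap.comp_apply] at h0 h1 h2 h3 h4
  let G : C(I × I × I, X) := H.comp ⟨fun z => (unitInterval.symm z.1, z.2), by fun_prop⟩
  have hG (r s t : I) : G (r, s, t) = H (unitInterval.symm r, s, t) := rfl
  let m : C(I × I, X) := G.comp ⟨fun z => (0, z.1, z.2), by fun_prop⟩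
  have hm (s t : I) : m (s, t) = H (1, s, t) := by
    change H (unitInterval.symm 0, s, t) = _
    rw [unitInterval.symm_zero]
  have hmem : squareClass A m ∈ sphericalClasses A x := by
    have := squareClass_mem_sphericalClasses (A := A) (x := x)
      (p := ofSquare m (base A x) (base A x) (fun s => by simp [hm, h3, he0])
        (fun s => by simp [hm, h4, he0]) (fun t => by simp [hm, h1]; rfl)
        (fun t => by simp [hm, h2, he0]; rfl))
    rwa [square_ofSquare] at this
  have h := squareClass_cube (A := A) G
  have e1 : G.comp ⟨fun z => (1, z.1, z.2), by fun_prop⟩ = τ.comp triangle :=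
    ContinuousMap.ext fun z => by
      change H (unitInterval.symm 1, z.1, z.2) = _
      rw [unitInterval.symm_one, h0]
      rfl
  have e3 : G.comp ⟨fun z => (z.1, 1, z.2), by fun_prop⟩ =
      (e (face 0 τ)).comp ⟨Prod.swap, continuous_swap⟩ :=
    ContinuousMap.ext fun z => by
      change H (unitInterval.symm z.1, 1, z.2) = e (face 0 τ) (z.2, z.1)
      rw [h2, unitInterval.symm_symm]
  have e4 : squareClass A (G.comp ⟨fun z => (z.1, 0, z.2), by fun_prop⟩) = 0 :=
    squareClass_fst fun s t => by
      change H (unitInterval.symm s, 0, t) = H (unitInterval.symm s, 0, 0)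
      rw [h1, h1]
  have e5 : G.comp ⟨fun z => (z.1, z.2, 1), by fun_prop⟩ =
      (e (face 1 τ)).comp ⟨Prod.swap, continuous_swap⟩ :=
    ContinuousMap.ext fun z => by
      change H (unitInterval.symm z.1, z.2, 1) = e (face 1 τ) (z.2, z.1)
      rw [h4, unitInterval.symm_symm]
  have e6 : G.comp ⟨fun z => (z.1, z.2, 0), by fun_prop⟩ =
      (e (face 2 τ)).comp ⟨Prod.swap, continuous_swap⟩ :=
    ContinuousMap.ext fun z => by
      change H (unitInterval.symm z.1, z.2, 0) = e (face 2 τ) (z.2, z.1)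
      rw [h3, unitInterval.symm_symm]
  rw [e1, e3, e4, e5, e6, squareClass_swap, squareClass_swap, squareClass_swap,
    squareClass_triangle] at h
  have key : (Submodule.Quotient.mk (Finsupp.single τ 1) : ChainClass A) +
      (squareClass A (e (face 0 τ)) - squareClass A (e (face 1 τ)) +
        squareClass A (e (face 2 τ))) = squareClass A m := by
    rw [← sub_eq_zero, ← h]
    abel
  rwa [key]

/-- A square whose sides and top lie in `A`, and whose bottom is constant, represents an element of
`π₂(X, A, x)` after its sides have been contracted within `A`. -/
theorem squareClass_mem_of_mem {γ : ∀ y : X, Path (x : X) y} (hγ : ∀ y ∈ A, ∀ t, γ y t ∈ A)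
    {f : C(I × I, X)} {y z : X} (hy : y ∈ A) (hz : z ∈ A) (h0 : ∀ s, f (s, 0) = x)
    (h1 : ∀ s, f (s, 1) ∈ A) (hl : ∀ t, f (0, t) = γ y t) (hr : ∀ t, f (1, t) = γ z t) :
    squareClass A f ∈ sphericalClasses A x := by
  let pt (y : X) (hy : y ∈ A) : PathSpace A x := ⟨γ y, (γ y).source, by
    change γ y 1 ∈ A
    rw [(γ y).target]
    exact hy⟩
  let grow (y : X) (hy : y ∈ A) : Path (base A x) (pt y hy) :=
    ofSquare ⟨fun z => γ y (z.1 * z.2), by fun_prop⟩ _ _ (fun s => by simp)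
      (fun s => hγ y hy _) (fun t => by simp; rfl) (fun t => by simp; rfl)
  have h := squareClass_mem_sphericalClasses
    (p := ((grow y hy).trans (ofSquare f (pt y hy) (pt z hz) h0 h1 hl hr)).trans (grow z hz).symm)
  rw [squareClass_trans, squareClass_trans,
    squareClass_eq_zero_of_mem (f := square (grow y hy)) fun _ => hγ y hy _,
    squareClass_eq_zero_of_mem (f := square (grow z hz).symm) fun _ => hγ z hz _, zero_add,
    add_zero, square_ofSquare] at h
  exact h

/-- The relative Hurewicz theorem, surjectivity in degree two. -/
theorem hurewicz_surjective [SimplyConnectedSpace X] [PathConnectedSpace A] :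
    Function.Surjective (hurewicz A x) := by
  have hγ (y : X) : ∃ p : Path (x : X) y, y ∈ A → ∀ t, p t ∈ A := by
    by_cases hy : y ∈ A
    · let p := PathConnectedSpace.somePath x ⟨y, hy⟩
      exact ⟨p.map continuous_subtype_val, fun _ t => (p t).2⟩
    · exact ⟨PathConnectedSpace.somePath _ _, fun h => absurd h hy⟩
  choose γ hγ using hγ
  choose e he0 he1 hel her using exists_square γ
  let S : Chain X 1 →ₗ[ℤ] ChainClass A :=
    Finsupp.linearCombination ℤ fun ρ => squareClass A (e ρ)
  have hS (ρ : Simplex X 1) (n : ℤ) : S (Finsupp.single ρ n) = n • squareClass A (e ρ) :=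
    Finsupp.linearCombination_single ..
  have hSA : chainsIn A 1 ≤ (sphericalClasses A x).comap S := by
    rw [chainsIn, Finsupp.supported_eq_span_single, Submodule.span_le]
    rintro _ ⟨ρ, hρ, rfl⟩
    change S (Finsupp.single ρ 1) ∈ sphericalClasses A x
    rw [hS, one_smul]
    have hρA (t) : ρ t ∈ A := hρ ⟨t, rfl⟩
    exact squareClass_mem_of_mem hγ (hρA _) (hρA _) (he0 ρ) (fun s => by rw [he1]; exact hρA _)
      (hel ρ) (her ρ)
  have hall : (⊤ : Submodule ℤ (Chain X 2)) ≤ (sphericalClasses A x).comap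
      ((constBoundaries A).mkQ + S.comp (bdry X 1)) := by
    rw [← Finsupp.supported_univ, Finsupp.supported_eq_span_single, Submodule.span_le]
    rintro _ ⟨τ, -, rfl⟩
    have h := mk_single_sub_mem (A := A) he0 he1 hel her τ
    change Submodule.Quotient.mk (Finsupp.single τ 1) + S (bdry X 1 (Finsupp.single τ 1)) ∈
      sphericalClasses A x
    convert h using 2
    rw [bdry_single, map_sum, Fin.sum_univ_three]
    simp only [hS]
    simp
    abel
  intro z
  obtain ⟨z, rfl⟩ := Submodule.Quotient.mk_surjective _ z
  have h1 : Submodule.Quotient.mk z.1 + S (bdry X 1 z.1) ∈ sphericalClasses A x :=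
    hall (Submodule.mem_top (x := z.1))
  have h2 : S (bdry X 1 z.1) ∈ sphericalClasses A x := hSA z.2
  obtain ⟨c, hc⟩ := (Submodule.add_mem_iff_left _ h2).1 h1
  exact ⟨c, toChainClass_injective A hc⟩

end RelPi2

/-! ### Generating systems of abelian groups and elementary moves -/

namespace Nielsen

open Function

variable {H : Type*} [AddCommGroup H] {ι : Type*} [Fintype ι]

theorem exists_sum_of_closure_eq_top {b : ι → H} (hb : AddSubgroup.closure (Set.range b) = ⊤)
    (a : H) : ∃ c : ι → ℤ, ∑ i, c i • b i = a := by
  have h : Submodule.span ℤ (Set.range b) = ⊤ := by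
    rw [← Submodule.toAddSubgroup_inj, Submodule.span_int_eq_addSubgroupClosure, hb]
    rfl
  exact (Submodule.mem_span_range_iff_exists_fun ℤ).1 (h ▸ Submodule.mem_top)

/-- If all relations between the members of a generating system are divisible by `d ≠ 1`, no
generating system has fewer members: modulo `d` these members are linearly independent. -/
theorem card_le_of_dvd {b : ι → H} (hb : AddSubgroup.closure (Set.range b) = ⊤) {d : ℕ}
    (hd : d ≠ 1) (hdvd : ∀ c : ι → ℤ, ∑ i, c i • b i = 0 → ∀ i, (d : ℤ) ∣ c i) {m : ℕ}
    {g : Fin m → H} (hg : AddSubgroup.closure (Set.range g) = ⊤) : Fintype.card ι ≤ m := by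
  classical
  choose u hu using fun i => exists_sum_of_closure_eq_top hg (b i)
  choose v hv using fun j => exists_sum_of_closure_eq_top hb (g j)
  have hrel (i k : ι) : (d : ℤ) ∣ (∑ j, u i j * v j k) - if i = k then 1 else 0 := by
    refine hdvd (fun k => (∑ j, u i j * v j k) - if i = k then 1 else 0) ?_ k
    simp only [sub_smul, Finset.sum_sub_distrib, Finset.sum_smul, ite_smul, one_smul, zero_smul,
      Finset.sum_ite_eq, Finset.mem_univ, if_true]
    rw [Finset.sum_comm]
    simp only [mul_smul, ← Finset.smul_sum, hv, hu, sub_self]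
  have : Nontrivial (ZMod d) := ZMod.nontrivial_iff.2 hd
  let U : Matrix ι (Fin m) (ZMod d) := .of fun i j => (u i j : ZMod d)
  let V : Matrix (Fin m) ι (ZMod d) := .of fun j k => (v j k : ZMod d)
  have hUV : U * V = 1 := by
    ext i k
    have := (ZMod.intCast_eq_intCast_iff_dvd_sub _ _ d).2
      ((dvd_sub_comm).1 (hrel i k))
    rw [Matrix.mul_apply, Matrix.one_apply]
    simpa [U, V] using this
  have hinj : Injective (Matrix.vecMulLinear U) := fun a a' h => by
    have h' := congrArg (fun w => Matrix.vecMul w V) h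
    simpa [Matrix.vecMul_vecMul, hUV] using h'
  simpa using card_le_of_injective (ZMod d) (Matrix.vecMulLinear U) hinj

theorem sum_move [DecidableEq ι] (b : ι → H) (c : ι → ℤ) {i j : ι} (hij : i ≠ j) (q : ℤ) :
    ∑ k, update c j (c j - q * c i) k • update b i (b i + q • b j) k = ∑ k, c k • b k := by
  have h (k : ι) : update c j (c j - q * c i) k • update b i (b i + q • b j) k =
      c k • b k + ((if k = i then (q * c i) • b j else 0) -
        if k = j then (q * c i) • b j else 0) := by
    by_cases hi : k = i
    · subst hi
      simp only [update_self, update_of_ne hij, if_true, if_neg hij, sub_zero, smul_add,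
        smul_smul, mul_comm q]
    · by_cases hj : k = j
      · subst hj
        simp only [update_self, update_of_ne hi, if_true, if_neg hi, zero_sub, sub_smul]
        rw [sub_eq_add_neg]
      · simp only [update_of_ne hi, update_of_ne hj, if_neg hi, if_neg hj, sub_zero, add_zero]
  simp only [h, Finset.sum_add_distrib, Finset.sum_sub_distrib, Finset.sum_ite_eq',
    Finset.mem_univ, if_true, sub_self, add_zero]

/-- Elementary moves lead from a generating system that is too long to one with a zero member.
The least absolute value `d` of a nonzero coefficient of a relation that can be obtained by moves
divides all coefficients of all relations; hence `d = 1`, and some member is redundant. -/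
theorem exists_apply_eq_zero [DecidableEq ι] {P : (ι → H) → Prop}
    (hP : ∀ b i j (q : ℤ), i ≠ j → P b → P (update b i (b i + q • b j)))
    (hgen : ∀ b, P b → AddSubgroup.closure (Set.range b) = ⊤) {m : ℕ} {g : Fin m → H}
    (hg : AddSubgroup.closure (Set.range g) = ⊤) (hm : m < Fintype.card ι) {b₀ : ι → H}
    (hb₀ : P b₀) : ∃ b, P b ∧ ∃ i, b i = 0 := by
  classical
  have hex : ∃ d : ℕ, 0 < d ∧ ∃ b, P b ∧ ∃ c : ι → ℤ, ∑ k, c k • b k = 0 ∧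
      ∃ i, (c i).natAbs = d := by
    by_contra hcon
    refine hm.not_ge (card_le_of_dvd (hgen _ hb₀) zero_ne_one (fun c hc i => ?_) hg)
    by_contra hci
    refine hcon ⟨(c i).natAbs, Int.natAbs_pos.2 fun h => hci (by simp [h]), b₀, hb₀, c, hc, i, rfl⟩
  obtain ⟨hd0, b, hb, c, hc, i, hci⟩ := Nat.find_spec hex
  have hmin {b : ι → H} (hb : P b) {c : ι → ℤ} (hc : ∑ k, c k • b k = 0) (j : ι)
      (h0 : 0 ≤ c j) (hlt : c j < Nat.find hex) : c j = 0 := by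
    by_contra hne
    exact Nat.find_min hex (m := (c j).natAbs) (by omega)
      ⟨Int.natAbs_pos.2 hne, b, hb, c, hc, j, rfl⟩
  set d := Nat.find hex with hd
  have hd' : (0 : ℤ) < d := by exact_mod_cast hd0
  obtain ⟨c, hc, hci⟩ : ∃ c : ι → ℤ, ∑ k, c k • b k = 0 ∧ c i = d := by
    rcases Int.natAbs_eq (c i) with h | h
    · exact ⟨c, hc, by omega⟩
    · exact ⟨fun k => -c k, by simp [neg_smul, Finset.sum_neg_distrib, hc], by simp only; omega⟩
  have hdvd {b : ι → H} (hb : P b) {c : ι → ℤ} (hc : ∑ k, c k • b k = 0) (hci : c i = d) (j : ι) :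
      (d : ℤ) ∣ c j := by
    by_cases hij : i = j
    · rw [← hij, hci]
    have h1 : c j - c j / d * c i = c j % d := by rw [hci, Int.emod_def, mul_comm]
    have := hmin (hP b i j (c j / d) hij hb) ((sum_move b c hij (c j / d)).trans hc) j
      (by rw [update_self, h1]; exact Int.emod_nonneg _ hd'.ne')
      (by rw [update_self, h1]; exact Int.emod_lt_of_pos _ hd')
    rw [update_self, h1] at this
    exact Int.dvd_of_emod_eq_zero this
  have hclear (S : Finset ι) (hS : i ∉ S) : ∃ b, P b ∧ ∃ c : ι → ℤ, ∑ k, c k • b k = 0 ∧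
      c i = d ∧ ∀ k ∈ S, c k = 0 := by
    induction S using Finset.induction_on with
    | empty => exact ⟨b, hb, c, hc, hci, by simp⟩
    | insert j S hj ih =>
      obtain ⟨b, hb, c, hc, hci, hcS⟩ := ih fun h => hS (Finset.mem_insert_of_mem h)
      have hij : i ≠ j := fun h => hS (h ▸ Finset.mem_insert_self _ _)
      refine ⟨_, hP b i j (c j / d) hij hb, _, (sum_move b c hij (c j / d)).trans hc, ?_, ?_⟩
      · rw [update_of_ne hij, hci]
      · intro k hk
        rcases Finset.mem_insert.1 hk with rfl | hk
        · rw [update_self, hci, Int.ediv_mul_cancel (hdvd hb hc hci k), sub_self]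
        · rw [update_of_ne (fun h : k = j => hj (h ▸ hk)), hcS k hk]
  obtain ⟨b, hb, c, hc, hci, hcS⟩ := hclear (Finset.univ.erase i) (Finset.notMem_erase _ _)
  have hdb : (d : ℤ) • b i = 0 := by
    rw [Finset.sum_eq_single_of_mem i (Finset.mem_univ _) fun k _ hk => by
      rw [hcS k (Finset.mem_erase.2 ⟨hk, Finset.mem_univ _⟩), zero_smul], hci] at hc
    exact hc
  by_cases hd1 : d = 1
  · exact ⟨b, hb, i, by rw [hd1] at hdb; simpa using hdb⟩
  -- otherwise `d` divides all relations
  refine absurd (card_le_of_dvd (hgen b hb) hd1 (fun c hc j => ?_) hg) hm.not_ge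
  have hupd (a : ℤ) (ha : a • b i = c i • b i) : ∑ k, update c i a k • b k = 0 := by
    rw [← hc]
    refine Finset.sum_congr rfl fun k _ => ?_
    by_cases hk : k = i
    · subst hk; rw [update_self, ha]
    · rw [update_of_ne hk]
  have hmod : c i % d = 0 := by
    have h := hmin hb (hupd (c i % d) (by
      rw [Int.emod_def, sub_smul, mul_comm, mul_smul, hdb, smul_zero, sub_zero])) i
      (by rw [update_self]; exact Int.emod_nonneg _ hd'.ne')
      (by rw [update_self]; exact Int.emod_lt_of_pos _ hd')
    rwa [update_self] at h
  have hdi : (d : ℤ) ∣ c i := Int.dvd_of_emod_eq_zero hmod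
  by_cases hij : j = i
  · rw [hij]; exact hdi
  have h := hdvd hb (hupd d (by
    obtain ⟨e, he⟩ := hdi
    rw [hdb, he, mul_comm, mul_smul, hdb, smul_zero])) (update_self ..) j
  rwa [update_of_ne hij] at h

/-- A class of systems in a group that is closed under elementary moves, and whose images in an
abelian group generate, contains a system whose image is a minimal generating system followed by
zeros. -/
theorem exists_minimal_image {C : Type*} [Group C] (φ : C →* Multiplicative H) {k : ℕ}
    {P : (Fin k → C) → Prop}
    (hP : ∀ β i j (q : ℤ), i ≠ j → P β → P (update β i (β i * β j ^ q)))
    (hperm : ∀ β (e : Equiv.Perm (Fin k)), P β → P (β ∘ e))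
    (hgen : ∀ β, P β → AddSubgroup.closure (Set.range fun i => (φ (β i)).toAdd) = ⊤)
    {β₀ : Fin k → C} (hβ₀ : P β₀) :
    ∃ (s : ℕ) (hs : s ≤ k) (α : Fin k → C), P α ∧
      IsMinimalGenerating (fun i : Fin s => (φ (α (Fin.castLE hs i))).toAdd) ∧
      ∀ i : Fin k, s ≤ (i : ℕ) → (φ (α i)).toAdd = 0 := by
  classical
  have hex : ∃ m, ∃ g : Fin m → H, AddSubgroup.closure (Set.range g) = ⊤ := ⟨k, _, hgen _ hβ₀⟩
  obtain ⟨g, hg⟩ := Nat.find_spec hex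
  have hmin {m : ℕ} (g : Fin m → H) (hg : AddSubgroup.closure (Set.range g) = ⊤) :
      Nat.find hex ≤ m := Nat.find_min' hex ⟨g, hg⟩
  set s := Nat.find hex
  have hexT : ∃ m, ∃ T : Finset (Fin k), T.card = m ∧ ∃ β, P β ∧ ∀ i ∉ T, (φ (β i)).toAdd = 0 :=
    ⟨_, Finset.univ, rfl, β₀, hβ₀, by simp⟩
  obtain ⟨T, hT, β, hβ, hβT⟩ := Nat.find_spec hexT
  have hres {β : Fin k → C} (hβ : P β) (hβT : ∀ i ∉ T, (φ (β i)).toAdd = 0) :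
      AddSubgroup.closure (Set.range fun i : T => (φ (β i)).toAdd) = ⊤ := by
    rw [eq_top_iff, ← hgen β hβ, AddSubgroup.closure_le]
    rintro _ ⟨i, rfl⟩
    by_cases hi : i ∈ T
    · exact AddSubgroup.subset_closure ⟨⟨i, hi⟩, rfl⟩
    · simp only [hβT i hi]
      exact AddSubgroup.zero_mem _
  have hle : T.card ≤ s := by
    by_contra! hlt
    obtain ⟨b, ⟨β, hβ, hβT, rfl⟩, i, hi⟩ := exists_apply_eq_zero (ι := T)
      (P := fun b => ∃ β, P β ∧ (∀ i ∉ T, (φ (β i)).toAdd = 0) ∧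
        b = fun i : T => (φ (β i)).toAdd)
      (by
        rintro _ i j q hij ⟨β, hβ, hβT, rfl⟩
        refine ⟨_, hP β i j q (fun h => hij (Subtype.ext h)) hβ, fun l hl => ?_, ?_⟩
        · rw [update_of_ne (fun h : l = i.1 => hl (h ▸ i.2))]
          exact hβT l hl
        · funext l
          by_cases hl : l = i
          · subst hl
            simp [toAdd_mul, toAdd_zpow]
          · rw [update_of_ne hl, update_of_ne (fun h => hl (Subtype.ext h))])
      (by rintro _ ⟨β, hβ, hβT, rfl⟩; exact hres hβ hβT) hg (by rwa [Fintype.card_coe])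
      ⟨β, hβ, hβT, rfl⟩
    refine Nat.find_min hexT (m := (T.erase i).card) ?_ ⟨T.erase i, rfl, β, hβ, fun l hl => ?_⟩
    · rw [← hT]; exact Finset.card_erase_lt_of_mem i.2
    · by_cases hli : l = i
      · rw [hli]; exact hi
      · exact hβT l fun h => hl (Finset.mem_erase.2 ⟨hli, h⟩)
  have hge : s ≤ T.card := by
    refine hmin (fun j => (φ (β (T.equivFin.symm j))).toAdd) ?_
    rw [← hres hβ hβT]
    congr 1
    exact T.equivFin.symm.surjective.range_comp (fun i : T => (φ (β i)).toAdd)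
  have hcard : T.card = s := le_antisymm hle hge
  have hsk : s ≤ k := by
    rw [← hcard]
    simpa using T.card_le_univ
  -- move the members outside `T` to the end
  let e₀ : {i : Fin k // (i : ℕ) < s} ≃ {i : Fin k // i ∈ T} := Fintype.equivOfCardEq (by
    rw [Fintype.card_coe, hcard, Fintype.card_subtype]
    exact Fin.card_filter_val_lt.trans (min_eq_right hsk))
  let e : Equiv.Perm (Fin k) := e₀.extendSubtype
  have hzero (i : Fin k) (hi : s ≤ (i : ℕ)) : (φ ((β ∘ e) i)).toAdd = 0 :=
    hβT _ (e₀.extendSubtype_not_mem i (not_lt.2 hi))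
  refine ⟨s, hsk, β ∘ e, hperm β e hβ, ⟨?_, fun m g hg => hmin g hg⟩, hzero⟩
  rw [eq_top_iff, ← hgen _ (hperm β e hβ), AddSubgroup.closure_le]
  rintro _ ⟨i, rfl⟩
  by_cases hi : (i : ℕ) < s
  · exact AddSubgroup.subset_closure ⟨⟨i, hi⟩, rfl⟩
  · simp only [hzero i (not_lt.1 hi)]
    exact AddSubgroup.zero_mem _

end Nielsen

namespace CrossedModule

variable {C G H : Type*} [Group C] [Group G] [MulDistribMulAction G C] [AddCommGroup H]

/-- A finitely generated crossed module that maps onto an abelian group, with trivial action of the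
operators on the latter, has a minimal generating system whose image is a minimal generating system
followed by zeros. -/
theorem exists_isMinimalGenerating (M : CrossedModule C G) (φ : C →* Multiplicative H)
    (hφ : Function.Surjective φ) (hsmul : ∀ (g : G) (c : C), φ (g • c) = φ c)
    (hfg : ∃ (k : ℕ) (β : Fin k → C), M.Generates β) :
    ∃ (k s : ℕ) (hs : s ≤ k) (α : Fin k → C), M.IsMinimalGenerating α ∧
      _root_.IsMinimalGenerating (fun i : Fin s => (φ (α (Fin.castLE hs i))).toAdd) ∧
      ∀ i : Fin k, s ≤ (i : ℕ) → (φ (α i)).toAdd = 0 := by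
  classical
  obtain ⟨β, hβ⟩ := Nat.find_spec hfg
  obtain ⟨s, hs, α, hα, h1, h2⟩ := Nielsen.exists_minimal_image φ (P := M.Generates)
    (fun β i j q hij hβ K hK hm => hβ K hK fun l => by
      have hj : β j ∈ K := by simpa [Function.update_of_ne hij.symm] using hm j
      by_cases hl : l = i
      · subst hl
        have := hm l
        rw [Function.update_self] at this
        exact (K.mul_mem_cancel_right (K.zpow_mem hj q)).1 this
      · simpa [Function.update_of_ne hl] using hm l)
    (fun β e hβ K hK hm => hβ K hK fun l => by simpa using hm (e.symm l))
    (fun β hβ => by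
      have h := hβ ((AddSubgroup.toSubgroup (AddSubgroup.closure
        (Set.range fun i => (φ (β i)).toAdd))).comap φ)
        (fun g c hc => by
          rw [Subgroup.mem_comap, hsmul]
          exact hc)
        (fun i => AddSubgroup.subset_closure ⟨i, rfl⟩)
      refine eq_top_iff.2 fun a _ => ?_
      obtain ⟨c, hc⟩ := hφ (Multiplicative.ofAdd a)
      have hmem : c ∈ (AddSubgroup.toSubgroup (AddSubgroup.closure
        (Set.range fun i => (φ (β i)).toAdd))).comap φ := h ▸ Subgroup.mem_top c
      have : φ c ∈ AddSubgroup.toSubgroup (AddSubgroup.closure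
        (Set.range fun i => (φ (β i)).toAdd)) := hmem
      rw [hc] at this
      exact this) hβ
  exact ⟨_, s, hs, α, ⟨hα, fun m β hβ => Nat.find_min' hfg ⟨β, hβ⟩⟩, h1, h2⟩

end CrossedModule

theorem mainTheorem4 {W : Type*} [TopologicalSpace W] [T2Space W] [CompactSpace W]
    [SimplyConnectedSpace W] [ChartedSpace (EuclideanHalfSpace 5) W] (V₀ V₁ : Set W)
    (hV₀ : ∃ y ∈ (𝓡∂ 5).boundary W, V₀ = connectedComponentIn ((𝓡∂ 5).boundary W) y)
    (hV₁ : ∃ y ∈ (𝓡∂ 5).boundary W, V₁ = connectedComponentIn ((𝓡∂ 5).boundary W) y)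
    (hne : V₀ ≠ V₁) (hV : (𝓡∂ 5).boundary W = V₀ ∪ V₁) (x : V₁) :
    ∃ (k s : ℕ) (hs : s ≤ k) (α : Fin k → RelPi2 V₁ x),
      (RelPi2.crossedModule V₁ x).IsMinimalGenerating α ∧
      IsMinimalGenerating (fun i : Fin s => RelPi2.hurewicz V₁ x (α (Fin.castLE hs i))) ∧
      ∀ i : Fin k, s ≤ (i : ℕ) → RelPi2.hurewicz V₁ x (α i) = 0 := by
  obtain ⟨y, hy, rfl⟩ := hV₁
  have : SecondCountableTopology (EuclideanHalfSpace 5) :=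
    inferInstanceAs (SecondCountableTopology {v : EuclideanSpace ℝ (Fin 5) // 0 ≤ v 0})
  have := ChartedSpace.secondCountable_of_sigmaCompact (EuclideanHalfSpace 5) W
  have : TopologicalSpace.MetrizableSpace W := inferInstance
  have := TopManifold.stronglyLocallyContractible 5 W
  have := TopManifold.stronglyLocallyContractible_boundary_component (n := 5) (W := W) y
  have := TopManifold.pathConnected_boundary_component hy
  have := TopManifold.compact_boundary_component (n := 5) (W := W) (y := y)
  exact (RelPi2.crossedModule _ x).exists_isMinimalGenerating (RelPi2.hurewiczHom _ x)
    (fun a => RelPi2.hurewicz_surjective a) RelPi2.hurewiczHom_smul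
    (RelPi2.exists_finite_generates (SmallPaths.exists_finite_generators x))
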